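/- Let $\Gamma$ be a finite subgroup of $\mathbb{C}^\times$ (the group of $N$-th roots of unity for some $N\ge 1$). Let $X=\{x_\sigma:\sigma\in\Gamma\cup\{0\}\}$ and $Y=\{y_{n,\nu}: n\in\mathbb{Z}_{\ge 1},\ \nu\in\Gamma\}$ be alphabets of noncommuting letters; put $y_{0,1}=1$ and $y_{0,\nu}=0$ for $\nu\ne 1$. Let $\Delta$ and $\Delta_*$ be the coproducts on $\mathbb{C}\langle\!\langle X\rangle\!\rangle$ and $\mathbb{C}\langle\!\langle Y\rangle\!\rangle$ that are multiplicative for concatenation, with $$\Delta(x_\sigma)=x_\sigma\otimes 1+1\otimes x_\sigma,\qquad \Delta_*(y_{n,\nu})=\sum_{\substack{k+l=n,\ k,l\ge 0\\ \kappa\lambda=\nu}}y_{k,\kappa}\otimes y_{l,\lambda}.$$ A series $\Phi$ is called diagonal if its constant term is $1$ and its coproduct is $\Phi\otimes\Phi$. Let $$\mathrm{Li}_{s_1,\dots,s_r}(z_1,\dots,z_r)=\lim_{M\to\infty}\sum_{M\ge k_1>\cdots>k_r>0}\frac{z_1^{k_1}\cdots z_r^{k_r}}{k_1^{s_1}\cdots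 k_r^{s_r}},\qquad I_{[0,1]}(\sigma_1,\dots,\sigma_r)=\int_{1\ge t_1\ge\cdots\ge t_r\ge 0}\ \prod_{i=1}^r\omega_{\sigma_i}(t_i),$$ with $\omega_0(t)=dt/t$ and $\omega_\sigma(t)=dt/(\sigma^{-1}-t)$ for $\sigma\in\Gamma$. (a) There is a unique series $\mathcal{L}\in\mathbb{C}\langle\!\langle Y\rangle\!\rangle$, diagonal for $\Delta_*$, in which the coefficient of $y_{1,1}$ is $0$ and the coefficient of every word $y_{s_1,\sigma_1}\cdots y_{s_r,\sigma_r}$ not beginning with $y_{1,1}$ is $\mathrm{Li}_{s_1,\dots,s_r}(\sigma_1,\dots,\sigma_r)$ (for these words the limit exists). (b) There is a unique series $\mathcal{I}\in\mathbb{C}\langle\!\langle X\rangle\!\rangle$, diagonal for $\Delta$, in which the coefficients of $x_0$ and $x_1$ are $0$ and the coefficient of every word $x_{\sigma_1}\cdots x_{\sigma_r}$ not beginning with $x_1$ and not ending with $x_0$ is $I_{[0,1]}(\sigma_1,\dots,\sigma_r)$ (for these words the integral converges absolutely). (c) Let $T$ be a commuting variable. Define $\mathrm{Li}^{*}_{s_1,\dots,s_r}(\sigma_1,\dots,\sigma_r)\in\mathbb{C}[T]$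 as the coefficient of $y_{s_1,\sigma_1}\cdots y_{s_r,\sigma_r}$ in $\exp(Ty_{1,1})\cdot\mathcal{L}$, and $I^{\mathrm{sh}}_{[0,1]}(\sigma_1,\dots,\sigma_n)\in\mathbb{C}[T]$ as the coefficient of $x_{\sigma_1}\cdots x_{\sigma_n}$ in $\exp(Tx_1)\cdot\mathcal{I}$. Let $A(u)=S(u)^{-1}$, where $S(u)=\exp\Big(\sum_{n\ge 2}\frac{(-1)^{n-1}\zeta(n)}{n}u^n\Big)$, and let $\rho:\mathbb{C}[T]\to\mathbb{C}[T]$ be the $\mathbb{C}$-linear map such that, coefficientwise in $u$, $\rho(e^{Tu})=A(u)e^{Tu}$. Then for all $r\ge 0$, all positive integers $s_1,\dots,s_r$ and all $\sigma_1,\dots,\sigma_r\in\Gamma$, $$\rho\big(\mathrm{Li}^{*}_{s_1,\dots,s_r}(\sigma_1,\sigma_2\sigma_1^{-1},\dots,\sigma_r\sigma_{r-1}^{-1})\big)=I^{\mathrm{sh}}_{[0,1]}(\{0\}^{s_1-1},\sigma_1,\dots,\{0\}^{s_r-1},\sigma_r),$$ where $\{0\}^{m}$ denotes $m$ consecutive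 entries $0$. -/

import Mathlib

open Filter Topology MeasureTheory

noncomputable section

/-! ### Noncommutative formal power series -/

/-- The set `R⟨⟨A⟩⟩` of formal power series in the noncommuting letters `A` with coefficients
in `R`; `Φ w` is the coefficient of the word `w`. -/
def NCSeries (A R : Type*) : Type _ := FreeMonoid A → R

namespace NCSeries

variable {A R S : Type*}

/-- The concatenation (Cauchy) product: the coefficient of `w` in `Φ * Ψ` is the sum of
`Φ u * Ψ v` over all factorizations `w = u v`. -/
instance [Semiring R] : Mul (NCSeries A R) where
  mul Φ Ψ := fun w => ∑ i ∈ Finset.range (w.toList.length + 1),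
    Φ (FreeMonoid.ofList (w.toList.take i)) * Ψ (FreeMonoid.ofList (w.toList.drop i))

/-- Apply a map to all coefficients. -/
def mapCoeff (f : R → S) (Φ : NCSeries A R) : NCSeries A S := fun w => f (Φ w)

open Classical in
/-- Substitution `f(a) = ∑ f_n a^n` of the letter `a` into a power series `f` in one variable. -/
def ofLetter [Semiring R] (a : A) (f : PowerSeries R) : NCSeries A R := fun w =>
  if w = FreeMonoid.of a ^ w.toList.length then PowerSeries.coeff w.toList.length f else 0

/-- A coproduct on `ℂ⟨A⟩`, multiplicative for concatenation, is given by its values on words.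
Here `MonoidAlgebra ℂ (FreeMonoid A × FreeMonoid A)` is `ℂ⟨A⟩ ⊗ ℂ⟨A⟩`, the basis element
indexed by `(u, v)` being `u ⊗ v`. For such a coproduct `Δ`, this is the coefficient
of `u ⊗ v` in `Δ Φ`. -/
def coproductCoeff (Δ : FreeMonoid A →* MonoidAlgebra ℂ (FreeMonoid A × FreeMonoid A))
    (Φ : NCSeries A ℂ) (u v : FreeMonoid A) : ℂ :=
  ∑ᶠ w : FreeMonoid A, Φ w * (Δ w).coeff (u, v)

/-- `Φ` is diagonal: `ε(Φ) = 1` and `Δ Φ = Φ ⊗ Φ`. -/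
def IsDiagonal (Δ : FreeMonoid A →* MonoidAlgebra ℂ (FreeMonoid A × FreeMonoid A))
    (Φ : NCSeries A ℂ) : Prop :=
  Φ 1 = 1 ∧ ∀ u v : FreeMonoid A, coproductCoeff Δ Φ u v = Φ u * Φ v

end NCSeries

/-! ### The two alphabets and their coproducts -/

section Alphabets

/-- The alphabet `X = {x_σ : σ ∈ Γ ∪ {0}}`. -/
abbrev XLetter (Γ : Subgroup ℂˣ) : Type := WithZero Γ

/-- The alphabet `Y = {y_{n,ν} : n ≥ 1, ν ∈ Γ}`. -/
abbrev YLetter (Γ : Subgroup ℂˣ) : Type := ℕ+ × Γ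

/-- The coproduct on `ℂ⟨X⟩`: all letters are primitive, `Δ x = x ⊗ 1 + 1 ⊗ x`. -/
def shuffleCoproduct (Γ : Subgroup ℂˣ) :
    FreeMonoid (XLetter Γ) →*
      MonoidAlgebra ℂ (FreeMonoid (XLetter Γ) × FreeMonoid (XLetter Γ)) :=
  FreeMonoid.lift fun x =>
    MonoidAlgebra.single (FreeMonoid.of x, 1) 1 + MonoidAlgebra.single (1, FreeMonoid.of x) 1

open Classical in
/-- `y_{n,ν}` as an element of `ℂ⟨Y⟩`, extended to `n = 0` by `y_{0,1} = 1` and `y_{0,ν} = 0`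
for `ν ≠ 1`. -/
def yElem (Γ : Subgroup ℂˣ) (n : ℕ) (ν : Γ) : MonoidAlgebra ℂ (FreeMonoid (YLetter Γ)) :=
  if h : 0 < n then MonoidAlgebra.single (FreeMonoid.of (⟨n, h⟩, ν)) 1
  else if ν = 1 then 1 else 0

/-- The pure tensor `p ⊗ q`, in the algebra with basis the `u ⊗ v`. -/
def pureTensor {M : Type*} [Monoid M] (p q : MonoidAlgebra ℂ M) : MonoidAlgebra ℂ (M × M) :=
  MonoidAlgebra.mapDomain (fun u : M => (u, (1 : M))) p *
    MonoidAlgebra.mapDomain (fun v : M => ((1 : M), v)) q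

/-- The coproduct on `ℂ⟨Y⟩`:
`Δ_* y_{n,ν} = ∑_{k + l = n, κ λ = ν} y_{k,κ} ⊗ y_{l,λ}` (with `k, l ≥ 0`). -/
def stuffleCoproduct (Γ : Subgroup ℂˣ) [Fintype Γ] :
    FreeMonoid (YLetter Γ) →*
      MonoidAlgebra ℂ (FreeMonoid (YLetter Γ) × FreeMonoid (YLetter Γ)) :=
  FreeMonoid.lift fun y =>
    ∑ kl ∈ Finset.HasAntidiagonal.antidiagonal (y.1 : ℕ), ∑ κ : Γ,
      pureTensor (yElem Γ kl.1 κ) (yElem Γ kl.2 (κ⁻¹ * y.2))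

end Alphabets

/-! ### The sums defining the coefficients of `Δ Φ` are finite -/

/-- All words occurring in `p` have degree `n`. -/
def IsHomogeneousOfDegree {P : Type*} [Monoid P] (d : P →* Multiplicative ℕ)
    (p : MonoidAlgebra ℂ P) (n : Multiplicative ℕ) : Prop :=
  ∀ m : P, p.coeff m ≠ 0 → d m = n

namespace IsHomogeneousOfDegree

variable {P : Type*} [Monoid P] {d : P →* Multiplicative ℕ}

theorem add {p q : MonoidAlgebra ℂ P} {n : Multiplicative ℕ}
    (hp : IsHomogeneousOfDegree d p n) (hq : IsHomogeneousOfDegree d q n) :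
    IsHomogeneousOfDegree d (p + q) n := by
  intro m hm
  by_cases h : p.coeff m = 0
  · exact hq m fun h' => hm (by simp [h, h'])
  · exact hp m h

theorem sum {ι : Type*} {s : Finset ι} {p : ι → MonoidAlgebra ℂ P} {n : Multiplicative ℕ}
    (hp : ∀ i ∈ s, IsHomogeneousOfDegree d (p i) n) :
    IsHomogeneousOfDegree d (∑ i ∈ s, p i) n := by
  classical
  induction s using Finset.induction_on with
  | empty => intro m hm; simp at hm
  | insert a s ha ih =>
    rw [Finset.sum_insert ha]
    exact (hp a (by simp)).add (ih fun i hi => hp i (by simp [hi]))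

theorem single (m : P) (c : ℂ) :
    IsHomogeneousOfDegree d (MonoidAlgebra.single m c) (d m) := by
  classical
  intro m' hm'
  rw [MonoidAlgebra.coeff_single, Finsupp.single_apply] at hm'
  by_cases h : m = m'
  · rw [h]
  · exact absurd (if_neg h) hm'

theorem mul {p q : MonoidAlgebra ℂ P} {n k : Multiplicative ℕ}
    (hp : IsHomogeneousOfDegree d p n) (hq : IsHomogeneousOfDegree d q k) :
    IsHomogeneousOfDegree d (p * q) (n * k) := by
  classical
  intro m hm
  have := MonoidAlgebra.support_coeff_mul_subset p q (Finsupp.mem_support_iff.2 hm)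
  obtain ⟨a, ha, b, hb, rfl⟩ := Finset.mem_mul.1 this
  rw [map_mul, hp a (Finsupp.mem_support_iff.1 ha), hq b (Finsupp.mem_support_iff.1 hb)]

theorem lift {A : Type*} {δ : A → MonoidAlgebra ℂ P} {wt : A → Multiplicative ℕ}
    (h : ∀ a, IsHomogeneousOfDegree d (δ a) (wt a)) (w : FreeMonoid A) :
    IsHomogeneousOfDegree d (FreeMonoid.lift δ w) (FreeMonoid.lift wt w) := by
  induction w using FreeMonoid.recOn with
  | one =>
    rw [map_one, map_one, MonoidAlgebra.one_def]
    simpa using single (d := d) (1 : P) (1 : ℂ)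
  | of_mul a w ih =>
    rw [map_mul, map_mul, FreeMonoid.lift_eval_of, FreeMonoid.lift_eval_of]
    exact (h a).mul ih

end IsHomogeneousOfDegree

/-- The total degree of a pair of words, for given degrees of the letters. -/
def pairDegree {A : Type*} (wt : A → ℕ) :
    FreeMonoid A × FreeMonoid A →* Multiplicative ℕ :=
  MonoidHom.coprod (FreeMonoid.lift fun a => Multiplicative.ofAdd (wt a))
    (FreeMonoid.lift fun a => Multiplicative.ofAdd (wt a))

theorem finite_words_of_degree {A : Type*} (wt : A → ℕ) (hpos : ∀ a, 0 < wt a)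
    (hfin : ∀ n, {a | wt a ≤ n}.Finite) (n : Multiplicative ℕ) :
    {w : FreeMonoid A | FreeMonoid.lift (fun a => Multiplicative.ofAdd (wt a)) w = n}.Finite := by
  have key : ∀ w : FreeMonoid A,
      w.toList.length ≤ (FreeMonoid.lift (fun a => Multiplicative.ofAdd (wt a)) w).toAdd ∧
      ∀ a ∈ w.toList, wt a ≤ (FreeMonoid.lift (fun a => Multiplicative.ofAdd (wt a)) w).toAdd := by
    intro w
    induction w using FreeMonoid.recOn with
    | one => simp
    | of_mul a w ih =>
      rw [map_mul (FreeMonoid.lift _), FreeMonoid.lift_eval_of, toAdd_mul, toAdd_ofAdd,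
        FreeMonoid.toList_of_mul]
      have := hpos a
      refine ⟨by simp only [List.length_cons]; omega, fun b hb => ?_⟩
      rcases List.mem_cons.1 hb with rfl | hb
      · omega
      · have := ih.2 b hb; omega
  have : Finite {a | wt a ≤ n.toAdd} := hfin n.toAdd
  refine ((List.finite_length_le {a | wt a ≤ n.toAdd} n.toAdd).image
    fun l => FreeMonoid.ofList (l.map Subtype.val)).subset fun w hw => ?_
  obtain ⟨h1, h2⟩ := key w
  have hw' : FreeMonoid.lift (fun a => Multiplicative.ofAdd (wt a)) w = n := hw
  rw [hw'] at h1 h2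
  refine ⟨w.toList.attach.map fun a => ⟨a.1, h2 a.1 a.2⟩, by simpa using h1, ?_⟩
  simp [List.map_map, Function.comp_def]

theorem shuffleCoproduct_finite (Γ : Subgroup ℂˣ) [Finite Γ] (u v : FreeMonoid (XLetter Γ)) :
    {w | (shuffleCoproduct Γ w).coeff (u, v) ≠ 0}.Finite := by
  have : Finite (XLetter Γ) := inferInstanceAs (Finite (Option Γ))
  refine (finite_words_of_degree (fun _ : XLetter Γ => 1) (fun _ => one_pos)
    (fun _ => Set.toFinite _) (pairDegree (fun _ : XLetter Γ => 1) (u, v))).subset fun w hw => ?_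
  refine (IsHomogeneousOfDegree.lift (d := pairDegree fun _ : XLetter Γ => 1)
    (fun a => ?_) w (u, v) hw).symm
  refine .add ?_ ?_
  · simpa [pairDegree] using
      IsHomogeneousOfDegree.single (d := pairDegree fun _ : XLetter Γ => 1) (FreeMonoid.of a, 1) 1
  · simpa [pairDegree] using
      IsHomogeneousOfDegree.single (d := pairDegree fun _ : XLetter Γ => 1) (1, FreeMonoid.of a) 1

theorem stuffleCoproduct_finite (Γ : Subgroup ℂˣ) [Fintype Γ] (u v : FreeMonoid (YLetter Γ)) :
    {w | (stuffleCoproduct Γ w).coeff (u, v) ≠ 0}.Finite := by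
  have zero : ∀ n, IsHomogeneousOfDegree (pairDegree fun y : YLetter Γ => (y.1 : ℕ)) 0 n :=
    fun n m hm => absurd rfl hm
  have one : IsHomogeneousOfDegree (pairDegree fun y : YLetter Γ => (y.1 : ℕ)) 1 1 := by
    rw [MonoidAlgebra.one_def]
    simpa using IsHomogeneousOfDegree.single
      (d := pairDegree fun y : YLetter Γ => (y.1 : ℕ)) 1 1
  refine (finite_words_of_degree (fun y : YLetter Γ => (y.1 : ℕ)) (fun y => y.1.pos)
    (fun n => ?_) (pairDegree (fun y : YLetter Γ => (y.1 : ℕ)) (u, v))).subset fun w hw => ?_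
  · have h : {y : ℕ+ × Γ | (y.1 : ℕ) ≤ n} ⊆
        (fun y : ℕ+ × Γ => ((y.1 : ℕ), y.2)) ⁻¹' (Set.Iic n ×ˢ Set.univ) := by
      intro y hy; simpa using hy
    refine Set.Finite.subset (Set.Finite.preimage ?_
      ((Set.finite_Iic n).prod Set.finite_univ)) h
    intro a _ b _ hab
    simp only [Prod.mk.injEq] at hab
    exact Prod.ext (PNat.coe_injective hab.1) hab.2
  · refine (IsHomogeneousOfDegree.lift
      (d := pairDegree fun y : YLetter Γ => (y.1 : ℕ)) (fun y => ?_) w (u, v) hw).symm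
    refine .sum fun kl hkl => .sum fun κ _ => ?_
    rw [← Finset.HasAntidiagonal.mem_antidiagonal.1 hkl, ofAdd_add]
    refine .mul ?_ ?_
    · unfold yElem
      split_ifs with h h'
      · rw [MonoidAlgebra.mapDomain_single]
        simpa [pairDegree] using IsHomogeneousOfDegree.single
          (d := pairDegree fun y : YLetter Γ => (y.1 : ℕ)) (FreeMonoid.of (⟨kl.1, h⟩, κ), 1) 1
      · rw [MonoidAlgebra.one_def, MonoidAlgebra.mapDomain_single, Nat.eq_zero_of_not_pos h]
        exact one
      · simpa using zero _
    · unfold yElem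
      split_ifs with h h'
      · rw [MonoidAlgebra.mapDomain_single]
        simpa [pairDegree] using IsHomogeneousOfDegree.single
          (d := pairDegree fun y : YLetter Γ => (y.1 : ℕ))
          (1, FreeMonoid.of (⟨kl.2, h⟩, κ⁻¹ * y.2)) 1
      · rw [MonoidAlgebra.one_def, MonoidAlgebra.mapDomain_single, Nat.eq_zero_of_not_pos h]
        exact one
      · simpa using zero _

/-! ### Polylogarithm series and iterated integrals -/

/-- The partial sum over `M ≥ k_1 > ⋯ > k_r > 0` of `∏ z_i ^ k_i / k_i ^ s_i`. -/
def polylogPartialSum {r : ℕ} (s : Fin r → ℕ) (z : Fin r → ℂ) (M : ℕ) : ℂ :=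
  open Classical in
  ∑ k ∈ (Fintype.piFinset fun _ : Fin r => Finset.Icc 1 M).filter StrictAnti,
    ∏ i, z i ^ k i / (k i : ℂ) ^ s i

/-- The series `Li_{s_1,…,s_r}(z_1,…,z_r)` converges (its outermost index `k_1` being summed in
increasing order) and its sum is `l`. -/
def HasPolylog {r : ℕ} (s : Fin r → ℕ) (z : Fin r → ℂ) (l : ℂ) : Prop :=
  Tendsto (polylogPartialSum s z) atTop (𝓝 l)

/-- The density of `ω_σ`: `ω_0 = dt / t`, and `ω_σ = dt / (σ⁻¹ - t)` for `σ ≠ 0`. -/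
def omegaDensity {Γ : Subgroup ℂˣ} : XLetter Γ → ℝ → ℂ
  | none, t => 1 / (t : ℂ)
  | some σ, t => 1 / (((σ : ℂˣ) : ℂ)⁻¹ - (t : ℂ))

/-- The simplex `1 ≥ t_1 ≥ ⋯ ≥ t_r ≥ 0`. -/
def orderedSimplex (r : ℕ) : Set (Fin r → ℝ) :=
  {t | (∀ i, t i ∈ Set.Icc (0 : ℝ) 1) ∧ Antitone t}

/-- The iterated integral `I_{[0,1]}(σ_1,…,σ_r)` converges (absolutely), and its value is `l`. -/
def HasIteratedIntegral {Γ : Subgroup ℂˣ} {r : ℕ} (σ : Fin r → XLetter Γ) (l : ℂ) : Prop :=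
  IntegrableOn (fun t : Fin r → ℝ => ∏ i, omegaDensity (σ i) (t i)) (orderedSimplex r) ∧
    ∫ t in orderedSimplex r, ∏ i, omegaDensity (σ i) (t i) = l

/-! ### The regularized generating series -/

/-- The defining properties of the series `ℒ`: it is diagonal for `Δ_*`, its image under `π_cv`
is the generating series `ℒ_cv` of the convergent `Li_{s_1,…,s_r}(σ_1,…,σ_r)`, i.e. those with
`(s_1, σ_1) ≠ (1, 1)`, and the coefficient of `y_{1,1}` is `0`. -/
structure IsPolylogSeries (Γ : Subgroup ℂˣ) [Fintype Γ] (L : NCSeries (YLetter Γ) ℂ) : Prop where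
  diagonal : NCSeries.IsDiagonal (stuffleCoproduct Γ) L
  convergent : ∀ w : FreeMonoid (YLetter Γ), w.toList.head? ≠ some (1, 1) →
    HasPolylog (fun i => ((w.toList.get i).1 : ℕ))
      (fun i => (((w.toList.get i).2 : ℂˣ) : ℂ)) (L w)
  coeff_y_one_one : L (FreeMonoid.of (1, 1)) = 0

/-- The defining properties of the series `ℐ`: it is diagonal for `Δ`, its image under `π_cv`
is the generating series `ℐ_cv` of the convergent `I_{[0,1]}(σ_1,…,σ_r)`, i.e. those with
`σ_1 ≠ 1` and `σ_r ≠ 0`, and the coefficients of `x_0` and `x_1` are `0`. -/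
structure IsIntegralSeries (Γ : Subgroup ℂˣ) (I : NCSeries (XLetter Γ) ℂ) : Prop where
  diagonal : NCSeries.IsDiagonal (shuffleCoproduct Γ) I
  convergent : ∀ w : FreeMonoid (XLetter Γ),
    w.toList.head? ≠ some 1 → w.toList.getLast? ≠ some 0 →
      HasIteratedIntegral (fun i => w.toList.get i) (I w)
  coeff_x_zero : I (FreeMonoid.of 0) = 0
  coeff_x_one : I (FreeMonoid.of 1) = 0

/-- The power series `e^{Tu}` in the variable `u` over `ℂ[T]`. -/
def expTu : PowerSeries (Polynomial ℂ) :=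
  PowerSeries.rescale Polynomial.X (PowerSeries.exp (Polynomial ℂ))

/-- `ℒ' = exp(T y_{1,1}) · ℒ`, a series over `ℂ[T]`. -/
def polylogSeriesT {Γ : Subgroup ℂˣ} (L : NCSeries (YLetter Γ) ℂ) :
    NCSeries (YLetter Γ) (Polynomial ℂ) :=
  NCSeries.ofLetter (1, 1) expTu * NCSeries.mapCoeff Polynomial.C L

/-- `ℐ' = exp(T x_1) · ℐ`, a series over `ℂ[T]`. -/
def integralSeriesT {Γ : Subgroup ℂˣ} (I : NCSeries (XLetter Γ) ℂ) :
    NCSeries (XLetter Γ) (Polynomial ℂ) :=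
  NCSeries.ofLetter 1 expTu * NCSeries.mapCoeff Polynomial.C I

/-- `Li^*_{s_1,…,s_r}(σ_1,…,σ_r)`: the coefficient of `y_{s_1,σ_1} ⋯ y_{s_r,σ_r}` in `ℒ'`. -/
def stuffleRegLi {Γ : Subgroup ℂˣ} (L : NCSeries (YLetter Γ) ℂ) {r : ℕ}
    (s : Fin r → ℕ+) (σ : Fin r → Γ) : Polynomial ℂ :=
  polylogSeriesT L (FreeMonoid.ofList (List.ofFn fun i => (s i, σ i)))

/-- `I^Ш_{[0,1]}(w)`: the coefficient in `ℐ'` of `x_{σ_1} ⋯ x_{σ_n}`, for the sequence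
`w = (σ_1,…,σ_n)` of elements of `Γ ∪ {0}`. -/
def shuffleRegI {Γ : Subgroup ℂˣ} (I : NCSeries (XLetter Γ) ℂ) (w : List (XLetter Γ)) :
    Polynomial ℂ :=
  integralSeriesT I (FreeMonoid.ofList w)

/-- The sequence `({0}^{s_1 - 1}, σ_1, …, {0}^{s_r - 1}, σ_r)`. -/
def integralIndex {Γ : Subgroup ℂˣ} {r : ℕ} (s : Fin r → ℕ+) (σ : Fin r → Γ) :
    List (XLetter Γ) :=
  (List.ofFn fun i => List.replicate ((s i : ℕ) - 1) (0 : XLetter Γ) ++ [((σ i : Γ) : XLetter Γ)]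
    ).flatten

/-- The sequence `(σ_1, σ_2 σ_1⁻¹, …, σ_r σ_{r-1}⁻¹)`. -/
def successiveRatios {G : Type*} [Group G] {r : ℕ} (σ : Fin r → G) : Fin r → G := fun i =>
  if (i : ℕ) = 0 then σ i else σ i * (σ ⟨(i : ℕ) - 1, by omega⟩)⁻¹

/-! ### The map `ρ` -/

/-- `S(u) = exp(∑_{n ≥ 2} (-1)^{n-1} ζ(n) u^n / n)`. -/
def seriesS : PowerSeries ℂ :=
  (PowerSeries.exp ℂ).subst
    (PowerSeries.mk fun n => if 2 ≤ n then (-1) ^ (n - 1) * riemannZeta n / (n : ℂ) else 0)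

/-- `A(u) = S(u)⁻¹`. -/
def seriesA : PowerSeries ℂ := seriesS⁻¹

/-- The `ℂ`-linear map `ρ : ℂ[T] → ℂ[T]` with `ρ(e^{Tu}) = A(u) e^{Tu}`, i.e. `ρ(T^n / n!)` is
the coefficient of `u^n` in `A(u) e^{Tu}`. -/
def rho : Polynomial ℂ →ₗ[ℂ] Polynomial ℂ :=
  (Polynomial.basisMonomials ℂ).constr ℂ fun n =>
    (n.factorial : ℂ) • PowerSeries.coeff n (PowerSeries.map Polynomial.C seriesA * expTu)

/-- `ρ`, applied to the coefficients of the powers of `u`, maps `e^{Tu}` to `A(u) e^{Tu}`. -/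
theorem rho_expTu (n : ℕ) :
    rho (PowerSeries.coeff n expTu) =
      PowerSeries.coeff n (PowerSeries.map Polynomial.C seriesA * expTu) := by
  have h : PowerSeries.coeff n expTu = ((n.factorial : ℂ)⁻¹) • Polynomial.monomial n (1 : ℂ) := by
    simp only [expTu, PowerSeries.coeff_rescale, PowerSeries.coeff_exp]
    rw [Polynomial.smul_monomial, smul_eq_mul, mul_one, ← Polynomial.C_mul_X_pow_eq_monomial,
      mul_comm]
    congr 1
    rw [IsScalarTower.algebraMap_apply ℚ ℂ (Polynomial ℂ), Polynomial.algebraMap_eq]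
    simp
  have h2 : rho (Polynomial.monomial n (1 : ℂ)) = (n.factorial : ℂ) •
      PowerSeries.coeff n (PowerSeries.map Polynomial.C seriesA * expTu) := by
    have := (Polynomial.basisMonomials ℂ).constr_basis ℂ (fun n : ℕ => (n.factorial : ℂ) •
      PowerSeries.coeff n (PowerSeries.map Polynomial.C seriesA * expTu)) n
    rwa [Polynomial.coe_basisMonomials] at this
  rw [h, map_smul, h2, smul_smul, inv_mul_cancel₀ (by exact_mod_cast n.factorial_ne_zero),
    one_smul]

end

/-! A series is diagonal exactly when its coefficients form a character of the quasi-shuffle algebra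
of words, because the coefficient of `u ⊗ v` in `Δ w` counts how often `w` occurs in the
quasi-shuffle of `u` and `v` (`coeff_coproduct_eq_count`, `isDiagonal_iff_isShuffleChar`).
Quasi-shuffling with a letter `a` that never arises by merging strips leading letters `a`, so a
character is determined by its values on `a` and on the words not beginning with `a`
(`IsShuffleChar.mem_of_head?_ne` and its corollaries). This gives uniqueness in (a) and (b), and
reduces every later identity between characters to the convergent words and the letters `y_{1,1}`,
`x_0`, `x_1`.

Existence comes from asymptotics. For fixed `M` the truncated sums form a stuffle character. On
words not beginning with `y_{1,1}` they converge with error `O(M^{-1/2})`, and on `y_{1,1}` they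
give the harmonic number `H_M`. Hence each truncated sum is a polynomial `P_w(H_M)` up to an error
smaller than every power of `1/H_M`. Such a polynomial is unique, so `w ↦ P_w` is a character over
`ℂ[T]`; its value at `T = 0` is `ℒ`, and it equals `exp(T y_{1,1}) ℒ` (`polylogPoly_eq`). Similarly,
the iterated integrals from `0` to `t`, regularized so that `dt/t` integrates to `0`, form a shuffle
character. At `t = 1 - 1/K` they have expansion polynomials in `log K`, which give `ℐ` and `exp(T
x_1) ℐ` (`integralPoly_eq`).

The bridge is that expanding the `ω_σ` in geometric series turns the integral of `({0}^{s_1-1}, σ_1,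
…)` up to `t` into the Abel mean `(1 - t) ∑ a_M t^M` of the truncated sums `a_M` of the word of
successive ratios (`one_sub_X_mul_mk_truncatedSum`). It remains to see that Abel means act on
polynomials in `H_M` as `ρ` (`HasExpansion.abelMean`). The truncated sums of the powers of `y_{1,1}`
have generating series `∏_{k ≤ M} (1 + u/k) = e^{H_M u} / A_M(u)` with `A_M → A`. Their Abel means
have generating series exactly `e^{u log K}`, since `x_1^n` is `1/n!` times a shuffle power of
`x_1`. So the Abel mean of `e^{H_M u}` is `A(u) e^{u log K}` up to negligible terms. Applied to
`P_w`, this yields the expansions of the integrals and (c) together. -/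

/-! ### Quasi-shuffles of words -/

section QuasiShuffle

variable {A : Type*}

/-- The quasi-shuffle of two words, as a multiset of words; `m a b` is the letter obtained by
merging `a` and `b`, if there is one. -/
def quasiShuffle (m : A → A → Option A) : List A → List A → Multiset (List A)
  | [], v => {v}
  | a :: u, [] => {a :: u}
  | a :: u, b :: v =>
    (quasiShuffle m u (b :: v)).map (List.cons a) +
      (quasiShuffle m (a :: u) v).map (List.cons b) +
      (m a b).elim 0 fun c => (quasiShuffle m u v).map (List.cons c)
termination_by u v => u.length + v.length

@[simp] theorem quasiShuffle_nil_left (m : A → A → Option A) (v : List A) :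
    quasiShuffle m [] v = {v} := by
  rw [quasiShuffle]

@[simp] theorem quasiShuffle_nil_right (m : A → A → Option A) (u : List A) :
    quasiShuffle m u [] = {u} := by
  cases u <;> rw [quasiShuffle]

theorem quasiShuffle_cons_cons (m : A → A → Option A) (a b : A) (u v : List A) :
    quasiShuffle m (a :: u) (b :: v) =
      (quasiShuffle m u (b :: v)).map (List.cons a) +
      (quasiShuffle m (a :: u) v).map (List.cons b) +
      (m a b).elim 0 fun c => (quasiShuffle m u v).map (List.cons c) := by
  rw [quasiShuffle]

/-- The value of a linear functional on the quasi-shuffle product of two words. -/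
def evalShuffle {R : Type*} [AddCommMonoid R] (m : A → A → Option A) (χ : List A → R)
    (u v : List A) : R :=
  ((quasiShuffle m u v).map χ).sum

section evalShuffle

variable {R : Type*} [AddCommMonoid R] (m : A → A → Option A) (χ : List A → R)

@[simp] theorem evalShuffle_nil_left (v : List A) : evalShuffle m χ [] v = χ v := by
  simp [evalShuffle]

@[simp] theorem evalShuffle_nil_right (u : List A) : evalShuffle m χ u [] = χ u := by
  simp [evalShuffle]

theorem evalShuffle_cons_cons (a b : A) (u v : List A) :
    evalShuffle m χ (a :: u) (b :: v) =
      evalShuffle m (fun w => χ (a :: w)) u (b :: v) +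
      evalShuffle m (fun w => χ (b :: w)) (a :: u) v +
      (m a b).elim 0 fun c => evalShuffle m (fun w => χ (c :: w)) u v := by
  rw [evalShuffle, quasiShuffle_cons_cons]
  cases h : m a b <;> simp [evalShuffle, Multiset.map_map]

theorem evalShuffle_none_cons_cons (a b : A) (u v : List A) :
    evalShuffle (fun _ _ => none) χ (a :: u) (b :: v) =
      evalShuffle (fun _ _ => none) (fun w => χ (a :: w)) u (b :: v) +
      evalShuffle (fun _ _ => none) (fun w => χ (b :: w)) (a :: u) v := by
  rw [evalShuffle_cons_cons]; simp

theorem evalShuffle_add (ψ : List A → R) (u v : List A) :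
    evalShuffle m (fun w => χ w + ψ w) u v = evalShuffle m χ u v + evalShuffle m ψ u v := by
  simp [evalShuffle, Multiset.sum_map_add]

@[simp] theorem evalShuffle_zero (u v : List A) :
    evalShuffle m (fun _ => (0 : R)) u v = 0 := by
  simp [evalShuffle]

theorem map_evalShuffle {S F : Type*} [AddCommMonoid S] [FunLike F R S] [AddMonoidHomClass F R S]
    (f : F) (u v : List A) :
    f (evalShuffle m χ u v) = evalShuffle m (fun w => f (χ w)) u v := by
  simp [evalShuffle, map_multiset_sum, Multiset.map_map]

theorem evalShuffle_const_mul {R : Type*} [NonUnitalNonAssocSemiring R] (χ : List A → R) (c : R)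
    (u v : List A) :
    evalShuffle m (fun w => c * χ w) u v = c * evalShuffle m χ u v :=
  (map_evalShuffle m χ (AddMonoidHom.mulLeft c) u v).symm

/-- The pure shuffle product also has a recursion on last letters. The induction peels first
letters, and the two recursions commute. This is what allows trailing letters `x_0` to be treated
like leading letters `x_1`. -/
theorem evalShuffle_append_singleton (a b : A) (u v : List A) (χ : List A → R) :
    evalShuffle (fun _ _ => none) χ (u ++ [a]) (v ++ [b]) =
      evalShuffle (fun _ _ => none) (fun w => χ (w ++ [a])) u (v ++ [b]) +
      evalShuffle (fun _ _ => none) (fun w => χ (w ++ [b])) (u ++ [a]) v := by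
  induction u generalizing v χ with
  | nil =>
    induction v generalizing χ with
    | nil => simp [evalShuffle_none_cons_cons, add_comm]
    | cons d v ih =>
      have := ih fun w => χ (d :: w)
      simp only [List.nil_append, List.cons_append, evalShuffle_none_cons_cons,
        evalShuffle_nil_left] at this ⊢
      rw [this]; abel
  | cons c u ihu =>
    induction v generalizing χ with
    | nil =>
      have := ihu [] fun w => χ (c :: w)
      simp only [List.nil_append, List.cons_append, evalShuffle_none_cons_cons,
        evalShuffle_nil_right] at this ⊢
      rw [this]; abel
    | cons d v ihv =>
      have h1 := ihu (d :: v) fun w => χ (c :: w)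
      have h2 := ihv fun w => χ (d :: w)
      simp only [List.cons_append, evalShuffle_none_cons_cons] at h1 h2 ⊢
      rw [h1, h2]; abel

theorem evalShuffle_reverse (u v : List A) (χ : List A → R) :
    evalShuffle (fun _ _ => none) (fun w => χ w.reverse) u v =
      evalShuffle (fun _ _ => none) χ u.reverse v.reverse := by
  induction u generalizing v χ with
  | nil => simp
  | cons a u ihu =>
    induction v generalizing χ with
    | nil => simp
    | cons b v ihv =>
      rw [evalShuffle_none_cons_cons, List.reverse_cons, List.reverse_cons,
        evalShuffle_append_singleton]
      have h1 := ihu (b :: v) fun w => χ (w ++ [a])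
      have h2 := ihv fun w => χ (w ++ [b])
      simp only [List.reverse_cons] at h1 h2 ⊢
      rw [h1, h2]

end evalShuffle

/-! ### Quasi-shuffle characters -/

/-- `χ` is multiplicative for the quasi-shuffle product. -/
structure IsShuffleChar {R : Type*} [CommSemiring R] (m : A → A → Option A) (χ : List A → R) :
    Prop where
  map_nil : χ [] = 1
  map_mul : ∀ u v, evalShuffle m χ u v = χ u * χ v

theorem IsShuffleChar.comp {R S F : Type*} [CommSemiring R] [CommSemiring S] [FunLike F R S]
    [RingHomClass F R S] {m : A → A → Option A} {χ : List A → R} (h : IsShuffleChar m χ) (f : F) :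
    IsShuffleChar m fun w => f (χ w) :=
  ⟨by rw [h.map_nil, map_one], fun u v => by rw [← map_evalShuffle, h.map_mul, _root_.map_mul]⟩

/-- Equality of two characters is membership of the combined character in the diagonal subalgebra of
`R × R`, so a membership criterion for one character doubles as a uniqueness criterion for two. -/
theorem IsShuffleChar.prodMk {R S : Type*} [CommSemiring R] [CommSemiring S]
    {m : A → A → Option A} {χ : List A → R} {ψ : List A → S} (h : IsShuffleChar m χ)
    (h' : IsShuffleChar m ψ) : IsShuffleChar m fun w => (χ w, ψ w) := by
  refine ⟨by rw [h.map_nil, h'.map_nil]; rfl, fun u v => Prod.ext ?_ ?_⟩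
  · have := map_evalShuffle m (fun w => (χ w, ψ w)) (RingHom.fst R S) u v
    rw [RingHom.coe_fst] at this
    rw [this, h.map_mul]; rfl
  · have := map_evalShuffle m (fun w => (χ w, ψ w)) (RingHom.snd R S) u v
    rw [RingHom.coe_snd] at this
    rw [this, h'.map_mul]; rfl

theorem IsShuffleChar.comp_reverse {R : Type*} [CommSemiring R] {χ : List A → R}
    (h : IsShuffleChar (fun _ _ => none) χ) :
    IsShuffleChar (fun _ _ => none) fun w => χ w.reverse :=
  ⟨h.map_nil, fun u v => by rw [evalShuffle_reverse, h.map_mul]⟩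

/-- The number of letters `a` at the beginning of a word. -/
def leadingCount [DecidableEq A] (a : A) : List A → ℕ
  | [] => 0
  | b :: w => if b = a then leadingCount a w + 1 else 0

theorem leadingCount_cons_self [DecidableEq A] (a : A) (w : List A) :
    leadingCount a (a :: w) = leadingCount a w + 1 := by
  simp [leadingCount]

theorem leadingCount_cons_of_ne [DecidableEq A] {a b : A} (h : b ≠ a) (w : List A) :
    leadingCount a (b :: w) = 0 := by
  simp [leadingCount, h]

theorem head?_ne_of_leadingCount_eq_zero [DecidableEq A] {a : A} {w : List A}
    (h : leadingCount a w = 0) : w.head? ≠ some a := by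
  cases w with
  | nil => simp
  | cons b w =>
    simp only [List.head?_cons, ne_eq, Option.some.injEq]
    rintro rfl
    simp [leadingCount] at h

/-- Quasi-shuffling with a letter `a` which is not obtained by merging: the word `a w` occurs with
its number of leading letters `a` as multiplicity, and the other words have fewer of them. -/
theorem quasiShuffle_singleton [DecidableEq A] {m : A → A → Option A} {a : A}
    (hm : ∀ b, m a b ≠ some a) (w : List A) :
    ∃ rest : Multiset (List A),
      quasiShuffle m [a] w = (leadingCount a w + 1) • {a :: w} + rest ∧
      ∀ v ∈ rest, leadingCount a v ≤ leadingCount a w := by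
  induction w with
  | nil => exact ⟨0, by simp [leadingCount]⟩
  | cons b w ih =>
    have hmerge : ∀ v ∈ (m a b).elim 0 fun c => (quasiShuffle m [] w).map (List.cons c),
        leadingCount a v = 0 := by
      intro v hv
      cases hc : m a b with
      | none => rw [hc] at hv; simp at hv
      | some c =>
        rw [hc] at hv
        simp only [quasiShuffle_nil_left, Option.elim_some, Multiset.map_singleton,
          Multiset.mem_singleton] at hv
        rw [hv]
        exact leadingCount_cons_of_ne (fun h => hm b (by rw [hc, h])) _
    rw [quasiShuffle_cons_cons]
    obtain ⟨rest, h1, h2⟩ := ih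
    by_cases hb : b = a
    · subst hb
      refine ⟨rest.map (List.cons b) + (m b b).elim 0 fun c =>
        (quasiShuffle m [] w).map (List.cons c), ?_, fun v hv => ?_⟩
      · rw [h1, leadingCount_cons_self, succ_nsmul' _ (leadingCount b w + 1)]
        simp only [quasiShuffle_nil_left, Multiset.map_singleton, Multiset.map_add,
          Multiset.map_nsmul, add_assoc]
      · rcases Multiset.mem_add.1 hv with hv | hv
        · obtain ⟨v', hv', rfl⟩ := Multiset.mem_map.1 hv
          rw [leadingCount_cons_self, leadingCount_cons_self]
          have := h2 v' hv'
          omega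
        · rw [hmerge v hv]; exact Nat.zero_le _
    · refine ⟨(quasiShuffle m [a] w).map (List.cons b) + (m a b).elim 0 fun c =>
        (quasiShuffle m [] w).map (List.cons c), ?_, fun v hv => ?_⟩
      · rw [leadingCount_cons_of_ne hb]
        simp
      · rcases Multiset.mem_add.1 hv with hv | hv
        · obtain ⟨v', -, rfl⟩ := Multiset.mem_map.1 hv
          rw [leadingCount_cons_of_ne hb]; exact Nat.zero_le _
        · rw [hmerge v hv]; exact Nat.zero_le _

/-- If a character takes values in a subalgebra on the letter `a` and on the words not beginning
with `a`, then it takes values in it everywhere; only words in a class `W` stable under the words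
used in the argument need be considered. -/
theorem IsShuffleChar.mem_of_head?_ne {R : Type*} [CommRing R] [Algebra ℂ R]
    {m : A → A → Option A} {χ : List A → R} (hχ : IsShuffleChar m χ) {a : A}
    (hm : ∀ b, m a b ≠ some a) (S : Subalgebra ℂ R) (W : Set (List A))
    (hW : ∀ w, a :: w ∈ W → w ∈ W ∧ ∀ v ∈ quasiShuffle m [a] w, v ∈ W)
    (ha : χ [a] ∈ S) (hS : ∀ w ∈ W, w.head? ≠ some a → χ w ∈ S) (w : List A) (hw : w ∈ W) :
    χ w ∈ S := by
  classical
  -- Induction on the number of leading letters `a`: in `χ [a] * χ v`, every word other than `a ::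
  -- v` has fewer of them than `a :: v`.
  suffices H : ∀ n, ∀ w ∈ W, leadingCount a w ≤ n → χ w ∈ S from H _ w hw le_rfl
  intro n
  induction n with
  | zero =>
    intro w hw h
    exact hS w hw (head?_ne_of_leadingCount_eq_zero (Nat.le_zero.1 h))
  | succ n ih =>
    intro w hw h
    by_cases h0 : w.head? = some a
    swap
    · exact hS w hw h0
    obtain ⟨v, rfl⟩ : ∃ v, w = a :: v := by
      cases w with
      | nil => simp at h0
      | cons b v => exact ⟨v, by simpa using h0⟩
    rw [leadingCount_cons_self] at h
    obtain ⟨rest, h1, h2⟩ := quasiShuffle_singleton hm v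
    obtain ⟨hv, hvW⟩ := hW v hw
    have key := hχ.map_mul [a] v
    rw [evalShuffle, h1] at key
    simp only [Multiset.map_add, Multiset.map_nsmul, Multiset.map_singleton, Multiset.sum_add,
      Multiset.sum_nsmul, Multiset.sum_singleton] at key
    have hrest : (rest.map χ).sum ∈ S := by
      refine S.toSubsemiring.toAddSubmonoid.multiset_sum_mem _ fun x hx => ?_
      obtain ⟨v', hv', rfl⟩ := Multiset.mem_map.1 hx
      refine ih v' (hvW v' ?_) ((h2 v' hv').trans (by omega))
      rw [h1]; exact Multiset.mem_add.2 (Or.inr hv')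
    -- The word `a :: v` occurs with multiplicity `leadingCount a v + 1`, which can be inverted
    -- because `S` is a `ℂ`-subalgebra.
    have h3 : ((leadingCount a v + 1 : ℕ) : ℂ) • χ (a :: v) ∈ S := by
      rw [Nat.cast_smul_eq_nsmul, eq_sub_of_add_eq key]
      exact S.sub_mem (S.mul_mem ha (ih v hv (by omega))) hrest
    have h4 := S.smul_mem h3 (((leadingCount a v + 1 : ℕ) : ℂ)⁻¹)
    rwa [smul_smul, inv_mul_cancel₀ (Nat.cast_ne_zero.2 (Nat.succ_ne_zero _)), one_smul] at h4

/-- A character is determined by its values on `a` and on the words not beginning with `a`. -/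
theorem IsShuffleChar.ext_of_head?_ne {R : Type*} [CommRing R] [Algebra ℂ R]
    {m : A → A → Option A} {χ ψ : List A → R} (hχ : IsShuffleChar m χ) (hψ : IsShuffleChar m ψ)
    {a : A} (hm : ∀ b, m a b ≠ some a) (W : Set (List A))
    (hW : ∀ w, a :: w ∈ W → w ∈ W ∧ ∀ v ∈ quasiShuffle m [a] w, v ∈ W)
    (ha : χ [a] = ψ [a]) (h : ∀ w ∈ W, w.head? ≠ some a → χ w = ψ w) (w : List A) (hw : w ∈ W) :
    χ w = ψ w :=
  (hχ.prodMk hψ).mem_of_head?_ne hm (AlgHom.equalizer (AlgHom.fst ℂ R R) (AlgHom.snd ℂ R R)) W hW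
    ha h w hw

theorem getLast?_of_mem_quasiShuffle_singleton (m : A → A → Option A) (hm : ∀ a b, m a b = none)
    {a : A} {w v : List A} (hv : v ∈ quasiShuffle m [a] w) :
    v.getLast? = some a ∨ v.getLast? = w.getLast? ∧ w ≠ [] := by
  induction w generalizing v with
  | nil =>
    rw [quasiShuffle_nil_right, Multiset.mem_singleton] at hv
    exact Or.inl (by rw [hv]; rfl)
  | cons b w ih =>
    rw [quasiShuffle_cons_cons, hm] at hv
    simp only [quasiShuffle_nil_left, Multiset.map_singleton, Option.elim_none, add_zero,
      Multiset.mem_add, Multiset.mem_singleton, Multiset.mem_map] at hv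
    rcases hv with rfl | ⟨v', hv', rfl⟩
    · exact Or.inr ⟨by simp [List.getLast?_cons], by simp⟩
    · rcases ih hv' with h | ⟨h, hne⟩
      · exact Or.inl (by simp [List.getLast?_cons, h])
      · exact Or.inr ⟨by simp [List.getLast?_cons, h], by simp⟩

/-- A shuffle character is determined by its values on `a`, on `b`, and on the words neither
beginning with `a` nor ending with `b`. -/
theorem IsShuffleChar.ext_of_head?_ne_of_getLast?_ne {R : Type*} [CommRing R] [Algebra ℂ R]
    {χ ψ : List A → R} (hχ : IsShuffleChar (fun _ _ => none) χ)
    (hψ : IsShuffleChar (fun _ _ => none) ψ) {a b : A} (hab : a ≠ b)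
    (ha : χ [a] = ψ [a]) (hb : χ [b] = ψ [b])
    (h : ∀ w, w.head? ≠ some a → w.getLast? ≠ some b → χ w = ψ w) (w : List A) :
    χ w = ψ w := by
  -- Leading letters `a` are removed first, inside the class of words not ending with `b`; shuffling
  -- with `a ≠ b` preserves this class. Reversal then removes the trailing letters `b`.
  have h1 : ∀ w : List A, w.getLast? ≠ some b → χ w = ψ w := by
    refine hχ.ext_of_head?_ne hψ (a := a) (by simp) {w | w.getLast? ≠ some b} (fun w hw => ?_) ha
      fun w hw hw' => h w hw' hw
    have hw' : w.getLast? ≠ some b := by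
      rcases List.eq_nil_or_concat w with rfl | ⟨w', c, rfl⟩
      · simp
      · simpa [List.getLast?_cons] using hw
    refine ⟨hw', fun v hv => ?_⟩
    rcases getLast?_of_mem_quasiShuffle_singleton _ (fun _ _ => rfl) hv with h | ⟨h, -⟩
    · rw [Set.mem_ofPred_eq, h]; simpa using hab
    · rw [Set.mem_ofPred_eq, h]; exact hw'
  have := hχ.comp_reverse.ext_of_head?_ne hψ.comp_reverse (a := b) (by simp) Set.univ
    (fun w _ => ⟨trivial, fun _ _ => trivial⟩) hb
    (fun w _ hw => h1 _ (by rwa [List.getLast?_reverse])) w.reverse trivial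
  simpa using this

theorem IsShuffleChar.mem_of_getLast?_ne {R : Type*} [CommRing R] [Algebra ℂ R]
    {χ : List A → R} (hχ : IsShuffleChar (fun _ _ => none) χ) {b : A} (S : Subalgebra ℂ R)
    (hb : χ [b] ∈ S) (h : ∀ w : List A, w.getLast? ≠ some b → χ w ∈ S) (w : List A) : χ w ∈ S := by
  have := hχ.comp_reverse.mem_of_head?_ne (a := b) (by simp) S Set.univ
    (fun w _ => ⟨trivial, fun _ _ => trivial⟩) hb
    (fun w _ hw => h _ (by rwa [List.getLast?_reverse])) w.reverse trivial
  simpa using this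

/-- `χ(a)^n = n! χ(a^n)` for a shuffle character. -/
theorem IsShuffleChar.factorial_nsmul_replicate {R : Type*} [CommRing R]
    {χ : List A → R} (hχ : IsShuffleChar (fun _ _ => none) χ) (a : A) (n : ℕ) :
    n.factorial • χ (List.replicate n a) = χ [a] ^ n := by
  have h : ∀ n, ∀ ψ : List A → R, evalShuffle (fun _ _ => none) ψ [a] (List.replicate n a) =
      (n + 1) • ψ (List.replicate (n + 1) a) := by
    intro n
    induction n with
    | zero => intro ψ; simp
    | succ n ih =>
      intro ψ
      rw [List.replicate_succ, evalShuffle_none_cons_cons, ih, evalShuffle_nil_left]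
      simp only [List.replicate_succ]
      rw [succ_nsmul' _ (n + 1)]
  induction n with
  | zero => simp [hχ.map_nil]
  | succ n ih =>
    have := hχ.map_mul [a] (List.replicate n a)
    rw [h] at this
    rw [Nat.factorial_succ, mul_nsmul, this, pow_succ', ← ih, mul_smul_comm]

end QuasiShuffle

/-! ### Diagonal series are quasi-shuffle characters -/

section Diagonal

variable {A : Type*}

open Classical in
theorem coeff_single_left_mul (y : A) (p : MonoidAlgebra ℂ (FreeMonoid A × FreeMonoid A))
    (u v : List A) :
    (MonoidAlgebra.single (FreeMonoid.of y, 1) 1 * p).coeff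
      (FreeMonoid.ofList u, FreeMonoid.ofList v) =
      if u.head? = some y then p.coeff (FreeMonoid.ofList u.tail, FreeMonoid.ofList v) else 0 := by
  split_ifs with h
  · obtain ⟨u', rfl⟩ : ∃ u', u = y :: u' := by
      cases u with
      | nil => simp at h
      | cons b v => exact ⟨v, by simpa using h⟩
    have : (FreeMonoid.ofList (y :: u'), FreeMonoid.ofList v) =
      (FreeMonoid.of y, 1) * (FreeMonoid.ofList u', FreeMonoid.ofList v) := by
      rw [FreeMonoid.ofList_cons, Prod.mk_mul_mk, one_mul]
    rw [this, MonoidAlgebra.coeff_single_mul_mul, one_mul]; rfl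
  · refine MonoidAlgebra.coeff_single_mul_of_forall_mul_ne _ _ fun d hd => h ?_
    have := congrArg (fun x => (FreeMonoid.toList x.1).head?) hd
    simpa using this.symm

open Classical in
theorem coeff_single_right_mul (y : A) (p : MonoidAlgebra ℂ (FreeMonoid A × FreeMonoid A))
    (u v : List A) :
    (MonoidAlgebra.single (1, FreeMonoid.of y) 1 * p).coeff
      (FreeMonoid.ofList u, FreeMonoid.ofList v) =
      if v.head? = some y then p.coeff (FreeMonoid.ofList u, FreeMonoid.ofList v.tail) else 0 := by
  split_ifs with h
  · obtain ⟨v', rfl⟩ : ∃ v', v = y :: v' := by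
      cases v with
      | nil => simp at h
      | cons b v => exact ⟨v, by simpa using h⟩
    have : (FreeMonoid.ofList u, FreeMonoid.ofList (y :: v')) =
      (1, FreeMonoid.of y) * (FreeMonoid.ofList u, FreeMonoid.ofList v') := by
      rw [FreeMonoid.ofList_cons, Prod.mk_mul_mk, one_mul]
    rw [this, MonoidAlgebra.coeff_single_mul_mul, one_mul]; rfl
  · refine MonoidAlgebra.coeff_single_mul_of_forall_mul_ne _ _ fun d hd => h ?_
    have := congrArg (fun x => (FreeMonoid.toList x.2).head?) hd
    simpa using this.symm

open Classical in
theorem coeff_single_both_mul (y z : A) (p : MonoidAlgebra ℂ (FreeMonoid A × FreeMonoid A))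
    (u v : List A) :
    (MonoidAlgebra.single (FreeMonoid.of y, FreeMonoid.of z) 1 * p).coeff
      (FreeMonoid.ofList u, FreeMonoid.ofList v) =
      if u.head? = some y ∧ v.head? = some z then
        p.coeff (FreeMonoid.ofList u.tail, FreeMonoid.ofList v.tail) else 0 := by
  have : MonoidAlgebra.single (FreeMonoid.of y, FreeMonoid.of z) (1 : ℂ) =
      MonoidAlgebra.single (FreeMonoid.of y, 1) 1 * MonoidAlgebra.single (1, FreeMonoid.of z) 1 := by
    rw [MonoidAlgebra.single_mul_single, Prod.mk_mul_mk, one_mul, mul_one, mul_one]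
  rw [this, mul_assoc, coeff_single_left_mul, ite_and, coeff_single_right_mul]

open Classical in
/-- The coefficient of `u ⊗ v` in `Δ(y) p`, when `Δ(y)` is the sum of `y ⊗ 1`, `1 ⊗ y` and of the
`a ⊗ b` with `m a b = y`. -/
noncomputable def peelCoeff (m : A → A → Option A) (y : A)
    (p : MonoidAlgebra ℂ (FreeMonoid A × FreeMonoid A)) (u v : List A) : ℂ :=
  (if u.head? = some y then p.coeff (FreeMonoid.ofList u.tail, FreeMonoid.ofList v) else 0) +
  (if v.head? = some y then p.coeff (FreeMonoid.ofList u, FreeMonoid.ofList v.tail) else 0) +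
  (if ∃ a ∈ u.head?, ∃ b ∈ v.head?, m a b = some y then
    p.coeff (FreeMonoid.ofList u.tail, FreeMonoid.ofList v.tail) else 0)

open Classical in
-- Duality between coproduct and product: peeling the first letter of `w` off `Δ w` splits into the
-- same three cases (from `u`, from `v`, merged from both) as the recursion defining the
-- quasi-shuffle.
theorem coeff_coproduct_eq_count (m : A → A → Option A)
    (Δ : FreeMonoid A →* MonoidAlgebra ℂ (FreeMonoid A × FreeMonoid A))
    (hΔ : ∀ y p u v, (Δ (FreeMonoid.of y) * p).coeff (FreeMonoid.ofList u, FreeMonoid.ofList v) =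
      peelCoeff m y p u v) (w u v : List A) :
    (Δ (FreeMonoid.ofList w)).coeff (FreeMonoid.ofList u, FreeMonoid.ofList v) =
      ((quasiShuffle m u v).count w : ℂ) := by
  have hcons : ∀ (a b : A) (w : List A) (s : Multiset (List A)),
      (s.map (List.cons a)).count (b :: w) = if a = b then s.count w else 0 := by
    intro a b w s
    split_ifs with h
    · subst h; exact Multiset.count_map_eq_count' _ _ (List.cons_injective) _
    · rw [Multiset.count_eq_zero, Multiset.mem_map]
      rintro ⟨x, -, hx⟩
      exact h (List.cons.inj hx).1
  have hnil : ∀ (a : A) (s : Multiset (List A)), (s.map (List.cons a)).count [] = 0 := by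
    intro a s
    rw [Multiset.count_eq_zero, Multiset.mem_map]
    rintro ⟨x, -, hx⟩
    simp at hx
  induction w generalizing u v with
  | nil =>
    rw [FreeMonoid.ofList_nil, map_one, MonoidAlgebra.one_def, MonoidAlgebra.coeff_single,
      Finsupp.single_apply]
    cases u with
    | nil =>
      cases v with
      | nil => simp; rfl
      | cons b v =>
        rw [if_neg, quasiShuffle_nil_left, Multiset.count_singleton, if_neg (by simp)]
        · simp
        · intro h; exact absurd (congrArg (fun x => FreeMonoid.toList x.2) h) (by simp)
    | cons a u =>
      rw [if_neg]
      swap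
      · intro h; exact absurd (congrArg (fun x => FreeMonoid.toList x.1) h) (by simp)
      cases v with
      | nil => rw [quasiShuffle_nil_right, Multiset.count_singleton, if_neg (by simp)]; simp
      | cons b v =>
        rw [quasiShuffle_cons_cons, Multiset.count_add, Multiset.count_add, hnil, hnil]
        cases m a b <;> simp
  | cons y w ih =>
    rw [FreeMonoid.ofList_cons, map_mul, hΔ, peelCoeff]
    simp only [ih]
    cases u with
    | nil =>
      cases v with
      | nil => simp
      | cons b v =>
        rw [quasiShuffle_nil_left, Multiset.count_singleton]
        by_cases h : b = y
        · simp [h, Multiset.count_singleton]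
        · simp [h, Ne.symm h]
    | cons a u =>
      cases v with
      | nil =>
        rw [quasiShuffle_nil_right, Multiset.count_singleton]
        by_cases h : a = y
        · simp [h, Multiset.count_singleton]
        · simp [h, Ne.symm h]
      | cons b v =>
        rw [quasiShuffle_cons_cons, Multiset.count_add, Multiset.count_add, hcons, hcons]
        have : ((m a b).elim 0 fun c => (quasiShuffle m u v).map (List.cons c)).count (y :: w) =
            if m a b = some y then (quasiShuffle m u v).count w else 0 := by
          cases m a b <;> simp [hcons]
        rw [this]
        simp

theorem isDiagonal_iff_isShuffleChar (m : A → A → Option A)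
    (Δ : FreeMonoid A →* MonoidAlgebra ℂ (FreeMonoid A × FreeMonoid A))
    (hΔ : ∀ y p u v, (Δ (FreeMonoid.of y) * p).coeff (FreeMonoid.ofList u, FreeMonoid.ofList v) =
      peelCoeff m y p u v) (Φ : NCSeries A ℂ) :
    NCSeries.IsDiagonal Δ Φ ↔ IsShuffleChar m fun w => Φ (FreeMonoid.ofList w) := by
  classical
  have key : ∀ u v, NCSeries.coproductCoeff Δ Φ (FreeMonoid.ofList u) (FreeMonoid.ofList v) =
      evalShuffle m (fun w => Φ (FreeMonoid.ofList w)) u v := by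
    intro u v
    rw [NCSeries.coproductCoeff, evalShuffle, Finset.sum_multiset_map_count,
      ← finsum_comp_equiv (FreeMonoid.ofList (α := A))]
    -- Only the finitely many words of the quasi-shuffle contribute, so the `finsum` is a genuine
    -- sum and not its default value `0`.
    rw [finsum_eq_sum_of_support_subset (s := (quasiShuffle m u v).toFinset)]
    · refine Finset.sum_congr rfl fun w _ => ?_
      rw [coeff_coproduct_eq_count m Δ hΔ, nsmul_eq_mul, mul_comm]
    · intro w hw
      rw [Function.mem_support, coeff_coproduct_eq_count m Δ hΔ] at hw
      simp only [Finset.mem_coe, Multiset.mem_toFinset]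
      by_contra h
      exact hw (by rw [Multiset.count_eq_zero_of_notMem h]; simp)
  constructor
  · rintro ⟨h1, h2⟩
    exact ⟨h1, fun u v => by rw [← key, h2]⟩
  · rintro ⟨h1, h2⟩
    exact ⟨h1, fun u v => (key u v).trans (h2 u v)⟩

theorem shuffleCoproduct_peel (Γ : Subgroup ℂˣ) (y : XLetter Γ)
    (p : MonoidAlgebra ℂ (FreeMonoid (XLetter Γ) × FreeMonoid (XLetter Γ)))
    (u v : List (XLetter Γ)) :
    (shuffleCoproduct Γ (FreeMonoid.of y) * p).coeff
      (FreeMonoid.ofList u, FreeMonoid.ofList v) = peelCoeff (fun _ _ => none) y p u v := by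
  rw [shuffleCoproduct, FreeMonoid.lift_eval_of, add_mul, MonoidAlgebra.coeff_add,
    Finsupp.add_apply, coeff_single_left_mul, coeff_single_right_mul, peelCoeff]
  simp

/-- The letter `y_{k+l,κλ}`. -/
def stuffleMerge (Γ : Subgroup ℂˣ) (a b : YLetter Γ) : Option (YLetter Γ) :=
  some (a.1 + b.1, a.2 * b.2)

theorem pureTensor_yElem (Γ : Subgroup ℂˣ) {k l : ℕ} (hk : 0 < k) (hl : 0 < l) (κ μ : Γ) :
    pureTensor (yElem Γ k κ) (yElem Γ l μ) =
      MonoidAlgebra.single (FreeMonoid.of (⟨k, hk⟩, κ), FreeMonoid.of (⟨l, hl⟩, μ)) 1 := by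
  rw [pureTensor, yElem, yElem, dif_pos hk, dif_pos hl, MonoidAlgebra.mapDomain_single,
    MonoidAlgebra.mapDomain_single, MonoidAlgebra.single_mul_single, Prod.mk_mul_mk, one_mul,
    mul_one, mul_one]

open Classical in
theorem pureTensor_yElem_zero_left (Γ : Subgroup ℂˣ) {l : ℕ} (hl : 0 < l) (κ μ : Γ) :
    pureTensor (yElem Γ 0 κ) (yElem Γ l μ) = if κ = 1 then
      MonoidAlgebra.single (1, FreeMonoid.of (⟨l, hl⟩, μ)) 1 else 0 := by
  rw [pureTensor, yElem, yElem, dif_neg (lt_irrefl 0), dif_pos hl, MonoidAlgebra.mapDomain_single]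
  split_ifs
  · rw [MonoidAlgebra.one_def, MonoidAlgebra.mapDomain_single,
      MonoidAlgebra.single_mul_single, Prod.mk_mul_mk, one_mul, one_mul, mul_one]
  · simp

open Classical in
theorem pureTensor_yElem_zero_right (Γ : Subgroup ℂˣ) {k : ℕ} (hk : 0 < k) (κ μ : Γ) :
    pureTensor (yElem Γ k κ) (yElem Γ 0 μ) = if μ = 1 then
      MonoidAlgebra.single (FreeMonoid.of (⟨k, hk⟩, κ), 1) 1 else 0 := by
  rw [pureTensor, yElem, yElem, dif_neg (lt_irrefl 0), dif_pos hk, MonoidAlgebra.mapDomain_single]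
  split_ifs
  · rw [MonoidAlgebra.one_def, MonoidAlgebra.mapDomain_single,
      MonoidAlgebra.single_mul_single, Prod.mk_mul_mk, one_mul, mul_one, mul_one]
  · simp

/-- At the two ends of the antidiagonal, `y_{0,κ}` is `1` or `0`, so the sum over `κ` collapses to a
single term. The interior terms are pairs of true letters, indexed with first weight `k + 1`. -/
theorem stuffleCoproduct_of (Γ : Subgroup ℂˣ) [Fintype Γ] (y : YLetter Γ) :
    stuffleCoproduct Γ (FreeMonoid.of y) =
      MonoidAlgebra.single (FreeMonoid.of y, 1) 1 + MonoidAlgebra.single (1, FreeMonoid.of y) 1 +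
      ∑ k : Fin ((y.1 : ℕ) - 1), ∑ κ : Γ, MonoidAlgebra.single
        (FreeMonoid.of (⟨(k : ℕ) + 1, Nat.succ_pos _⟩, κ),
          FreeMonoid.of (⟨(y.1 : ℕ) - (k + 1), by omega⟩, κ⁻¹ * y.2)) 1 := by
  classical
  obtain ⟨⟨n, hn⟩, ν⟩ := y
  obtain ⟨n, rfl⟩ : ∃ k, n = k + 1 := ⟨n - 1, by omega⟩
  rw [stuffleCoproduct, FreeMonoid.lift_eval_of]
  simp only [PNat.mk_coe]
  rw [Finset.Nat.sum_antidiagonal_eq_sum_range_succ_mk, Finset.sum_range_succ,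
    Finset.sum_range_succ']
  have h1 : ∑ κ : Γ, pureTensor (yElem Γ (n + 1) κ) (yElem Γ (n + 1 - (n + 1)) (κ⁻¹ * ν)) =
      MonoidAlgebra.single (FreeMonoid.of (⟨n + 1, hn⟩, ν), 1) 1 := by
    rw [Nat.sub_self]
    simp only [pureTensor_yElem_zero_right Γ hn, inv_mul_eq_one]
    simp
  have h2 : ∑ κ : Γ, pureTensor (yElem Γ 0 κ) (yElem Γ (n + 1 - 0) (κ⁻¹ * ν)) =
      MonoidAlgebra.single (1, FreeMonoid.of (⟨n + 1, hn⟩, ν)) 1 := by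
    simp only [Nat.sub_zero, pureTensor_yElem_zero_left Γ hn]
    simp
  rw [h1, h2, Finset.sum_range]
  have h3 : ∀ k : Fin n, ∀ κ : Γ, pureTensor (yElem Γ (k + 1) κ)
      (yElem Γ (n + 1 - (k + 1)) (κ⁻¹ * ν)) = MonoidAlgebra.single
        (FreeMonoid.of (⟨(k : ℕ) + 1, Nat.succ_pos _⟩, κ),
          FreeMonoid.of (⟨n + 1 - (k + 1), by omega⟩, κ⁻¹ * ν)) 1 :=
    fun k κ => pureTensor_yElem Γ _ _ _ _
  simp only [h3]
  rw [add_comm, add_comm (∑ k : Fin n, _), ← add_assoc]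
  rfl

/-- The first letters `a` of `u` and `b` of `v` leave at most one pair `(k, κ)` in the double sum,
namely `k + 1 = a.1` and `κ = a.2`, and it contributes exactly when `a` and `b` merge to `y`. -/
theorem stuffleCoproduct_peel (Γ : Subgroup ℂˣ) [Fintype Γ] (y : YLetter Γ)
    (p : MonoidAlgebra ℂ (FreeMonoid (YLetter Γ) × FreeMonoid (YLetter Γ)))
    (u v : List (YLetter Γ)) :
    (stuffleCoproduct Γ (FreeMonoid.of y) * p).coeff
      (FreeMonoid.ofList u, FreeMonoid.ofList v) = peelCoeff (stuffleMerge Γ) y p u v := by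
  classical
  rw [stuffleCoproduct_of, add_mul, add_mul, MonoidAlgebra.coeff_add, MonoidAlgebra.coeff_add,
    Finsupp.add_apply, Finsupp.add_apply, coeff_single_left_mul, coeff_single_right_mul, peelCoeff]
  congr 1
  simp only [Finset.sum_mul, MonoidAlgebra.coeff_sum, Finsupp.finsetSum_apply,
    coeff_single_both_mul]
  split_ifs with h
  · obtain ⟨a, ha, b, hb, hab⟩ := h
    rw [Option.mem_def] at ha hb
    rw [stuffleMerge, Option.some_inj] at hab
    subst hab
    have ha' := a.1.pos
    have hb' := b.1.pos
    have hlt : (a.1 : ℕ) - 1 < ((a.1 + b.1 : ℕ+) : ℕ) - 1 := by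
      rw [PNat.add_coe]; omega
    rw [Finset.sum_eq_single (⟨(a.1 : ℕ) - 1, hlt⟩), Finset.sum_eq_single a.2, if_pos]
    · refine ⟨ha.trans (congrArg some (Prod.ext ?_ rfl)), hb.trans (congrArg some (Prod.ext ?_ ?_))⟩
      · exact PNat.coe_injective (by simp; omega)
      · exact PNat.coe_injective (by simp; omega)
      · simp
    · intro κ _ hκ
      rw [if_neg]
      rintro ⟨h, -⟩
      rw [ha, Option.some_inj] at h
      exact hκ (congrArg Prod.snd h).symm
    · simp
    · intro k _ hk
      refine Finset.sum_eq_zero fun κ _ => if_neg ?_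
      rintro ⟨h, -⟩
      rw [ha, Option.some_inj] at h
      refine hk (Fin.ext ?_)
      have := congrArg (fun x : YLetter Γ => (x.1 : ℕ)) h
      simp only [PNat.mk_coe] at this
      simp only
      omega
    · intro h; exact absurd (Finset.mem_univ _) h
  · refine Finset.sum_eq_zero fun k _ => Finset.sum_eq_zero fun κ _ => if_neg ?_
    rintro ⟨h1, h2⟩
    refine h ⟨_, h1, _, h2, congrArg some (Prod.ext (PNat.coe_injective ?_) ?_)⟩
    · have : (k : ℕ) < (y.1 : ℕ) - 1 := k.2
      rw [PNat.add_coe, PNat.mk_coe, PNat.mk_coe]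
      omega
    · simp

end Diagonal

/-! ### The series `exp(T a) Φ` -/

section ExpLetter

variable {A : Type*}

theorem coeff_expTu (n : ℕ) :
    PowerSeries.coeff n expTu = Polynomial.C ((n.factorial : ℂ)⁻¹) * Polynomial.X ^ n := by
  simp only [expTu, PowerSeries.coeff_rescale, PowerSeries.coeff_exp]
  rw [mul_comm, IsScalarTower.algebraMap_apply ℚ ℂ (Polynomial ℂ), Polynomial.algebraMap_eq]
  simp

open Classical in
theorem ofLetter_mul_mapCoeff (a : A) (Φ : NCSeries A ℂ) (w : List A) :
    (NCSeries.ofLetter a expTu * NCSeries.mapCoeff Polynomial.C Φ) (FreeMonoid.ofList w) =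
      ∑ i ∈ Finset.range (w.length + 1), (if w.take i = List.replicate i a then
        PowerSeries.coeff i expTu * Polynomial.C (Φ (FreeMonoid.ofList (w.drop i))) else 0) := by
  have hrep : ∀ n, FreeMonoid.toList (FreeMonoid.of a ^ n) = List.replicate n a := by
    intro n
    induction n with
    | zero => simp
    | succ n ih => rw [pow_succ', FreeMonoid.toList_of_mul, ih, List.replicate_succ]
  refine Finset.sum_congr rfl fun i hi => ?_
  have hi' : i ≤ w.length := by
    have := Finset.mem_range.1 hi
    omega
  rw [NCSeries.ofLetter, NCSeries.mapCoeff, ite_mul, zero_mul]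
  simp only [FreeMonoid.toList_ofList, List.length_take, min_eq_left hi',
    ← FreeMonoid.toList.injective.eq_iff, hrep]

theorem derivative_coeff_expTu_zero : Polynomial.derivative (PowerSeries.coeff 0 expTu) = 0 := by
  simp [coeff_expTu]

theorem derivative_coeff_expTu_succ (n : ℕ) :
    Polynomial.derivative (PowerSeries.coeff (n + 1) expTu) = PowerSeries.coeff n expTu := by
  rw [coeff_expTu, coeff_expTu, Polynomial.derivative_C_mul, Polynomial.derivative_X_pow,
    Nat.add_sub_cancel, ← mul_assoc, ← Polynomial.C_mul, Nat.factorial_succ, Nat.cast_mul,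
    mul_inv_rev, mul_assoc, inv_mul_cancel₀ (Nat.cast_ne_zero.2 n.succ_ne_zero), mul_one]

theorem eval_zero_coeff_expTu (n : ℕ) :
    (PowerSeries.coeff n expTu).eval 0 = if n = 0 then 1 else 0 := by
  rw [coeff_expTu]
  split_ifs with h
  · simp [h]
  · simp [h]

open Classical in
-- This is `d/dT exp(T a) = a exp(T a)` read off on coefficients. Together with the value at `T = 0`
-- it determines `exp(T a) Φ`, and it replaces explicit manipulation of the exponential.
theorem derivative_ofLetter_mul_cons (a b : A) (Φ : NCSeries A ℂ) (w : List A) :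
    Polynomial.derivative ((NCSeries.ofLetter a expTu * NCSeries.mapCoeff Polynomial.C Φ)
      (FreeMonoid.ofList (b :: w))) = if b = a then
        (NCSeries.ofLetter a expTu * NCSeries.mapCoeff Polynomial.C Φ) (FreeMonoid.ofList w)
      else 0 := by
  rw [ofLetter_mul_mapCoeff, ofLetter_mul_mapCoeff, Finset.sum_range_succ', map_add, map_sum]
  have h0 : Polynomial.derivative (PowerSeries.coeff 0 expTu * Polynomial.C
      (Φ (FreeMonoid.ofList (b :: w)))) = 0 := by
    rw [Polynomial.derivative_mul, derivative_coeff_expTu_zero, Polynomial.derivative_C]; simp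
  simp only [List.take_zero, List.replicate_zero, if_true, List.drop_zero, h0, add_zero,
    List.length_cons, List.take_succ_cons, List.replicate_succ, List.drop_succ_cons,
    List.cons.injEq, ite_and]
  split_ifs with h
  · refine Finset.sum_congr rfl fun i _ => ?_
    split_ifs
    · rw [Polynomial.derivative_mul, derivative_coeff_expTu_succ, Polynomial.derivative_C]; simp
    · simp
  · simp

theorem eval_zero_ofLetter_mul (a : A) (Φ : NCSeries A ℂ) (w : List A) :
    ((NCSeries.ofLetter a expTu * NCSeries.mapCoeff Polynomial.C Φ)
      (FreeMonoid.ofList w)).eval 0 = Φ (FreeMonoid.ofList w) := by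
  classical
  rw [ofLetter_mul_mapCoeff, Polynomial.eval_finsetSum, Finset.sum_range_succ']
  rw [Finset.sum_eq_zero]
  · simp [eval_zero_coeff_expTu, -PowerSeries.coeff_zero_eq_constantCoeff]
  · intro i _
    split_ifs
    · simp [eval_zero_coeff_expTu]
    · simp

theorem Polynomial.eq_of_derivative_eq {p q : Polynomial ℂ}
    (h : Polynomial.derivative p = Polynomial.derivative q) (h0 : p.eval 0 = q.eval 0) : p = q := by
  have h1 : Polynomial.derivative (p - q) = 0 := by rw [Polynomial.derivative_sub, h, sub_self]
  have h2 := Polynomial.eq_C_of_derivative_eq_zero h1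
  have h3 : (p - q).coeff 0 = 0 := by
    rw [Polynomial.coeff_zero_eq_eval_zero, Polynomial.eval_sub, h0, sub_self]
  rw [h3, map_zero] at h2
  exact sub_eq_zero.1 h2

/-- `exp(T a) Φ` is a character if `Φ` is, and `a` is not obtained by merging. -/
theorem isShuffleChar_ofLetter_mul {m : A → A → Option A} {a : A} (hm : ∀ b c, m b c ≠ some a)
    {Φ : NCSeries A ℂ} (hΦ : IsShuffleChar m fun w => Φ (FreeMonoid.ofList w)) :
    IsShuffleChar m fun w => (NCSeries.ofLetter a expTu * NCSeries.mapCoeff Polynomial.C Φ)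
      (FreeMonoid.ofList w) := by
  classical
  set E : List A → Polynomial ℂ := fun w =>
    (NCSeries.ofLetter a expTu * NCSeries.mapCoeff Polynomial.C Φ) (FreeMonoid.ofList w) with hE
  have hd : ∀ b w, Polynomial.derivative (E (b :: w)) = if b = a then E w else 0 :=
    fun b w => derivative_ofLetter_mul_cons a b Φ w
  have he : ∀ w, (E w).eval 0 = Φ (FreeMonoid.ofList w) := fun w => eval_zero_ofLetter_mul a Φ w
  have hnil : E [] = 1 := by
    have h1 : Φ (FreeMonoid.ofList []) = 1 := hΦ.map_nil
    simp only [hE, ofLetter_mul_mapCoeff]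
    simp only [List.length_nil, zero_add, Finset.sum_range_one, List.take_nil, List.replicate_zero,
      if_true, List.drop_nil, h1]
    simp [coeff_expTu]
  refine ⟨hnil, fun u v => ?_⟩
  -- Both sides are polynomials in `T`. At `T = 0` they agree because `Φ` is a character. Their
  -- derivatives agree by induction, since differentiating deletes a leading `a`, and `hm` kills the
  -- merged term.
  induction hn : u.length + v.length using Nat.strong_induction_on generalizing u v with
  | _ n ih =>
    cases u with
    | nil => rw [evalShuffle_nil_left, hnil, one_mul]
    | cons b u =>
      cases v with
      | nil => rw [evalShuffle_nil_right, hnil, mul_one]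
      | cons c v =>
        simp only [List.length_cons] at hn
        refine Polynomial.eq_of_derivative_eq ?_ ?_
        · rw [map_evalShuffle, evalShuffle_cons_cons, Polynomial.derivative_mul]
          simp only [hd]
          have h3 : ((m b c).elim 0 fun d => evalShuffle m (fun w => if d = a then E w else 0) u v) =
              0 := by
            cases h : m b c with
            | none => rfl
            | some d =>
              have : d ≠ a := fun h' => hm b c (by rw [h, h'])
              simp [this]
          rw [h3, add_zero]
          congr 1
          · split_ifs
            · exact ih _ (by simp; omega) u (c :: v) rfl
            · simp
          · split_ifs
            · exact ih _ (by simp; omega) (b :: u) v rfl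
            · simp
        · rw [← Polynomial.coe_evalRingHom, map_evalShuffle, map_mul]
          simp only [Polynomial.coe_evalRingHom, he]
          exact hΦ.map_mul _ _

theorem ofLetter_mul_eq_C (a : A) (Φ : NCSeries A ℂ) {w : List A} (hw : w.head? ≠ some a) :
    (NCSeries.ofLetter a expTu * NCSeries.mapCoeff Polynomial.C Φ) (FreeMonoid.ofList w) =
      Polynomial.C (Φ (FreeMonoid.ofList w)) := by
  classical
  refine Polynomial.eq_of_derivative_eq ?_ (by rw [eval_zero_ofLetter_mul, Polynomial.eval_C])
  cases w with
  | nil => rw [ofLetter_mul_mapCoeff]; simp [coeff_expTu]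
  | cons b w =>
    rw [derivative_ofLetter_mul_cons, if_neg (by simpa using hw), Polynomial.derivative_C]

theorem ofLetter_mul_singleton (a : A) (Φ : NCSeries A ℂ) (h1 : Φ 1 = 1)
    (ha : Φ (FreeMonoid.of a) = 0) :
    (NCSeries.ofLetter a expTu * NCSeries.mapCoeff Polynomial.C Φ) (FreeMonoid.ofList [a]) =
      Polynomial.X := by
  classical
  refine Polynomial.eq_of_derivative_eq ?_ ?_
  · rw [derivative_ofLetter_mul_cons, if_pos rfl, ofLetter_mul_eq_C _ _ (by simp),
      FreeMonoid.ofList_nil, h1, Polynomial.derivative_X, map_one]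
  · rw [eval_zero_ofLetter_mul, Polynomial.eval_X]; exact ha

theorem ofLetter_mul_singleton_of_ne (a b : A) (hab : b ≠ a) (Φ : NCSeries A ℂ)
    (hb : Φ (FreeMonoid.of b) = 0) :
    (NCSeries.ofLetter a expTu * NCSeries.mapCoeff Polynomial.C Φ) (FreeMonoid.ofList [b]) = 0 := by
  rw [ofLetter_mul_eq_C _ _ (by simpa using hab), FreeMonoid.ofList_singleton, hb, map_zero]

end ExpLetter

/-! ### Asymptotic expansions of sequences as polynomials in a divergent sequence -/

section Expansion

/-- `f` tends to `0` faster than all powers of `h⁻¹`. -/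
def Negligible (h : ℕ → ℝ) (f : ℕ → ℂ) : Prop :=
  ∀ j : ℕ, Tendsto (fun n => (h n : ℂ) ^ j * f n) atTop (𝓝 0)

/-- `f` equals `P(h)` up to a negligible sequence. -/
def HasExpansion (h : ℕ → ℝ) (f : ℕ → ℂ) (P : Polynomial ℂ) : Prop :=
  Negligible h fun n => f n - P.eval (h n : ℂ)

variable {h : ℕ → ℝ} {f g : ℕ → ℂ} {P Q : Polynomial ℂ}

theorem Negligible.tendsto (hf : Negligible h f) : Tendsto f atTop (𝓝 0) := by
  simpa using hf 0

theorem Negligible.add (hf : Negligible h f) (hg : Negligible h g) :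
    Negligible h fun n => f n + g n := fun j => by
  simpa [mul_add] using (hf j).add (hg j)

theorem negligible_zero : Negligible h fun _ => 0 := fun j => by simp

theorem Negligible.sum {ι : Type*} {s : Finset ι} {F : ι → ℕ → ℂ}
    (hF : ∀ i ∈ s, Negligible h (F i)) : Negligible h fun n => ∑ i ∈ s, F i n := by
  intro j
  have := tendsto_finsetSum s fun i hi => hF i hi j
  simpa [Finset.mul_sum] using this

theorem Negligible.mul (hf : Negligible h f) (hg : Negligible h g) :
    Negligible h fun n => f n * g n := fun j => by
  simpa [mul_assoc] using (hf j).mul hg.tendsto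

theorem Negligible.eval_mul (hf : Negligible h f) (P : Polynomial ℂ) :
    Negligible h fun n => P.eval (h n : ℂ) * f n := by
  intro j
  have := tendsto_finsetSum (Finset.range (P.natDegree + 1)) fun i _ =>
    (hf (j + i)).const_mul (P.coeff i)
  simp only [mul_zero, Finset.sum_const_zero] at this
  refine this.congr fun n => ?_
  beta_reduce
  rw [Polynomial.eval_eq_sum_range, Finset.sum_mul, Finset.mul_sum]
  exact Finset.sum_congr rfl fun i _ => by rw [pow_add]; ring

theorem hasExpansion_zero_iff : HasExpansion h f 0 ↔ Negligible h f := by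
  simp [HasExpansion]

theorem HasExpansion.congr (hf : HasExpansion h f P) (hfg : ∀ n, f n = g n) :
    HasExpansion h g P := (funext hfg : f = g) ▸ hf

theorem Negligible.congr (hf : Negligible h f) (hfg : ∀ n, f n = g n) :
    Negligible h g := (funext hfg : f = g) ▸ hf

theorem hasExpansion_eval (P : Polynomial ℂ) :
    HasExpansion h (fun n => P.eval (h n : ℂ)) P :=
  negligible_zero.congr fun n => by simp

theorem hasExpansion_const (c : ℂ) : HasExpansion h (fun _ => c) (Polynomial.C c) :=
  (hasExpansion_eval (Polynomial.C c)).congr fun n => by simp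

theorem hasExpansion_self : HasExpansion h (fun n => (h n : ℂ)) Polynomial.X :=
  (hasExpansion_eval Polynomial.X).congr fun n => by simp

theorem HasExpansion.add (hf : HasExpansion h f P) (hg : HasExpansion h g Q) :
    HasExpansion h (fun n => f n + g n) (P + Q) :=
  (Negligible.add hf hg).congr fun n => by simp; ring

theorem HasExpansion.mul (hf : HasExpansion h f P) (hg : HasExpansion h g Q) :
    HasExpansion h (fun n => f n * g n) (P * Q) :=
  ((Negligible.mul hf hg).add ((Negligible.eval_mul hf Q).add (Negligible.eval_mul hg P))).congr
    fun n => by simp; ring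

theorem HasExpansion.const_mul (hf : HasExpansion h f P) (c : ℂ) :
    HasExpansion h (fun n => c * f n) (Polynomial.C c * P) :=
  (hasExpansion_const c).mul hf

theorem HasExpansion.sum {ι : Type*} {s : Finset ι} {F : ι → ℕ → ℂ} {P : ι → Polynomial ℂ}
    (hF : ∀ i ∈ s, HasExpansion h (F i) (P i)) :
    HasExpansion h (fun n => ∑ i ∈ s, F i n) (∑ i ∈ s, P i) :=
  (Negligible.sum hF).congr fun n => by simp [Polynomial.eval_finsetSum]

theorem HasExpansion.negligible_mul (hf : HasExpansion h f P) (hg : Negligible h g) :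
    Negligible h fun n => f n * g n := by
  have := hf.mul (hasExpansion_zero_iff.2 hg)
  rwa [mul_zero, hasExpansion_zero_iff] at this

theorem HasExpansion.tendsto {c : ℂ} (hf : HasExpansion h f (Polynomial.C c)) :
    Tendsto f atTop (𝓝 c) := by
  have := (Negligible.tendsto hf).add_const c
  simpa using this

/-- A nonconstant polynomial is unbounded along `h → ∞`, while `(P - Q)(h)` tends to `0`; so `P - Q`
is a constant, and that constant is `0`. -/
theorem HasExpansion.unique (hh : Tendsto h atTop atTop) (hf : HasExpansion h f P)
    (hg : HasExpansion h f Q) : P = Q := by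
  have h1 : Tendsto (fun n => (P - Q).eval (h n : ℂ)) atTop (𝓝 0) := by
    have := (Negligible.tendsto hg).sub (Negligible.tendsto hf)
    rw [sub_zero] at this
    refine this.congr fun n => ?_
    rw [Polynomial.eval_sub]; ring
  have hh' : Tendsto (fun n => ‖(h n : ℂ)‖) atTop atTop := by
    simpa [Function.comp_def] using tendsto_abs_atTop_atTop.comp hh
  rcases lt_or_ge 0 (P - Q).degree with hd | hd
  · exact absurd h1.norm
      (not_tendsto_nhds_of_tendsto_atTop (Polynomial.tendsto_norm_atTop _ hd hh') _)
  · rw [Polynomial.eq_C_of_degree_le_zero hd] at h1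
    simp only [Polynomial.eval_C] at h1
    have h2 := tendsto_nhds_unique tendsto_const_nhds h1
    rw [← sub_eq_zero, Polynomial.eq_C_of_degree_le_zero hd, h2, map_zero]

/-- The sequences which have an expansion. -/
def expansionSubalgebra (h : ℕ → ℝ) : Subalgebra ℂ (ℕ → ℂ) where
  carrier := {f | ∃ P, HasExpansion h f P}
  mul_mem' := fun ⟨P, hP⟩ ⟨Q, hQ⟩ => ⟨P * Q, hP.mul hQ⟩
  add_mem' := fun ⟨P, hP⟩ ⟨Q, hQ⟩ => ⟨P + Q, hP.add hQ⟩
  algebraMap_mem' := fun c => ⟨Polynomial.C c, hasExpansion_const c⟩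

/-- The polynomials in the expansions of a character with values in sequences form a character. -/
theorem IsShuffleChar.of_hasExpansion {A : Type*} {m : A → A → Option A} {χ : List A → ℕ → ℂ}
    (hh : Tendsto h atTop atTop) (hχ : IsShuffleChar m χ) {P : List A → Polynomial ℂ}
    (hP : ∀ w, HasExpansion h (χ w) (P w)) : IsShuffleChar m P := by
  refine ⟨?_, fun u v => ?_⟩
  · have h1 := hP []
    rw [hχ.map_nil] at h1
    exact h1.unique hh (hasExpansion_const 1)
  · have h1 : HasExpansion h (evalShuffle m χ u v) (evalShuffle m P u v) := by
      rw [evalShuffle, evalShuffle]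
      induction quasiShuffle m u v using Multiset.induction_on with
      | empty => exact hasExpansion_zero_iff.2 negligible_zero
      | cons w s ih =>
        rw [Multiset.map_cons, Multiset.map_cons, Multiset.sum_cons, Multiset.sum_cons]
        exact (hP w).add ih
    rw [hχ.map_mul] at h1
    exact h1.unique hh ((hP u).mul (hP v))

/-! ### Expansions in the harmonic numbers -/

theorem tendsto_harmonic_atTop : Tendsto (fun n => (harmonic n : ℝ)) atTop atTop :=
  tendsto_atTop_mono log_add_one_le_harmonic
    (Real.tendsto_log_atTop.comp (tendsto_natCast_atTop_atTop.comp (tendsto_add_atTop_nat 1)))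

theorem harmonic_nonneg (n : ℕ) : 0 ≤ (harmonic n : ℝ) :=
  (Real.log_nonneg (by exact_mod_cast Nat.succ_le_succ (Nat.zero_le n))).trans
    (log_add_one_le_harmonic n)

/-- The factor `e` absorbs the `1` of `1 + log n`, so that powers of harmonic numbers are bounded by
powers of a single logarithm. -/
theorem harmonic_le_log (n : ℕ) : (harmonic n : ℝ) ≤ Real.log (Real.exp 1 * ((n : ℝ) + 1)) := by
  have hn : (0 : ℝ) < (n : ℝ) + 1 := by positivity
  rw [Real.log_mul (Real.exp_ne_zero _) hn.ne', Real.log_exp]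
  refine (harmonic_le_one_add_log n).trans ?_
  rcases Nat.eq_zero_or_pos n with rfl | h
  · simp
  · have : (0 : ℝ) < n := by exact_mod_cast h
    gcongr
    linarith

/-- A power saving beats every power of the logarithm. This turns the elementary rates of
convergence below into negligible errors. -/
theorem negligible_harmonic_of_le {f : ℕ → ℂ} {C : ℝ}
    (hf : ∀ n, ‖f n‖ ≤ C / √((n : ℝ) + 1)) : Negligible (fun n => (harmonic n : ℝ)) f := by
  intro j
  have hy : Tendsto (fun n : ℕ => Real.exp 1 * ((n : ℝ) + 1)) atTop atTop :=
    (tendsto_atTop_add_const_right _ _ tendsto_natCast_atTop_atTop).const_mul_atTop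
      (Real.exp_pos 1)
  have h1 := ((isLittleO_log_rpow_rpow_atTop (s := 1 / 2) (j : ℝ)
    (by norm_num)).tendsto_div_nhds_zero.comp hy).const_mul (C * √(Real.exp 1))
  rw [mul_zero] at h1
  refine squeeze_zero_norm (fun n => ?_) h1
  have hn : (0 : ℝ) < (n : ℝ) + 1 := by positivity
  rw [norm_mul, norm_pow, Complex.norm_real, Real.norm_of_nonneg (harmonic_nonneg n)]
  simp only [Function.comp_apply, Real.rpow_natCast, ← Real.sqrt_eq_rpow]
  have hC : 0 ≤ C / √((n : ℝ) + 1) := (norm_nonneg _).trans (hf n)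
  calc (harmonic n : ℝ) ^ j * ‖f n‖
      ≤ Real.log (Real.exp 1 * ((n : ℝ) + 1)) ^ j * (C / √((n : ℝ) + 1)) := by
        gcongr
        · exact pow_nonneg ((harmonic_nonneg n).trans (harmonic_le_log n)) j
        · exact harmonic_nonneg n
        · exact harmonic_le_log n
        · exact hf n
    _ = _ := by
        rw [Real.sqrt_mul (Real.exp_pos 1).le]
        have := (Real.sqrt_pos.2 hn).ne'
        have := (Real.sqrt_pos.2 (Real.exp_pos 1)).ne'
        field_simp

end Expansion

/-! ### Truncated polylogarithm sums -/

section TruncatedSums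

variable (Γ : Subgroup ℂˣ)

/-- The summand `ν ^ (k + 1) / (k + 1) ^ n` belonging to the letter `y_{n,ν}`. -/
noncomputable def letterTerm (y : YLetter Γ) (k : ℕ) : ℂ :=
  ((y.2 : ℂˣ) : ℂ) ^ (k + 1) / ((k : ℂ) + 1) ^ (y.1 : ℕ)

/-- The sum over `M ≥ k_1 > ⋯ > k_r > 0` of `∏ σ_i ^ k_i / k_i ^ s_i`. -/
noncomputable def truncatedSum : List (YLetter Γ) → ℕ → ℂ
  | [], _ => 1
  | y :: w, M => ∑ k ∈ Finset.range M, letterTerm Γ y k * truncatedSum w k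

theorem truncatedSum_cons_succ (y : YLetter Γ) (w : List (YLetter Γ)) (M : ℕ) :
    truncatedSum Γ (y :: w) (M + 1) =
      truncatedSum Γ (y :: w) M + letterTerm Γ y M * truncatedSum Γ w M := by
  rw [truncatedSum, Finset.sum_range_succ]; rfl

theorem truncatedSum_cons_zero (y : YLetter Γ) (w : List (YLetter Γ)) :
    truncatedSum Γ (y :: w) 0 = 0 := rfl

theorem letterTerm_merge (a b : YLetter Γ) (k : ℕ) :
    letterTerm Γ (a.1 + b.1, a.2 * b.2) k = letterTerm Γ a k * letterTerm Γ b k := by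
  simp only [letterTerm, PNat.add_coe, pow_add, Subgroup.coe_mul, Units.val_mul, mul_pow]
  rw [div_mul_div_comm]; ring

/-- A discrete Leibniz rule. Raising `M` by one adds to a product `F G` the terms `ΔF · G`, `F · ΔG`
and `ΔF · ΔG`, and the last one is the merged letter by `letterTerm_merge`. -/
theorem evalShuffle_truncatedSum (M : ℕ) (u v : List (YLetter Γ)) :
    evalShuffle (stuffleMerge Γ) (fun w => truncatedSum Γ w M) u v =
      truncatedSum Γ u M * truncatedSum Γ v M := by
  induction M generalizing u v with
  | zero =>
    cases u with
    | nil => simp [truncatedSum]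
    | cons a u =>
      cases v with
      | nil => simp [truncatedSum]
      | cons b v => simp [evalShuffle_cons_cons, truncatedSum_cons_zero, stuffleMerge]
  | succ M ih =>
    cases u with
    | nil => simp [truncatedSum]
    | cons a u =>
      cases v with
      | nil => simp [truncatedSum]
      | cons b v =>
        have h := ih (a :: u) (b :: v)
        rw [evalShuffle_cons_cons] at h ⊢
        simp only [truncatedSum_cons_succ, stuffleMerge, Option.elim_some, evalShuffle_add,
          evalShuffle_const_mul, ih, letterTerm_merge] at h ⊢
        linear_combination h

theorem isShuffleChar_truncatedSum : IsShuffleChar (stuffleMerge Γ) (truncatedSum Γ) :=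
  ⟨rfl, fun u v => funext fun M => by
    have := map_evalShuffle (stuffleMerge Γ) (truncatedSum Γ) (Pi.evalRingHom (fun _ => ℂ) M) u v
    simp only [Pi.evalRingHom_apply] at this
    rw [this, evalShuffle_truncatedSum]; rfl⟩

/-! ### The polylogarithm partial sums in recursive form. -/

theorem strictAnti_cons_iff {r : ℕ} {k : ℕ} {κ : Fin r → ℕ} :
    StrictAnti (Fin.cons k κ : Fin (r + 1) → ℕ) ↔ (∀ i, κ i < k) ∧ StrictAnti κ := by
  constructor
  · intro h
    refine ⟨fun i => ?_, fun i j hij => ?_⟩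
    · simpa using h (Fin.succ_pos i)
    · simpa using h (Fin.succ_lt_succ_iff.2 hij)
  · rintro ⟨h1, h2⟩ i j hij
    induction j using Fin.cases with
    | zero => exact absurd hij (Fin.not_lt_zero _)
    | succ j =>
      induction i using Fin.cases with
      | zero => simpa using h1 j
      | succ i => simpa using h2 (Fin.succ_lt_succ_iff.1 hij)

/-- The outermost index is `k + 1` with `k < M`, so the strictly smaller inner indices are bounded
by `k`. -/
theorem polylogPartialSum_succ {r : ℕ} (s : Fin (r + 1) → ℕ) (z : Fin (r + 1) → ℂ) (M : ℕ) :
    polylogPartialSum s z M = ∑ k ∈ Finset.range M, z 0 ^ (k + 1) / ((k : ℂ) + 1) ^ s 0 *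
      polylogPartialSum (fun i => s i.succ) (fun i => z i.succ) k := by
  simp only [polylogPartialSum, Finset.mul_sum]
  rw [Finset.sum_sigma']
  refine Finset.sum_bij' (fun f _ => ⟨f 0 - 1, Fin.tail f⟩)
    (fun x _ => (Fin.cons (x.1 + 1) x.2 : Fin (r + 1) → ℕ)) ?_ ?_ ?_ ?_ ?_
  · intro f hf
    simp only [Finset.mem_filter, Fintype.mem_piFinset, Finset.mem_Icc] at hf
    simp only [Finset.mem_sigma, Finset.mem_range, Finset.mem_filter, Fintype.mem_piFinset,
      Finset.mem_Icc]
    have h0 := hf.1 0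
    refine ⟨by omega, fun i => ⟨(hf.1 i.succ).1, ?_⟩, fun i j hij =>
      hf.2 (Fin.succ_lt_succ_iff.2 hij)⟩
    have := hf.2 (Fin.succ_pos i)
    simp only [Fin.tail]
    omega
  · rintro ⟨k, κ⟩ h
    simp only [Finset.mem_sigma, Finset.mem_range, Finset.mem_filter, Fintype.mem_piFinset,
      Finset.mem_Icc] at h
    simp only [Finset.mem_filter, Fintype.mem_piFinset, Finset.mem_Icc, strictAnti_cons_iff]
    refine ⟨fun i => ?_, fun i => ?_, h.2.2⟩
    · induction i using Fin.cases with
      | zero => simp; omega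
      | succ i => simp only [Fin.cons_succ]; have := h.2.1 i; omega
    · have := h.2.1 i; omega
  · intro f hf
    simp only [Finset.mem_filter, Fintype.mem_piFinset, Finset.mem_Icc] at hf
    have h0 := hf.1 0
    simp only
    rw [Nat.sub_add_cancel h0.1, Fin.cons_self_tail]
  · rintro ⟨k, κ⟩ _
    simp
  · intro f hf
    simp only [Finset.mem_filter, Fintype.mem_piFinset, Finset.mem_Icc] at hf
    have h0 := hf.1 0
    obtain ⟨k, hk⟩ : ∃ k, f 0 = k + 1 := ⟨f 0 - 1, by omega⟩
    rw [Fin.prod_univ_succ, hk]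
    simp [Fin.tail]

theorem polylogPartialSum_eq (w : List (YLetter Γ)) (M : ℕ) :
    polylogPartialSum (fun i => ((w.get i).1 : ℕ)) (fun i => (((w.get i).2 : ℂˣ) : ℂ)) M =
      truncatedSum Γ w M := by
  induction w generalizing M with
  | nil =>
    simp only [polylogPartialSum, truncatedSum]
    rw [Finset.filter_true_of_mem (fun x _ i => i.elim0)]
    simp
  | cons y w ih =>
    have := polylogPartialSum_succ (r := w.length) (fun i => (((y :: w).get i).1 : ℕ))
      (fun i => ((((y :: w).get i).2 : ℂˣ) : ℂ)) M
    refine this.trans ?_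
    rw [truncatedSum]
    exact Finset.sum_congr rfl fun k _ => by rw [← ih]; rfl

theorem truncatedSum_singleton_one (M : ℕ) :
    truncatedSum Γ [(1, 1)] M = (((harmonic M : ℚ) : ℝ) : ℂ) := by
  simp [truncatedSum, letterTerm, harmonic]

theorem stuffleMerge_ne (b c : YLetter Γ) : stuffleMerge Γ b c ≠ some (1, 1) := by
  intro h
  have h1 := congrArg (fun x : YLetter Γ => (x.1 : ℕ)) (Option.some_inj.1 h)
  simp only [PNat.add_coe, PNat.one_coe] at h1
  have := b.1.pos
  have := c.1.pos
  omega

theorem IsPolylogSeries.isShuffleChar [Fintype Γ] {L : NCSeries (YLetter Γ) ℂ}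
    (hL : IsPolylogSeries Γ L) :
    IsShuffleChar (stuffleMerge Γ) fun w => L (FreeMonoid.ofList w) :=
  (isDiagonal_iff_isShuffleChar _ _ (stuffleCoproduct_peel Γ) L).1 hL.diagonal

/-! ### Convergence with a rate -/

/-- Increments of size `k^{-3/2}` are dominated by those of a telescoping sequence of size
`k^{-1/2}`, which bounds the tail. -/
theorem exists_norm_sub_le_of_norm_sub_le {S : ℕ → ℂ} {C : ℝ}
    (hS : ∀ k : ℕ, ‖S (k + 1) - S k‖ ≤ C / (((k : ℝ) + 1) * √((k : ℝ) + 1))) :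
    ∃ l C', ∀ M : ℕ, ‖S M - l‖ ≤ C' / √((M : ℝ) + 1) := by
  -- With `p = √(k+1)` and `q = √(k+2)`, one has `1/p - 1/q = 1/(p q (p + q))`. The factor `4`
  -- suffices because `q² ≤ 2p²` and `pq ≤ 2p²`.
  set b : ℕ → ℝ := fun k => 4 * C / √((k : ℝ) + 1) with hb
  have hC : 0 ≤ C := by simpa using (norm_nonneg _).trans (hS 0)
  have hb0 : ∀ k, 0 ≤ b k := fun k => by positivity
  have hstep : ∀ k, ‖S (k + 1) - S k‖ ≤ b k - b (k + 1) := by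
    intro k
    refine (hS k).trans ?_
    have hx : (0 : ℝ) < (k : ℝ) + 1 := by positivity
    set p := √((k : ℝ) + 1) with hp
    set q := √(((k + 1 : ℕ) : ℝ) + 1) with hq
    have hp2 : p ^ 2 = (k : ℝ) + 1 := Real.sq_sqrt hx.le
    have hq2 : q ^ 2 = (k : ℝ) + 1 + 1 := by
      rw [hq, Real.sq_sqrt (by positivity)]; push_cast; ring
    have hp1 : 1 ≤ p := Real.one_le_sqrt.2 (by linarith [(Nat.cast_nonneg k : (0 : ℝ) ≤ k)])
    have hpq : p ≤ q := Real.sqrt_le_sqrt (by push_cast; linarith)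
    have hq0 : 0 < q := by linarith
    have hqp : q ≤ 2 * p - 0 ∧ q * q ≤ 2 * (p * p) := by
      constructor <;> nlinarith
    have key : q - p = 1 / (q + p) := by
      field_simp
      nlinarith
    have : b k - b (k + 1) = 4 * C * ((q - p) / (p * q)) := by
      simp only [hb, ← hp, ← hq]
      field_simp
    rw [this, ← hp2, key, div_div, show C / (p ^ 2 * p) = C * (1 / (p ^ 2 * p)) by ring, mul_comm 4,
      mul_assoc]
    refine mul_le_mul_of_nonneg_left ?_ hC
    rw [mul_one_div, div_le_div_iff₀ (by positivity) (by positivity)]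
    nlinarith [mul_pos hq0 (by linarith : 0 < p)]
  have hle : ∀ M n, ‖S (M + n) - S M‖ ≤ b M - b (M + n) := by
    intro M n
    induction n with
    | zero => simp
    | succ n ih =>
      calc ‖S (M + (n + 1)) - S M‖ = ‖(S (M + n + 1) - S (M + n)) + (S (M + n) - S M)‖ := by
            rw [← add_assoc]; congr 1; ring
        _ ≤ _ := (norm_add_le _ _).trans (add_le_add (hstep _) ih)
        _ = _ := by rw [← add_assoc]; ring
  have hle' : ∀ M N, M ≤ N → ‖S N - S M‖ ≤ b M := by
    intro M N h
    obtain ⟨n, rfl⟩ := Nat.exists_eq_add_of_le h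
    linarith [hle M n, hb0 (M + n)]
  have hb_lim : Tendsto b atTop (𝓝 0) := by
    refine Tendsto.div_atTop tendsto_const_nhds ?_
    exact Real.tendsto_sqrt_atTop.comp
      (tendsto_atTop_add_const_right _ _ tendsto_natCast_atTop_atTop)
  have hcauchy : CauchySeq S := by
    refine cauchySeq_of_le_tendsto_0' b (fun n m h => ?_) hb_lim
    rw [dist_comm, dist_eq_norm]
    exact hle' n m h
  obtain ⟨l, hl⟩ := cauchySeq_tendsto_of_complete hcauchy
  refine ⟨l, 4 * C, fun M => ?_⟩
  rw [norm_sub_rev]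
  exact le_of_tendsto (hl.sub_const (S M)).norm
    (eventually_atTop.2 ⟨M, fun N hN => hle' M N hN⟩)

variable [Finite Γ]

theorem norm_coe_subgroup (ν : Γ) : ‖((ν : ℂˣ) : ℂ)‖ = 1 := by
  refine Complex.norm_eq_one_of_pow_eq_one (n := Nat.card Γ) ?_ Nat.card_pos.ne'
  rw [← Units.val_pow_eq_pow_val, ← Subgroup.coe_pow, pow_card_eq_one']
  rfl

theorem norm_letterTerm (y : YLetter Γ) (k : ℕ) :
    ‖letterTerm Γ y k‖ = 1 / ((k : ℝ) + 1) ^ (y.1 : ℕ) := by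
  rw [letterTerm, norm_div, norm_pow, norm_pow, norm_coe_subgroup, one_pow]
  congr 2
  have := Complex.norm_natCast (k + 1)
  push_cast at this
  exact this

theorem norm_letterTerm_le (y : YLetter Γ) {n k : ℕ} (hn : n ≤ y.1) :
    ‖letterTerm Γ y k‖ ≤ 1 / ((k : ℝ) + 1) ^ n := by
  rw [norm_letterTerm]
  have : (1 : ℝ) ≤ (k : ℝ) + 1 := by linarith [(Nat.cast_nonneg k : (0 : ℝ) ≤ k)]
  gcongr

theorem sum_one_div_sqrt_le (M : ℕ) :
    ∑ k ∈ Finset.range M, 1 / √((k : ℝ) + 1) ≤ 2 * √(M : ℝ) := by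
  induction M with
  | zero => simp
  | succ M ih =>
    rw [Finset.sum_range_succ, Nat.cast_succ]
    have hx : (0 : ℝ) < (M : ℝ) + 1 := by positivity
    have hp := Real.sqrt_pos.2 hx
    have hp2 := Real.sq_sqrt hx.le
    have hq2 := Real.sq_sqrt (Nat.cast_nonneg M : (0 : ℝ) ≤ M)
    have : 1 / √((M : ℝ) + 1) ≤ 2 * (√((M : ℝ) + 1) - √(M : ℝ)) := by
      rw [div_le_iff₀ hp]
      nlinarith [sq_nonneg (√((M : ℝ) + 1) - √(M : ℝ))]
    linarith

/-- The bound `√M` is crude, but it is stable under adding a letter, because `∑ k^{-1} · √k` is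
again `O(√M)`. It leaves increments `O(k^{-3/2})` as soon as the first letter contributes `k^{-2}`.
-/
theorem exists_norm_truncatedSum_le (w : List (YLetter Γ)) :
    ∃ C : ℝ, 0 ≤ C ∧ ∀ M : ℕ, ‖truncatedSum Γ w M‖ ≤ C * √((M : ℝ) + 1) := by
  induction w with
  | nil =>
    refine ⟨1, zero_le_one, fun M => ?_⟩
    rw [truncatedSum, norm_one, one_mul]
    exact Real.one_le_sqrt.2 (by linarith [(Nat.cast_nonneg M : (0 : ℝ) ≤ M)])
  | cons y w ih =>
    obtain ⟨C, hC, h⟩ := ih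
    refine ⟨C * 2, by positivity, fun M => ?_⟩
    rw [truncatedSum]
    refine (norm_sum_le _ _).trans ?_
    rw [mul_assoc]
    refine le_trans ?_ (mul_le_mul_of_nonneg_left ((sum_one_div_sqrt_le M).trans
      (by gcongr; linarith : 2 * √(M : ℝ) ≤ 2 * √((M : ℝ) + 1))) hC)
    rw [Finset.mul_sum]
    refine Finset.sum_le_sum fun k _ => ?_
    rw [norm_mul]
    have hx : (0 : ℝ) < (k : ℝ) + 1 := by positivity
    calc _ ≤ 1 / ((k : ℝ) + 1) ^ 1 * (C * √((k : ℝ) + 1)) :=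
          mul_le_mul (norm_letterTerm_le Γ y y.1.pos) (h k) (norm_nonneg _) (by positivity)
      _ = C * (1 / √((k : ℝ) + 1)) := by
          have h1 := Real.sqrt_pos.2 hx
          have h2 := Real.mul_self_sqrt hx.le
          field_simp
          nlinarith

theorem exists_norm_truncatedSum_succ_sub_le (w : List (YLetter Γ)) :
    ∃ C : ℝ, 0 ≤ C ∧ ∀ M : ℕ,
      ‖truncatedSum Γ w (M + 1) - truncatedSum Γ w M‖ ≤ C / √((M : ℝ) + 1) := by
  cases w with
  | nil => exact ⟨0, le_rfl, fun M => by simp [truncatedSum]⟩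
  | cons y w =>
    obtain ⟨C, hC, h⟩ := exists_norm_truncatedSum_le Γ w
    refine ⟨C, hC, fun M => ?_⟩
    rw [truncatedSum_cons_succ, add_sub_cancel_left, norm_mul]
    have hx : (0 : ℝ) < (M : ℝ) + 1 := by positivity
    calc _ ≤ 1 / ((M : ℝ) + 1) ^ 1 * (C * √((M : ℝ) + 1)) :=
          mul_le_mul (norm_letterTerm_le Γ y y.1.pos) (h M) (norm_nonneg _) (by positivity)
      _ = C / √((M : ℝ) + 1) := by
          have h1 := Real.sqrt_pos.2 hx
          have h2 := Real.mul_self_sqrt hx.le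
          field_simp
          nlinarith

theorem exists_norm_truncatedSum_sub_le_of_two_le {y : YLetter Γ} (hy : 2 ≤ (y.1 : ℕ))
    (w : List (YLetter Γ)) :
    ∃ l C, ∀ M : ℕ, ‖truncatedSum Γ (y :: w) M - l‖ ≤ C / √((M : ℝ) + 1) := by
  obtain ⟨C, hC, h⟩ := exists_norm_truncatedSum_le Γ w
  refine exists_norm_sub_le_of_norm_sub_le (C := C) fun k => ?_
  rw [truncatedSum_cons_succ, add_sub_cancel_left, norm_mul]
  have hx : (0 : ℝ) < (k : ℝ) + 1 := by positivity
  calc _ ≤ 1 / ((k : ℝ) + 1) ^ 2 * (C * √((k : ℝ) + 1)) :=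
        mul_le_mul (norm_letterTerm_le Γ y hy) (h k) (norm_nonneg _) (by positivity)
    _ = C / (((k : ℝ) + 1) * √((k : ℝ) + 1)) := by
        have h1 := Real.sqrt_pos.2 hx
        have h2 := Real.mul_self_sqrt hx.le
        field_simp
        nlinarith

/-- Summation by parts: the oscillating factor `z^k` with `z ≠ 1` has bounded partial sums.
Subtracting the boundary term `z^{M+1} g(M)` from `(z - 1)` times the sum leaves increments `z^{k+2}
(g(k) - g(k+1))`, which are `O(k^{-3/2})`. -/
theorem exists_norm_truncatedSum_sub_le_of_ne_one {ν : Γ} (hν : ν ≠ 1) (w : List (YLetter Γ)) :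
    ∃ l C, ∀ M : ℕ, ‖truncatedSum Γ ((1, ν) :: w) M - l‖ ≤ C / √((M : ℝ) + 1) := by
  obtain ⟨C, hC, h⟩ := exists_norm_truncatedSum_le Γ w
  obtain ⟨D, hD, h'⟩ := exists_norm_truncatedSum_succ_sub_le Γ w
  set z : ℂ := ((ν : ℂˣ) : ℂ) with hz
  have hz1 : z - 1 ≠ 0 := by
    rw [sub_ne_zero, hz]
    intro h
    exact hν (Subtype.ext (Units.ext h))
  have hzn : ‖z‖ = 1 := norm_coe_subgroup Γ ν
  set g : ℕ → ℂ := fun k => truncatedSum Γ w k / ((k : ℂ) + 1) with hg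
  have hcast : ∀ k : ℕ, ‖((k : ℂ) + 1)‖ = (k : ℝ) + 1 := by
    intro k
    have := Complex.norm_natCast (k + 1)
    push_cast at this
    exact this
  have hgn : ∀ k : ℕ, ‖g k‖ ≤ C / √((k : ℝ) + 1) := by
    intro k
    have hx : (0 : ℝ) < (k : ℝ) + 1 := by positivity
    simp only [hg]
    rw [norm_div, hcast]
    refine (div_le_div_of_nonneg_right (h k) hx.le).trans (le_of_eq ?_)
    have h1 := Real.sqrt_pos.2 hx
    have h2 := Real.mul_self_sqrt hx.le
    field_simp
    nlinarith
  obtain ⟨l, C', hl⟩ := exists_norm_sub_le_of_norm_sub_le (C := C + D)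
    (S := fun M => (z - 1) * truncatedSum Γ ((1, ν) :: w) M - z ^ (M + 1) * g M) (fun k => by
      have h1 : letterTerm Γ (1, ν) k * truncatedSum Γ w k = z ^ (k + 1) * g k := by
        simp only [letterTerm, hg, PNat.one_coe, pow_one, ← hz]; ring
      have hk1 : ((k : ℂ) + 1) ≠ 0 := by exact_mod_cast k.succ_ne_zero
      have hk2 : ((k : ℂ) + 1 + 1) ≠ 0 := by exact_mod_cast (k + 1).succ_ne_zero
      -- The difference `g(k) - g(k+1)` is split into the change of the denominator and the change
      -- of the inner truncated sum.
      have h2 : (z - 1) * truncatedSum Γ ((1, ν) :: w) (k + 1) - z ^ (k + 1 + 1) * g (k + 1) -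
          ((z - 1) * truncatedSum Γ ((1, ν) :: w) k - z ^ (k + 1) * g k) =
          z ^ (k + 2) * (truncatedSum Γ w k / (((k : ℂ) + 1) * (((k + 1 : ℕ) : ℂ) + 1)) -
            (truncatedSum Γ w (k + 1) - truncatedSum Γ w k) / (((k + 1 : ℕ) : ℂ) + 1)) := by
        rw [truncatedSum_cons_succ, h1]
        simp only [hg]
        push_cast
        field_simp
        ring
      rw [h2, norm_mul, norm_pow, hzn, one_pow, one_mul]
      refine (norm_sub_le _ _).trans ?_
      rw [norm_div, norm_div, norm_mul, hcast, hcast]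
      have hx : (0 : ℝ) < (k : ℝ) + 1 := by positivity
      have h3 := Real.sqrt_pos.2 hx
      have h4 := Real.mul_self_sqrt hx.le
      push_cast
      calc _ ≤ C * √((k : ℝ) + 1) / (((k : ℝ) + 1) * ((k : ℝ) + 1)) +
            D / √((k : ℝ) + 1) / ((k : ℝ) + 1) := by
            gcongr
            · exact h k
            · linarith
            · exact h' k
            · linarith
        _ = _ := by
            field_simp
            nlinarith)
  refine ⟨l / (z - 1), (C' + C) / ‖z - 1‖, fun M => ?_⟩
  have h1 : truncatedSum Γ ((1, ν) :: w) M - l / (z - 1) =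
      (((z - 1) * truncatedSum Γ ((1, ν) :: w) M - z ^ (M + 1) * g M - l) + z ^ (M + 1) * g M) /
        (z - 1) := by
    field_simp
    ring
  rw [h1, norm_div, div_right_comm]
  refine div_le_div_of_nonneg_right ?_ (norm_nonneg _)
  rw [add_div]
  refine (norm_add_le _ _).trans (add_le_add (hl M) ?_)
  rw [norm_mul, norm_pow, hzn, one_pow, one_mul]
  exact hgn M

theorem truncatedSum_hasExpansion_of_head?_ne {w : List (YLetter Γ)}
    (hw : w.head? ≠ some (1, 1)) :
    ∃ l, HasExpansion (fun n => (harmonic n : ℝ)) (truncatedSum Γ w) (Polynomial.C l) := by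
  have key : ∃ l C, ∀ M : ℕ, ‖truncatedSum Γ w M - l‖ ≤ C / √((M : ℝ) + 1) := by
    cases w with
    | nil => exact ⟨1, 0, fun M => by simp [truncatedSum]⟩
    | cons y w =>
      by_cases hy : 2 ≤ (y.1 : ℕ)
      · exact exists_norm_truncatedSum_sub_le_of_two_le Γ hy w
      · obtain ⟨s, ν⟩ := y
        obtain rfl : s = 1 := PNat.coe_injective (by
          have := s.pos
          rw [PNat.one_coe]
          simp only at hy
          omega)
        refine exists_norm_truncatedSum_sub_le_of_ne_one Γ (fun h => hw ?_) w
        rw [h]; rfl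
  obtain ⟨l, C, h⟩ := key
  refine ⟨l, negligible_harmonic_of_le (C := C) fun n => ?_⟩
  simpa using h n

/-- Sequences with an expansion form a subalgebra containing the harmonic numbers and the convergent
truncated sums; a character with these values on generators stays inside it. -/
theorem truncatedSum_hasExpansion (w : List (YLetter Γ)) :
    ∃ P, HasExpansion (fun n => (harmonic n : ℝ)) (truncatedSum Γ w) P := by
  refine (isShuffleChar_truncatedSum Γ).mem_of_head?_ne (a := (1, 1)) (stuffleMerge_ne Γ _)
    (expansionSubalgebra _) Set.univ (fun w _ => ⟨trivial, fun _ _ => trivial⟩)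
    ⟨Polynomial.X, hasExpansion_self.congr fun n => (truncatedSum_singleton_one Γ n).symm⟩
    (fun w _ hw => ?_) w trivial
  obtain ⟨l, hl⟩ := truncatedSum_hasExpansion_of_head?_ne Γ hw
  exact ⟨_, hl⟩

/-! ### The regularized generating series of the polylogarithm values -/

/-- The polynomial in the harmonic numbers approximating a truncated sum. -/
noncomputable def polylogPoly (w : List (YLetter Γ)) : Polynomial ℂ :=
  (truncatedSum_hasExpansion Γ w).choose

theorem hasExpansion_polylogPoly (w : List (YLetter Γ)) :
    HasExpansion (fun n => (harmonic n : ℝ)) (truncatedSum Γ w) (polylogPoly Γ w) :=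
  (truncatedSum_hasExpansion Γ w).choose_spec

theorem isShuffleChar_polylogPoly : IsShuffleChar (stuffleMerge Γ) (polylogPoly Γ) :=
  (isShuffleChar_truncatedSum Γ).of_hasExpansion tendsto_harmonic_atTop
    (hasExpansion_polylogPoly Γ)

theorem polylogPoly_singleton_one : polylogPoly Γ [(1, 1)] = Polynomial.X :=
  (hasExpansion_polylogPoly Γ _).unique tendsto_harmonic_atTop
    (hasExpansion_self.congr fun n => (truncatedSum_singleton_one Γ n).symm)

theorem polylogPoly_of_head?_ne {w : List (YLetter Γ)} (hw : w.head? ≠ some (1, 1)) :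
    ∃ l, polylogPoly Γ w = Polynomial.C l ∧ Tendsto (truncatedSum Γ w) atTop (𝓝 l) := by
  obtain ⟨l, hl⟩ := truncatedSum_hasExpansion_of_head?_ne Γ hw
  exact ⟨l, (hasExpansion_polylogPoly Γ w).unique tendsto_harmonic_atTop hl, hl.tendsto⟩

end TruncatedSums

section PolylogSeries

variable (Γ : Subgroup ℂˣ) [Fintype Γ]

theorem IsPolylogSeries.tendsto {Γ : Subgroup ℂˣ} [Fintype Γ] {L : NCSeries (YLetter Γ) ℂ}
    (hL : IsPolylogSeries Γ L) {w : List (YLetter Γ)} (hw : w.head? ≠ some (1, 1)) :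
    Tendsto (truncatedSum Γ w) atTop (𝓝 (L (FreeMonoid.ofList w))) :=
  (hL.convergent (FreeMonoid.ofList w) hw).congr (polylogPartialSum_eq Γ w)

/-- Existence and uniqueness of the series `ℒ`. -/
theorem existsUnique_isPolylogSeries : ∃! L : NCSeries (YLetter Γ) ℂ, IsPolylogSeries Γ L := by
  refine ⟨fun w => (polylogPoly Γ (FreeMonoid.toList w)).eval 0, ⟨?_, fun w hw => ?_, ?_⟩,
    fun L hL => ?_⟩
  · exact (isDiagonal_iff_isShuffleChar _ _ (stuffleCoproduct_peel Γ) _).2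
      ((isShuffleChar_polylogPoly Γ).comp (Polynomial.evalRingHom 0))
  · obtain ⟨l, h1, h2⟩ := polylogPoly_of_head?_ne Γ hw
    rw [h1, Polynomial.eval_C]
    exact h2.congr fun M => (polylogPartialSum_eq Γ w.toList M).symm
  · change (polylogPoly Γ [(1, 1)]).eval 0 = 0
    rw [polylogPoly_singleton_one, Polynomial.eval_X]
  · refine funext fun w => ?_
    refine hL.isShuffleChar.ext_of_head?_ne
      ((isShuffleChar_polylogPoly Γ).comp (Polynomial.evalRingHom 0)) (stuffleMerge_ne Γ (1, 1))
      Set.univ (fun w _ => ⟨trivial, fun _ _ => trivial⟩) ?_ (fun w _ hw => ?_) w.toList trivial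
    · rw [polylogPoly_singleton_one, Polynomial.coe_evalRingHom, Polynomial.eval_X]
      exact hL.coeff_y_one_one
    · obtain ⟨l, h1, h2⟩ := polylogPoly_of_head?_ne Γ hw
      rw [h1, Polynomial.coe_evalRingHom, Polynomial.eval_C]
      exact tendsto_nhds_unique (hL.tendsto hw) h2

/-- The expansion polynomials are the coefficients of `exp(T y_{1,1}) ℒ`. -/
theorem polylogPoly_eq {L : NCSeries (YLetter Γ) ℂ} (hL : IsPolylogSeries Γ L)
    (w : List (YLetter Γ)) :
    polylogPoly Γ w = polylogSeriesT L (FreeMonoid.ofList w) := by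
  refine (isShuffleChar_polylogPoly Γ).ext_of_head?_ne
    (isShuffleChar_ofLetter_mul (stuffleMerge_ne Γ) hL.isShuffleChar) (stuffleMerge_ne Γ (1, 1))
    Set.univ (fun w _ => ⟨trivial, fun _ _ => trivial⟩) ?_ (fun w _ hw => ?_) w trivial
  · rw [polylogPoly_singleton_one,
      ofLetter_mul_singleton _ _ hL.diagonal.1 hL.coeff_y_one_one]
  · obtain ⟨l, h1, h2⟩ := polylogPoly_of_head?_ne Γ hw
    rw [h1, ofLetter_mul_eq_C _ _ hw, tendsto_nhds_unique (hL.tendsto hw) h2]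

end PolylogSeries

/-! ### Power series with polynomially bounded coefficients -/

section PolyBounded

/-- The coefficients of `f` are bounded by a polynomial. -/
def PolyBounded (f : PowerSeries ℂ) : Prop :=
  ∃ (C : ℝ) (k : ℕ), 0 ≤ C ∧ ∀ n, ‖PowerSeries.coeff n f‖ ≤ C * ((n : ℝ) + 1) ^ k

/-- The value at `t` of a power series. -/
noncomputable def seriesEval (t : ℝ) (f : PowerSeries ℂ) : ℂ :=
  ∑' n, PowerSeries.coeff n f * (t : ℂ) ^ n

variable {f g : PowerSeries ℂ} {t : ℝ}

theorem one_le_natCast_add_one (n : ℕ) : (1 : ℝ) ≤ (n : ℝ) + 1 := by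
  linarith [(Nat.cast_nonneg n : (0 : ℝ) ≤ n)]

theorem PolyBounded.add (hf : PolyBounded f) (hg : PolyBounded g) : PolyBounded (f + g) := by
  obtain ⟨C, k, hC, h⟩ := hf
  obtain ⟨D, l, hD, h'⟩ := hg
  refine ⟨C + D, k + l, by positivity, fun n => ?_⟩
  rw [map_add, add_mul]
  refine (norm_add_le _ _).trans (add_le_add ((h n).trans ?_) ((h' n).trans ?_))
  · gcongr
    · exact one_le_natCast_add_one n
    · omega
  · gcongr
    · exact one_le_natCast_add_one n
    · omega

theorem PolyBounded.neg (hf : PolyBounded f) : PolyBounded (-f) := by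
  obtain ⟨C, k, hC, h⟩ := hf
  exact ⟨C, k, hC, fun n => by rw [map_neg, norm_neg]; exact h n⟩

theorem PolyBounded.sub (hf : PolyBounded f) (hg : PolyBounded g) : PolyBounded (f - g) := by
  rw [sub_eq_add_neg]
  exact hf.add hg.neg

theorem PolyBounded.mul (hf : PolyBounded f) (hg : PolyBounded g) : PolyBounded (f * g) := by
  obtain ⟨C, k, hC, h⟩ := hf
  obtain ⟨D, l, hD, h'⟩ := hg
  refine ⟨C * D, k + l + 1, by positivity, fun n => ?_⟩
  rw [PowerSeries.coeff_mul]
  have hle : ∀ p ∈ Finset.HasAntidiagonal.antidiagonal n,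
      ‖PowerSeries.coeff p.1 f * PowerSeries.coeff p.2 g‖ ≤ C * D * ((n : ℝ) + 1) ^ (k + l) := by
    intro p hp
    have hp' := Finset.HasAntidiagonal.mem_antidiagonal.1 hp
    have h1 : (p.1 : ℝ) ≤ n := by exact_mod_cast (by omega : p.1 ≤ n)
    have h2 : (p.2 : ℝ) ≤ n := by exact_mod_cast (by omega : p.2 ≤ n)
    rw [norm_mul]
    calc _ ≤ (C * ((p.1 : ℝ) + 1) ^ k) * (D * ((p.2 : ℝ) + 1) ^ l) :=
          mul_le_mul (h _) (h' _) (norm_nonneg _) (by positivity)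
      _ ≤ (C * ((n : ℝ) + 1) ^ k) * (D * ((n : ℝ) + 1) ^ l) := by gcongr
      _ = _ := by ring
  refine (norm_sum_le_of_le _ hle).trans (le_of_eq ?_)
  rw [Finset.sum_const, Finset.Nat.card_antidiagonal, nsmul_eq_mul]
  push_cast
  ring

theorem polyBounded_C (c : ℂ) : PolyBounded (PowerSeries.C c) := by
  refine ⟨‖c‖, 0, norm_nonneg _, fun n => ?_⟩
  rw [pow_zero, mul_one, PowerSeries.coeff_C]
  split_ifs <;> simp

theorem polyBounded_one : PolyBounded 1 := by
  simpa using polyBounded_C 1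

theorem polyBounded_X : PolyBounded PowerSeries.X := by
  refine ⟨1, 0, zero_le_one, fun n => ?_⟩
  rw [PowerSeries.coeff_X]
  split_ifs <;> simp

theorem PolyBounded.derivative (hf : PolyBounded f) :
    PolyBounded (PowerSeries.derivative ℂ f) := by
  obtain ⟨C, k, hC, h⟩ := hf
  refine ⟨C * 2 ^ k, k + 1, by positivity, fun n => ?_⟩
  rw [PowerSeries.coeff_derivative, norm_mul]
  have h1 : ‖((n : ℂ) + 1)‖ = (n : ℝ) + 1 := by
    have := Complex.norm_natCast (n + 1)
    push_cast at this
    exact this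
  rw [h1, pow_succ, ← mul_assoc]
  refine mul_le_mul_of_nonneg_right ((h _).trans ?_) (by positivity)
  rw [mul_assoc, ← mul_pow]
  gcongr
  push_cast
  linarith [(Nat.cast_nonneg n : (0 : ℝ) ≤ n)]

theorem summable_pow_mul (k : ℕ) {r : ℝ} (hr : |r| < 1) :
    Summable fun n : ℕ => ((n : ℝ) + 1) ^ k * r ^ n := by
  have h : ∀ n : ℕ, ((n : ℝ) + 1) ^ k * r ^ n =
      ∑ i ∈ Finset.range (k + 1), (k.choose i : ℝ) * ((n : ℝ) ^ i * r ^ n) := by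
    intro n
    rw [add_pow, Finset.sum_mul]
    exact Finset.sum_congr rfl fun i _ => by rw [one_pow]; ring
  simp only [h]
  refine summable_sum fun i _ => Summable.mul_left _ ?_
  exact summable_pow_mul_geometric_of_norm_lt_one (R := ℝ) i hr

theorem PolyBounded.summable_norm (hf : PolyBounded f) (ht : |t| < 1) :
    Summable fun n => ‖PowerSeries.coeff n f * (t : ℂ) ^ n‖ := by
  obtain ⟨C, k, hC, h⟩ := hf
  refine Summable.of_nonneg_of_le (fun n => norm_nonneg _) (fun n => ?_)
    ((summable_pow_mul k (r := |t|) (by rwa [abs_abs])).mul_left C)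
  rw [norm_mul, norm_pow, Complex.norm_real, Real.norm_eq_abs, ← mul_assoc]
  exact mul_le_mul_of_nonneg_right (h n) (by positivity)

theorem PolyBounded.summable (hf : PolyBounded f) (ht : |t| < 1) :
    Summable fun n => PowerSeries.coeff n f * (t : ℂ) ^ n :=
  (hf.summable_norm ht).of_norm

theorem seriesEval_add (hf : PolyBounded f) (hg : PolyBounded g) (ht : |t| < 1) :
    seriesEval t (f + g) = seriesEval t f + seriesEval t g := by
  rw [seriesEval, seriesEval, seriesEval, ← (hf.summable ht).tsum_add (hg.summable ht)]
  exact tsum_congr fun n => by rw [map_add, add_mul]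

theorem seriesEval_neg : seriesEval t (-f) = -seriesEval t f := by
  rw [seriesEval, seriesEval, ← tsum_neg]
  exact tsum_congr fun n => by rw [map_neg, neg_mul]

theorem seriesEval_sub (hf : PolyBounded f) (hg : PolyBounded g) (ht : |t| < 1) :
    seriesEval t (f - g) = seriesEval t f - seriesEval t g := by
  rw [sub_eq_add_neg, seriesEval_add hf hg.neg ht, seriesEval_neg, sub_eq_add_neg]

theorem seriesEval_C (c : ℂ) : seriesEval t (PowerSeries.C c) = c := by
  rw [seriesEval, tsum_eq_single 0]
  · simp
  · intro n hn
    rw [PowerSeries.coeff_C, if_neg hn, zero_mul]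

theorem seriesEval_one : seriesEval t 1 = 1 := by
  simpa using seriesEval_C (t := t) 1

theorem seriesEval_X : seriesEval t PowerSeries.X = t := by
  rw [seriesEval, tsum_eq_single 1]
  · simp
  · intro n hn
    rw [PowerSeries.coeff_X, if_neg hn, zero_mul]

theorem seriesEval_mul (hf : PolyBounded f) (hg : PolyBounded g) (ht : |t| < 1) :
    seriesEval t (f * g) = seriesEval t f * seriesEval t g := by
  rw [seriesEval, seriesEval, seriesEval,
    tsum_mul_tsum_eq_tsum_sum_antidiagonal_of_summable_norm (hf.summable_norm ht)
      (hg.summable_norm ht)]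
  refine tsum_congr fun n => ?_
  rw [PowerSeries.coeff_mul, Finset.sum_mul]
  refine Finset.sum_congr rfl fun p hp => ?_
  rw [← Finset.HasAntidiagonal.mem_antidiagonal.1 hp, pow_add]
  ring

theorem seriesEval_zero : seriesEval 0 f = PowerSeries.coeff 0 f := by
  rw [seriesEval, tsum_eq_single 0]
  · simp
  · intro n hn
    simp [hn]

/-- Termwise differentiation on `(-r, r)` with `|t| < r < 1`. The derivative again has polynomially
bounded coefficients, hence is summable at `r`, and this gives the uniform majorant. -/
theorem hasDerivAt_seriesEval (hf : PolyBounded f) (ht : |t| < 1) :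
    HasDerivAt (fun t => seriesEval t f) (seriesEval t (PowerSeries.derivative ℂ f)) t := by
  obtain ⟨r, hr1, hr2⟩ := exists_between ht
  have hr0 : 0 ≤ r := (abs_nonneg t).trans hr1.le
  have hr : |r| < 1 := by rwa [abs_of_nonneg hr0]
  have hmem : ∀ y ∈ Set.Ioo (-r) r, |y| ≤ r := fun y hy => (abs_lt.2 ⟨hy.1, hy.2⟩).le
  have hsum : Summable fun n : ℕ => ‖PowerSeries.coeff n f‖ * (n * r ^ (n - 1)) := by
    rw [← summable_nat_add_iff 1]
    refine (hf.derivative.summable_norm hr).congr fun n => ?_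
    have h1 : ‖((n : ℂ) + 1)‖ = ((n + 1 : ℕ) : ℝ) := by
      rw [← Complex.norm_natCast (n + 1)]; push_cast; rfl
    rw [PowerSeries.coeff_derivative, norm_mul, norm_mul, norm_pow, Complex.norm_real,
      Real.norm_of_nonneg hr0, h1, Nat.add_sub_cancel, mul_assoc]
  have key := hasDerivAt_tsum_of_isPreconnected (𝕜 := ℝ) (F := ℂ)
    (g := fun n y => PowerSeries.coeff n f * (y : ℂ) ^ n)
    (g' := fun n y => PowerSeries.coeff n f * ((n : ℂ) * (y : ℂ) ^ (n - 1)))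
    (t := Set.Ioo (-r) r) (y₀ := t) (y := t) hsum isOpen_Ioo isPreconnected_Ioo
    (fun n y _ => by
      have h1 := ((Complex.ofRealCLM.hasDerivAt (x := y)).pow n).const_mul (PowerSeries.coeff n f)
      simpa using h1)
    (fun n y hy => by
      rw [norm_mul, norm_mul, norm_pow, Complex.norm_real, Real.norm_eq_abs, Complex.norm_natCast]
      gcongr
      exact hmem y hy)
    (abs_lt.1 hr1) (hf.summable ht) (abs_lt.1 hr1)
  refine key.congr_deriv ?_
  rw [seriesEval]
  have hs : Summable fun n : ℕ => PowerSeries.coeff n f * ((n : ℂ) * (t : ℂ) ^ (n - 1)) := by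
    rw [← summable_nat_add_iff 1]
    refine (hf.derivative.summable ht).congr fun n => ?_
    rw [PowerSeries.coeff_derivative, Nat.add_sub_cancel]; push_cast; ring
  rw [hs.tsum_eq_zero_add]
  simp only [Nat.cast_zero, zero_mul, mul_zero, zero_add, Nat.add_sub_cancel]
  refine tsum_congr fun n => ?_
  rw [PowerSeries.coeff_derivative]; push_cast; ring

end PolyBounded

/-! ### The generating series of iterated integrals -/

section IteratedSeries

variable (Γ : Subgroup ℂˣ)

/-- The expansion of `t ω_a(t) / dt`. -/
noncomputable def letterSeries : XLetter Γ → PowerSeries ℂ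
  | none => 1
  | some σ => PowerSeries.mk fun n => if n = 0 then 0 else ((σ : ℂˣ) : ℂ) ^ n

theorem letterSeries_zero : letterSeries Γ 0 = 1 := rfl

theorem letterSeries_coe (σ : Γ) : letterSeries Γ (σ : XLetter Γ) =
    PowerSeries.mk fun n => if n = 0 then 0 else ((σ : ℂˣ) : ℂ) ^ n := rfl

/-- The operator dividing the coefficient of `t ^ n` by `n`, an inverse of `t d/dt`. -/
noncomputable def logIntegral (f : PowerSeries ℂ) : PowerSeries ℂ :=
  PowerSeries.mk fun n => PowerSeries.coeff n f / n

theorem X_mul_derivative_logIntegral {f : PowerSeries ℂ} (hf : PowerSeries.constantCoeff f = 0) :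
    PowerSeries.X * PowerSeries.derivative ℂ (logIntegral f) = f := by
  ext n
  cases n with
  | zero => simpa using hf.symm
  | succ n =>
    rw [PowerSeries.coeff_succ_X_mul, PowerSeries.coeff_derivative, logIntegral,
      PowerSeries.coeff_mk]
    push_cast
    exact div_mul_cancel₀ _ (by exact_mod_cast n.succ_ne_zero)

/-- Since division by `0` gives `0`, the primitive selected is the one vanishing at `t = 0`. -/
theorem constantCoeff_logIntegral (f : PowerSeries ℂ) :
    PowerSeries.constantCoeff (logIntegral f) = 0 := by
  rw [← PowerSeries.coeff_zero_eq_constantCoeff_apply, logIntegral, PowerSeries.coeff_mk]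
  simp

theorem PolyBounded.logIntegral {f : PowerSeries ℂ} (hf : PolyBounded f) :
    PolyBounded (logIntegral f) := by
  obtain ⟨C, k, hC, h⟩ := hf
  refine ⟨C, k, hC, fun n => le_trans ?_ (h n)⟩
  rw [_root_.logIntegral, PowerSeries.coeff_mk, norm_div, Complex.norm_natCast]
  rcases Nat.eq_zero_or_pos n with rfl | hn
  · simp
  · exact div_le_self (norm_nonneg _) (by exact_mod_cast hn)

open Classical in
/-- The expansion at `0` of the iterated integral of a word, regularized at `0` so that the
integral of `dt / t` is `0`. -/
noncomputable def iteratedSeries : List (XLetter Γ) → PowerSeries ℂ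
  | [] => 1
  | a :: w => logIntegral (letterSeries Γ a * iteratedSeries w -
      if (a :: w).getLast? = some 0 then iteratedSeries ((a :: w).dropLast) else 0)
termination_by w => w.length

@[simp] theorem iteratedSeries_nil : iteratedSeries Γ [] = 1 := by
  rw [iteratedSeries]

theorem constantCoeff_iteratedSeries {w : List (XLetter Γ)} (hw : w ≠ []) :
    PowerSeries.constantCoeff (iteratedSeries Γ w) = 0 := by
  cases w with
  | nil => exact absurd rfl hw
  | cons a w => rw [iteratedSeries, constantCoeff_logIntegral]

/-- The part of `t d/dt` of the iterated integral of a word coming from its first letter. -/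
noncomputable def frontSeries : List (XLetter Γ) → PowerSeries ℂ
  | [] => 0
  | a :: w => letterSeries Γ a * iteratedSeries Γ w

open Classical in
/-- The part of `t d/dt` of the iterated integral of a word coming from its last letter. -/
noncomputable def backSeries (w : List (XLetter Γ)) : PowerSeries ℂ :=
  if w.getLast? = some 0 then iteratedSeries Γ w.dropLast else 0

/-- If `G` is the generating series of iterated integrals, then `G exp(-x_0 log t)` has no
logarithms, and `t d/dt` acts on it by stripping a first letter and, with a minus sign, a last
`x_0`. The only word whose two parts have nonzero constant terms is `x_0` itself, where `1 - 1 = 0`,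
so `logIntegral` does invert `t d/dt` here. -/
theorem X_mul_derivative_iteratedSeries (w : List (XLetter Γ)) :
    PowerSeries.X * PowerSeries.derivative ℂ (iteratedSeries Γ w) =
      frontSeries Γ w - backSeries Γ w := by
  cases w with
  | nil => simp [frontSeries, backSeries]
  | cons a w =>
    rw [iteratedSeries, X_mul_derivative_logIntegral]
    · rfl
    · rw [map_sub, map_mul]
      cases w with
      | nil =>
        rw [List.getLast?_singleton, List.dropLast_singleton]
        rcases eq_or_ne a 0 with rfl | ha
        · simp [letterSeries_zero]
        · rw [if_neg (by simpa using ha)]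
          obtain ⟨σ, rfl⟩ := WithZero.ne_zero_iff_exists.1 ha
          rw [letterSeries_coe, ← PowerSeries.coeff_zero_eq_constantCoeff_apply,
            PowerSeries.coeff_mk]
          simp
      | cons b w =>
        rw [constantCoeff_iteratedSeries Γ (by simp), mul_zero, zero_sub, neg_eq_zero]
        split_ifs
        · exact constantCoeff_iteratedSeries Γ (by simp)
        · simp

/-- The operator `t d/dt` is a derivation, and stripping first letters or last letters `x_0` is a
derivation for the shuffle product by the two recursions. Both sides thus have the same image under
`t d/dt`, by induction on the total length, and the same constant term. -/
theorem isShuffleChar_iteratedSeries :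
    IsShuffleChar (fun _ _ => none) (iteratedSeries Γ) := by
  classical
  refine ⟨iteratedSeries_nil Γ, fun u v => ?_⟩
  induction hn : u.length + v.length using Nat.strong_induction_on generalizing u v with
  | _ n ih =>
    rcases eq_or_ne u [] with rfl | hu
    · simp
    rcases eq_or_ne v [] with rfl | hv
    · simp
    have hfront : evalShuffle (fun _ _ => none) (frontSeries Γ) u v =
        frontSeries Γ u * iteratedSeries Γ v + iteratedSeries Γ u * frontSeries Γ v := by
      obtain ⟨a, u, rfl⟩ := List.exists_cons_of_ne_nil hu
      obtain ⟨b, v, rfl⟩ := List.exists_cons_of_ne_nil hv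
      simp only [List.length_cons] at hn
      rw [evalShuffle_none_cons_cons]
      simp only [frontSeries, evalShuffle_const_mul]
      rw [ih _ (by simp; omega) u (b :: v) rfl, ih _ (by simp; omega) (a :: u) v rfl]
      ring
    have hback : evalShuffle (fun _ _ => none) (backSeries Γ) u v =
        backSeries Γ u * iteratedSeries Γ v + iteratedSeries Γ u * backSeries Γ v := by
      obtain ⟨u, a, rfl⟩ := (List.eq_nil_or_concat u).resolve_left hu
      obtain ⟨v, b, rfl⟩ := (List.eq_nil_or_concat v).resolve_left hv
      have hb : ∀ w c, backSeries Γ (w ++ [c]) = if c = 0 then iteratedSeries Γ w else 0 := by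
        intro w c
        simp [backSeries]
      simp only [List.concat_eq_append, List.length_append, List.length_singleton] at hn ⊢
      rw [evalShuffle_append_singleton]
      simp only [hb]
      congr 1
      · split_ifs
        · rw [ih _ (by simp; omega) u (v ++ [b]) rfl]
        · simp
      · split_ifs
        · rw [ih _ (by simp; omega) (u ++ [a]) v rfl]
        · simp
    refine PowerSeries.derivative.ext ?_ ?_
    · refine mul_left_cancel₀ (PowerSeries.X_ne_zero (R := ℂ)) ?_
      rw [Derivation.leibniz, smul_eq_mul, smul_eq_mul, mul_add, mul_left_comm,
        X_mul_derivative_iteratedSeries, mul_left_comm, X_mul_derivative_iteratedSeries]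
      have h1 := map_evalShuffle (fun _ _ => none) (iteratedSeries Γ)
        ((AddMonoidHom.mulLeft (PowerSeries.X : PowerSeries ℂ)).comp
          (PowerSeries.derivative ℂ : PowerSeries ℂ →ₗ[ℂ] PowerSeries ℂ).toAddMonoidHom) u v
      have h2 : ∀ f : PowerSeries ℂ, ((AddMonoidHom.mulLeft (PowerSeries.X : PowerSeries ℂ)).comp
          (PowerSeries.derivative ℂ : PowerSeries ℂ →ₗ[ℂ] PowerSeries ℂ).toAddMonoidHom) f =
          PowerSeries.X * PowerSeries.derivative ℂ f := fun f => rfl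
      simp only [h2, X_mul_derivative_iteratedSeries] at h1
      rw [h1]
      have h3 := evalShuffle_add (fun _ _ => none)
        (fun w => frontSeries Γ w - backSeries Γ w) (backSeries Γ) u v
      simp only [sub_add_cancel] at h3
      linear_combination hfront - hback - h3
    · rw [map_evalShuffle, map_mul, constantCoeff_iteratedSeries Γ hu, zero_mul]
      obtain ⟨a, u, rfl⟩ := List.exists_cons_of_ne_nil hu
      obtain ⟨b, v, rfl⟩ := List.exists_cons_of_ne_nil hv
      rw [evalShuffle_none_cons_cons]
      simp [constantCoeff_iteratedSeries]

theorem polyBounded_letterSeries [Finite Γ] (a : XLetter Γ) : PolyBounded (letterSeries Γ a) := by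
  cases a with
  | none => exact polyBounded_one
  | some σ =>
    refine ⟨1, 0, zero_le_one, fun n => ?_⟩
    change ‖PowerSeries.coeff n (PowerSeries.mk fun n => if n = 0 then 0 else
      ((σ : ℂˣ) : ℂ) ^ n)‖ ≤ _
    rw [PowerSeries.coeff_mk]
    split_ifs
    · simp
    · rw [norm_pow, norm_coe_subgroup]; simp

theorem polyBounded_iteratedSeries [Finite Γ] (w : List (XLetter Γ)) :
    PolyBounded (iteratedSeries Γ w) := by
  induction hn : w.length using Nat.strong_induction_on generalizing w with
  | _ n ih =>
    cases w with
    | nil => rw [iteratedSeries_nil]; exact polyBounded_one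
    | cons a w =>
      simp only [List.length_cons] at hn
      rw [iteratedSeries]
      refine (((polyBounded_letterSeries Γ a).mul (ih _ (by omega) w rfl)).sub ?_).logIntegral
      split_ifs
      · exact ih _ (by rw [List.length_dropLast, List.length_cons]; omega) _ rfl
      · simpa using polyBounded_C 0

end IteratedSeries

/-! ### Iterated integrals as Abel means of truncated sums -/

section AbelMean

/-- A sequence of points tending to `1` from below. -/
noncomputable def abelPoint (N : ℕ) : ℝ := 1 - 1 / ((N : ℝ) + 2)

theorem abelPoint_nonneg (N : ℕ) : 0 ≤ abelPoint N := by
  rw [abelPoint, sub_nonneg, div_le_one (by positivity)]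
  linarith [(Nat.cast_nonneg N : (0 : ℝ) ≤ N)]

theorem abelPoint_lt_one (N : ℕ) : abelPoint N < 1 := by
  rw [abelPoint, sub_lt_self_iff]; positivity

theorem abs_abelPoint_lt_one (N : ℕ) : |abelPoint N| < 1 := by
  rw [abs_of_nonneg (abelPoint_nonneg N)]; exact abelPoint_lt_one N

theorem one_sub_abelPoint (N : ℕ) : 1 - abelPoint N = ((N : ℝ) + 2)⁻¹ := by
  rw [abelPoint]; ring

/-- The Abel means `(1 - t) ∑ f(M) t^M`. -/
noncomputable def abelMean (f : ℕ → ℂ) (N : ℕ) : ℂ :=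
  ((1 - abelPoint N : ℝ) : ℂ) * seriesEval (abelPoint N) (PowerSeries.mk f)

/-- The divergent sequence `-log (1 - t)`. -/
noncomputable def logScale (N : ℕ) : ℝ := Real.log ((N : ℝ) + 2)

theorem tendsto_natCast_add_two : Tendsto (fun N : ℕ => (N : ℝ) + 2) atTop atTop :=
  tendsto_atTop_add_const_right _ _ tendsto_natCast_atTop_atTop

theorem tendsto_logScale : Tendsto logScale atTop atTop :=
  Real.tendsto_log_atTop.comp tendsto_natCast_add_two

theorem logScale_nonneg (N : ℕ) : 0 ≤ logScale N :=
  Real.log_nonneg (by linarith [(Nat.cast_nonneg N : (0 : ℝ) ≤ N)])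

theorem abelMean_add {f g : ℕ → ℂ} (hf : PolyBounded (PowerSeries.mk f))
    (hg : PolyBounded (PowerSeries.mk g)) (N : ℕ) :
    abelMean (fun n => f n + g n) N = abelMean f N + abelMean g N := by
  rw [abelMean, abelMean, abelMean, ← mul_add, ← seriesEval_add hf hg (abs_abelPoint_lt_one N)]
  rfl

theorem abelMean_const_mul (c : ℂ) (f : ℕ → ℂ) (N : ℕ) :
    abelMean (fun n => c * f n) N = c * abelMean f N := by
  rw [abelMean, abelMean, mul_left_comm, seriesEval, seriesEval, ← tsum_mul_left (a := c)]
  simp only [PowerSeries.coeff_mk, mul_assoc]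

theorem polyBounded_mk_of_bounded {f : ℕ → ℂ} {C : ℝ} (hf : ∀ n, ‖f n‖ ≤ C) :
    PolyBounded (PowerSeries.mk f) :=
  ⟨C, 0, (norm_nonneg _).trans (hf 0), fun n => by simpa using hf n⟩

theorem Negligible.exists_bound {h : ℕ → ℝ} {f : ℕ → ℂ} (hf : Negligible h f) :
    ∃ C, ∀ n, ‖f n‖ ≤ C := by
  obtain ⟨C, hC⟩ := (Metric.isBounded_range_of_tendsto f hf.tendsto).exists_norm_le
  exact ⟨C, fun n => hC _ ⟨n, rfl⟩⟩

theorem tendsto_logScale_pow_div_sqrt (j : ℕ) :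
    Tendsto (fun N : ℕ => logScale N ^ j / √((N : ℝ) + 2)) atTop (𝓝 0) := by
  have := (isLittleO_log_rpow_rpow_atTop (s := 1 / 2) (j : ℝ)
    (by norm_num)).tendsto_div_nhds_zero.comp tendsto_natCast_add_two
  refine this.congr fun N => ?_
  simp only [Function.comp_apply, Real.rpow_natCast, ← Real.sqrt_eq_rpow, logScale]

/-- With `K = N + 2` the weights `(1 - t) t^M` have total mass `1`. The indices `M < √K` carry mass
`O(K^{-1/2})`, and `f` is bounded there. For `M ≥ √K` one has `log K ≤ 2 H_M`, so decay in powers of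
`H_M` becomes decay in powers of `log K`. -/
theorem Negligible.abelMean {f : ℕ → ℂ} (hf : Negligible (fun n => (harmonic n : ℝ)) f) :
    Negligible logScale (abelMean f) := by
  intro j
  obtain ⟨C, hC⟩ := hf.exists_bound
  have hC0 : 0 ≤ C := (norm_nonneg _).trans (hC 0)
  have hsqrt : Tendsto (fun N : ℕ => √((N : ℝ) + 2)) atTop atTop :=
    Real.tendsto_sqrt_atTop.comp tendsto_natCast_add_two
  have hbound : ∀ ε > 0, ∀ᶠ N : ℕ in atTop, ‖(logScale N : ℂ) ^ j * _root_.abelMean f N‖ ≤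
      2 * C * (logScale N ^ j / √((N : ℝ) + 2)) + ε := by
    intro ε hε
    -- The factor `2^j` compensates for `log K ≤ 2 H_M` raised to the power `j`.
    have hε' : 0 < ε / 2 ^ j := by positivity
    obtain ⟨M₀, hM₀⟩ := eventually_atTop.1 ((hf j).norm.eventually_le_const
      (by simpa using hε' : ‖(0 : ℂ)‖ < ε / 2 ^ j))
    filter_upwards [hsqrt.eventually_ge_atTop (M₀ : ℝ)] with N hN
    set K : ℝ := (N : ℝ) + 2 with hK
    have hK0 : 1 ≤ K := by rw [hK]; linarith [(Nat.cast_nonneg N : (0 : ℝ) ≤ N)]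
    set t := abelPoint N with ht
    have ht0 : 0 ≤ t := abelPoint_nonneg N
    have ht1 : t < 1 := abelPoint_lt_one N
    have ht2 : 1 - t = K⁻¹ := one_sub_abelPoint N
    set n₀ := ⌈√K⌉₊ with hn₀
    have hL : 0 ≤ logScale N ^ j := pow_nonneg (logScale_nonneg N) j
    have hpt : ∀ M : ℕ, logScale N ^ j * ‖f M‖ ≤
        (if M ∈ Finset.range n₀ then C * logScale N ^ j else 0) + ε := by
      intro M
      split_ifs with hM
      · have := mul_le_mul_of_nonneg_left (hC M) hL
        linarith
      · rw [Finset.mem_range, not_lt] at hM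
        have h1 : √K ≤ M := Nat.ceil_le.1 hM
        have h2 : logScale N ≤ 2 * (harmonic M : ℝ) := by
          have h3 : Real.log (√K) ≤ harmonic M := by
            refine le_trans (Real.log_le_log (Real.sqrt_pos.2 (by linarith)) ?_)
              (log_add_one_le_harmonic M)
            push_cast; linarith
          rw [Real.log_sqrt (by linarith)] at h3
          change Real.log K ≤ _
          linarith
        have h4 := hM₀ M (by exact_mod_cast hN.trans h1)
        rw [norm_mul, norm_pow, Complex.norm_real, Real.norm_of_nonneg (harmonic_nonneg M)] at h4
        calc logScale N ^ j * ‖f M‖ ≤ (2 * (harmonic M : ℝ)) ^ j * ‖f M‖ := by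
              gcongr
              exact logScale_nonneg N
          _ = 2 ^ j * ((harmonic M : ℝ) ^ j * ‖f M‖) := by rw [mul_pow]; ring
          _ ≤ 2 ^ j * (ε / 2 ^ j) := by gcongr
          _ = 0 + ε := by field_simp; ring
    have hs := (polyBounded_mk_of_bounded hC).summable_norm (abs_abelPoint_lt_one N)
    have hs1 : HasSum (fun M => logScale N ^ j * (‖f M‖ * t ^ M))
        (logScale N ^ j * ∑' M, ‖f M‖ * t ^ M) := by
      refine (Summable.hasSum (hs.congr fun M => ?_)).mul_left _
      rw [PowerSeries.coeff_mk, norm_mul, norm_pow, Complex.norm_real, ← ht,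
        Real.norm_of_nonneg ht0]
    have hs2 : HasSum (fun M => (if M ∈ Finset.range n₀ then C * logScale N ^ j else 0) + ε * t ^ M)
        (n₀ * (C * logScale N ^ j) + ε * (1 - t)⁻¹) := by
      refine HasSum.add ?_ ((hasSum_geometric_of_lt_one ht0 ht1).mul_left ε)
      have : HasSum (fun M => if M ∈ Finset.range n₀ then C * logScale N ^ j else 0)
          (∑ M ∈ Finset.range n₀, if M ∈ Finset.range n₀ then C * logScale N ^ j else 0) :=
        hasSum_sum_of_ne_finset_zero fun M hM => if_neg hM
      rwa [Finset.sum_congr rfl fun M hM => if_pos hM, Finset.sum_const, Finset.card_range,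
        nsmul_eq_mul] at this
    have hle : logScale N ^ j * ∑' M, ‖f M‖ * t ^ M ≤
        n₀ * (C * logScale N ^ j) + ε * (1 - t)⁻¹ := by
      refine hasSum_le (fun M => ?_) hs1 hs2
      have htM : t ^ M ≤ 1 := pow_le_one₀ ht0 ht1.le
      have htM0 : 0 ≤ t ^ M := pow_nonneg ht0 M
      rw [← mul_assoc]
      refine (mul_le_mul_of_nonneg_right (hpt M) htM0).trans ?_
      rw [add_mul]
      gcongr
      split_ifs
      · exact mul_le_of_le_one_right (mul_nonneg hC0 hL) htM
      · simp
    have hnorm : ‖seriesEval t (PowerSeries.mk f)‖ ≤ ∑' M, ‖f M‖ * t ^ M := by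
      refine (norm_tsum_le_tsum_norm hs).trans (le_of_eq (tsum_congr fun M => ?_))
      rw [PowerSeries.coeff_mk, norm_mul, norm_pow, Complex.norm_real, ← ht,
        Real.norm_of_nonneg ht0]
    rw [_root_.abelMean, norm_mul, norm_mul, norm_pow, Complex.norm_real, Complex.norm_real,
      Real.norm_of_nonneg (logScale_nonneg N), ← ht, ht2, Real.norm_of_nonneg (by positivity)]
    have hn0 : (n₀ : ℝ) ≤ 2 * √K := by
      have h1 := (Nat.ceil_lt_add_one (Real.sqrt_nonneg K)).le
      have h2 := Real.one_le_sqrt.2 hK0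
      linarith
    have hsq := Real.mul_self_sqrt (by linarith : 0 ≤ K)
    have hsq0 := Real.sqrt_pos.2 (by linarith : 0 < K)
    rw [ht2, inv_inv] at hle
    calc logScale N ^ j * (K⁻¹ * ‖seriesEval t (PowerSeries.mk f)‖)
        ≤ logScale N ^ j * (K⁻¹ * ∑' M, ‖f M‖ * t ^ M) := by gcongr
      _ = K⁻¹ * (logScale N ^ j * ∑' M, ‖f M‖ * t ^ M) := by ring
      _ ≤ K⁻¹ * (n₀ * (C * logScale N ^ j) + ε * K) := by gcongr
      _ ≤ K⁻¹ * (2 * √K * (C * logScale N ^ j) + ε * K) := by gcongr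
      _ = 2 * C * (logScale N ^ j / √K) + ε := by
          generalize √K = r at hsq hsq0 ⊢
          rw [← hsq]
          field_simp
  rw [tendsto_zero_iff_norm_tendsto_zero]
  refine tendsto_order.2 ⟨fun a ha => Eventually.of_forall fun N => ha.trans_le (norm_nonneg _),
    fun a ha => ?_⟩
  have h1 := (tendsto_logScale_pow_div_sqrt j).const_mul (2 * C)
  rw [mul_zero] at h1
  filter_upwards [hbound (a / 2) (by linarith), h1.eventually_lt_const (half_pos ha)] with N h2 h3
  linarith

/-! ### Coefficients of iterated integrals as truncated sums. -/

variable (Γ : Subgroup ℂˣ)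

/-- The word `x_0^{s_1 - 1} x_{σ_1} ⋯ x_0^{s_r - 1} x_{σ_r}`. -/
def xWord : List (YLetter Γ) → List (XLetter Γ)
  | [] => []
  | y :: l => List.replicate ((y.1 : ℕ) - 1) 0 ++ (y.2 : XLetter Γ) :: xWord l

/-- The word with the letters `y_{s_i, σ_i σ_{i-1}⁻¹}`, where `σ_0 = p`. -/
def relativeRatios : Γ → List (YLetter Γ) → List (YLetter Γ)
  | _, [] => []
  | p, y :: l => (y.1, y.2 * p⁻¹) :: relativeRatios y.2 l

theorem getLast?_append_xWord_ne (u : List (XLetter Γ)) (σ : Γ) (l : List (YLetter Γ)) :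
    (u ++ (σ : XLetter Γ) :: xWord Γ l).getLast? ≠ some 0 := by
  induction l generalizing u σ with
  | nil => simp [xWord]
  | cons y l ih =>
    rw [xWord, ← List.cons_append, ← List.append_assoc]
    exact ih _ _

theorem exists_xWord_eq {w : List (XLetter Γ)} (hw : w.getLast? ≠ some 0) :
    ∃ l, xWord Γ l = w := by
  induction w with
  | nil => exact ⟨[], rfl⟩
  | cons a w ih =>
    have hw' : w.getLast? ≠ some 0 := by
      rcases List.eq_nil_or_concat w with rfl | ⟨w', c, rfl⟩
      · simp
      · simpa [List.getLast?_cons] using hw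
    obtain ⟨l, hl⟩ := ih hw'
    rcases eq_or_ne a 0 with rfl | ha
    · cases l with
      | nil =>
        rw [xWord] at hl
        rw [← hl] at hw
        simp at hw
      | cons y l =>
        refine ⟨(y.1 + 1, y.2) :: l, ?_⟩
        rw [← hl, xWord, xWord, ← List.cons_append, ← List.replicate_succ]
        have : ((y.1 + 1 : ℕ+) : ℕ) - 1 = (y.1 : ℕ) - 1 + 1 := by
          have := y.1.pos
          rw [PNat.add_coe, PNat.one_coe]; omega
        rw [this]
    · obtain ⟨σ, rfl⟩ := WithZero.ne_zero_iff_exists.1 ha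
      exact ⟨(1, σ) :: l, by rw [xWord, hl]; rfl⟩

theorem coeff_iteratedSeries_zero_cons {w : List (XLetter Γ)}
    (hw : ((0 : XLetter Γ) :: w).getLast? ≠ some 0) (n : ℕ) :
    PowerSeries.coeff n (iteratedSeries Γ (0 :: w)) =
      PowerSeries.coeff n (iteratedSeries Γ w) / n := by
  rw [iteratedSeries, if_neg hw, sub_zero, letterSeries_zero, one_mul, logIntegral,
    PowerSeries.coeff_mk]

theorem coeff_iteratedSeries_coe_cons (σ : Γ) {w : List (XLetter Γ)}
    (hw : ((σ : XLetter Γ) :: w).getLast? ≠ some 0) (k : ℕ) :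
    PowerSeries.coeff (k + 1) (iteratedSeries Γ (σ :: w)) =
      (∑ m ∈ Finset.range (k + 1), PowerSeries.coeff m (iteratedSeries Γ w) *
        ((σ : ℂˣ) : ℂ) ^ (k + 1 - m)) / ((k : ℂ) + 1) := by
  rw [iteratedSeries, if_neg hw, sub_zero, letterSeries_coe, mul_comm, logIntegral,
    PowerSeries.coeff_mk, PowerSeries.coeff_mul,
    Finset.Nat.sum_antidiagonal_eq_sum_range_succ_mk, Finset.sum_range_succ]
  simp only [PowerSeries.coeff_mk, Nat.sub_self, if_true, mul_zero, add_zero]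
  push_cast
  congr 1
  refine Finset.sum_congr rfl fun m hm => ?_
  have := Finset.mem_range.1 hm
  rw [if_neg (by omega)]

theorem coeff_iteratedSeries_replicate (j : ℕ) (σ : Γ) (l : List (YLetter Γ)) (n : ℕ) :
    PowerSeries.coeff n (iteratedSeries Γ (List.replicate j 0 ++ (σ : XLetter Γ) :: xWord Γ l)) =
      PowerSeries.coeff n (iteratedSeries Γ ((σ : XLetter Γ) :: xWord Γ l)) / (n : ℂ) ^ j := by
  induction j with
  | zero => simp
  | succ j ih =>
    rw [List.replicate_succ, List.cons_append, coeff_iteratedSeries_zero_cons, ih, div_div, pow_succ]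
    exact getLast?_append_xWord_ne Γ (0 :: List.replicate j 0) σ l

/-- Expand each `ω_σ` in a geometric series and integrate termwise: each letter, `x_0` included,
divides by the current exponent, and these exponents are the summation indices. -/
theorem coeff_iteratedSeries_xWord (l : List (YLetter Γ)) (y : YLetter Γ) (k : ℕ) :
    PowerSeries.coeff (k + 1) (iteratedSeries Γ (xWord Γ (y :: l))) =
      letterTerm Γ y k * truncatedSum Γ (relativeRatios Γ y.2 l) k := by
  have reduction : ∀ (l : List (YLetter Γ)) (y : YLetter Γ) (k : ℕ),
      PowerSeries.coeff (k + 1) (iteratedSeries Γ ((y.2 : XLetter Γ) :: xWord Γ l)) =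
        ((y.2 : ℂˣ) : ℂ) ^ (k + 1) / ((k : ℂ) + 1) * truncatedSum Γ (relativeRatios Γ y.2 l) k →
      PowerSeries.coeff (k + 1) (iteratedSeries Γ (xWord Γ (y :: l))) =
        letterTerm Γ y k * truncatedSum Γ (relativeRatios Γ y.2 l) k := by
    intro l y k h
    rw [xWord, coeff_iteratedSeries_replicate, h, letterTerm]
    obtain ⟨j, hj⟩ : ∃ j, (y.1 : ℕ) = j + 1 := ⟨(y.1 : ℕ) - 1, by have := y.1.pos; omega⟩
    rw [hj, Nat.add_sub_cancel, pow_succ ((k : ℂ) + 1)]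
    push_cast
    rw [mul_comm (((k : ℂ) + 1) ^ j), ← div_div, mul_div_right_comm]
  induction l generalizing y k with
  | nil =>
    refine reduction _ _ _ ?_
    rw [coeff_iteratedSeries_coe_cons Γ _ (getLast?_append_xWord_ne Γ [] y.2 [])]
    simp [xWord, relativeRatios, truncatedSum, PowerSeries.coeff_one]
  | cons z l ih =>
    refine reduction _ _ _ ?_
    rw [coeff_iteratedSeries_coe_cons Γ _ (getLast?_append_xWord_ne Γ [] y.2 (z :: l)),
      Finset.sum_range_succ', relativeRatios, truncatedSum]
    have h0 : PowerSeries.coeff 0 (iteratedSeries Γ (xWord Γ (z :: l))) = 0 := by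
      rw [PowerSeries.coeff_zero_eq_constantCoeff_apply]
      exact constantCoeff_iteratedSeries Γ (by simp [xWord])
    rw [h0, zero_mul, add_zero, Finset.mul_sum, Finset.sum_div]
    refine Finset.sum_congr rfl fun m hm => ?_
    have hm' := Finset.mem_range.1 hm
    rw [ih]
    have hy : ((y.2 : ℂˣ) : ℂ) ≠ 0 := Units.ne_zero _
    -- The geometric series gives `y.2 ^ (k + 1 - (m + 1)) * z.2 ^ (m + 1)`; factoring out `y.2 ^ (k
    -- + 1)` leaves the ratio `z.2 * y.2⁻¹` to the power `m + 1`.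
    have hpow : ((y.2 : ℂˣ) : ℂ) ^ (k + 1) =
        ((y.2 : ℂˣ) : ℂ) ^ (k + 1 - (m + 1)) * ((y.2 : ℂˣ) : ℂ) ^ (m + 1) := by
      rw [← pow_add]; congr 1; omega
    simp only [letterTerm, Subgroup.coe_mul, Subgroup.coe_inv, Units.val_mul, Units.val_inv_eq_inv_val,
      mul_pow, inv_pow]
    rw [hpow]
    field_simp

/-- The coefficients of the iterated integral are the increments of the truncated sums, and
multiplication by `1 - t` takes increments. At a point `t < 1` the integral is therefore an Abel
mean. -/
theorem one_sub_X_mul_mk_truncatedSum (l : List (YLetter Γ)) :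
    (1 - PowerSeries.X) * PowerSeries.mk (truncatedSum Γ (relativeRatios Γ 1 l)) =
      iteratedSeries Γ (xWord Γ l) := by
  ext n
  rw [sub_mul, one_mul, map_sub]
  cases l with
  | nil =>
    cases n with
    | zero => simp [xWord, relativeRatios, truncatedSum]
    | succ n =>
      rw [PowerSeries.coeff_succ_X_mul]
      simp [xWord, relativeRatios, truncatedSum, PowerSeries.coeff_one]
  | cons y l =>
    cases n with
    | zero =>
      rw [PowerSeries.coeff_zero_X_mul, PowerSeries.coeff_mk, relativeRatios,
        truncatedSum_cons_zero, PowerSeries.coeff_zero_eq_constantCoeff_apply,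
        constantCoeff_iteratedSeries Γ (by simp [xWord]), sub_zero]
    | succ n =>
      rw [PowerSeries.coeff_succ_X_mul, coeff_iteratedSeries_xWord, PowerSeries.coeff_mk,
        PowerSeries.coeff_mk, relativeRatios, truncatedSum_cons_succ, add_sub_cancel_left]
      congr 1
      simp [letterTerm]

/-- The values of the iterated integrals at the points `abelPoint N`. -/
noncomputable def iteratedValue (w : List (XLetter Γ)) (N : ℕ) : ℂ :=
  seriesEval (abelPoint N) (iteratedSeries Γ w)

theorem iteratedValue_zero (N : ℕ) : iteratedValue Γ [0] N = 0 := by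
  have : iteratedSeries Γ [0] = 0 := by
    rw [iteratedSeries, List.getLast?_singleton, if_pos rfl, List.dropLast_singleton,
      letterSeries_zero, iteratedSeries_nil, mul_one, sub_self]
    ext n
    rw [logIntegral, PowerSeries.coeff_mk]
    simp
  rw [iteratedValue, this]
  simpa using seriesEval_C (t := abelPoint N) 0

variable [Finite Γ]

theorem polyBounded_mk_truncatedSum (w : List (YLetter Γ)) :
    PolyBounded (PowerSeries.mk (truncatedSum Γ w)) := by
  obtain ⟨C, hC, h⟩ := exists_norm_truncatedSum_le Γ w
  refine ⟨C, 1, hC, fun n => ?_⟩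
  rw [PowerSeries.coeff_mk, pow_one]
  refine (h n).trans (mul_le_mul_of_nonneg_left ?_ hC)
  rw [Real.sqrt_le_left (by positivity)]
  nlinarith [(Nat.cast_nonneg n : (0 : ℝ) ≤ n)]

theorem seriesEval_iteratedSeries_xWord (l : List (YLetter Γ)) (N : ℕ) :
    seriesEval (abelPoint N) (iteratedSeries Γ (xWord Γ l)) =
      abelMean (truncatedSum Γ (relativeRatios Γ 1 l)) N := by
  have ht := abs_abelPoint_lt_one N
  rw [← one_sub_X_mul_mk_truncatedSum, seriesEval_mul (polyBounded_one.sub polyBounded_X)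
    (polyBounded_mk_truncatedSum Γ _) ht, seriesEval_sub polyBounded_one polyBounded_X ht,
    seriesEval_one, seriesEval_X, abelMean, Complex.ofReal_sub, Complex.ofReal_one]

theorem isShuffleChar_iteratedValue : IsShuffleChar (fun _ _ => none) (iteratedValue Γ) := by
  refine ⟨funext fun N => ?_, fun u v => funext fun N => ?_⟩
  · rw [iteratedValue, iteratedSeries_nil, seriesEval_one]; rfl
  · have ht := abs_abelPoint_lt_one N
    have h1 := (isShuffleChar_iteratedSeries Γ).map_mul u v
    have h2 : ∀ s : Multiset (List (XLetter Γ)), PolyBounded (s.map (iteratedSeries Γ)).sum ∧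
        (s.map (iteratedValue Γ)).sum N =
          seriesEval (abelPoint N) (s.map (iteratedSeries Γ)).sum := by
      intro s
      induction s using Multiset.induction_on with
      | empty =>
        refine ⟨by simpa using polyBounded_C 0, ?_⟩
        have := seriesEval_C (t := abelPoint N) 0
        rw [map_zero] at this
        simpa using this.symm
      | cons w s ih =>
        rw [Multiset.map_cons, Multiset.map_cons, Multiset.sum_cons, Multiset.sum_cons]
        refine ⟨(polyBounded_iteratedSeries Γ w).add ih.1, ?_⟩
        rw [seriesEval_add (polyBounded_iteratedSeries Γ w) ih.1 ht, Pi.add_apply, ih.2]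
        rfl
    rw [evalShuffle] at h1 ⊢
    rw [(h2 _).2, h1, seriesEval_mul (polyBounded_iteratedSeries Γ _)
      (polyBounded_iteratedSeries Γ _) ht]
    rfl

theorem iteratedValue_one (N : ℕ) : iteratedValue Γ [1] N = logScale N := by
  have hx : xWord Γ [(1, 1)] = [1] := rfl
  have ht := abs_abelPoint_lt_one N
  rw [iteratedValue, seriesEval]
  have h0 : ∀ k, PowerSeries.coeff (k + 1) (iteratedSeries Γ [1]) = 1 / ((k : ℂ) + 1) := by
    intro k
    have := coeff_iteratedSeries_xWord Γ [] (1, 1) k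
    rw [hx] at this
    rw [this]
    simp [letterTerm, relativeRatios, truncatedSum]
  rw [((polyBounded_iteratedSeries Γ [1]).summable ht).tsum_eq_zero_add]
  simp only [h0]
  have h1 := Complex.hasSum_ofReal.2 (Real.hasSum_pow_div_log_of_abs_lt_one ht)
  rw [one_sub_abelPoint, Real.log_inv, neg_neg] at h1
  rw [PowerSeries.coeff_zero_eq_constantCoeff_apply, constantCoeff_iteratedSeries Γ (by simp),
    zero_mul, zero_add, logScale, ← h1.tsum_eq]
  refine tsum_congr fun n => ?_
  push_cast
  ring

/-- The Abel means of the truncated sums of a word of letters `y_{1,1}`. -/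
theorem abelMean_truncatedSum_replicate (n N : ℕ) :
    abelMean (truncatedSum Γ (List.replicate n (1, 1))) N =
      (PowerSeries.coeff n expTu).eval (logScale N : ℂ) := by
  have h1 : ∀ n, relativeRatios Γ 1 (List.replicate n (1, 1)) = List.replicate n (1, 1) := by
    intro n
    induction n with
    | zero => rfl
    | succ n ih => rw [List.replicate_succ, relativeRatios, ih]; simp
  have h2 : ∀ n, xWord Γ (List.replicate n (1, 1)) = List.replicate n 1 := by
    intro n
    induction n with
    | zero => rfl
    | succ n ih => rw [List.replicate_succ, xWord, ih]; rfl
  have h3 := seriesEval_iteratedSeries_xWord Γ (List.replicate n (1, 1)) N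
  rw [h1, h2] at h3
  -- The integral of `x_1^n` is a divided shuffle power of that of `x_1`, so this Abel mean is
  -- exactly `(log K)^n / n!`, with no error term.
  have h4 := congrFun ((isShuffleChar_iteratedValue Γ).factorial_nsmul_replicate 1 n) N
  rw [Pi.smul_apply, Pi.pow_apply, iteratedValue_one, iteratedValue, h3, nsmul_eq_mul] at h4
  rw [coeff_expTu, Polynomial.eval_mul, Polynomial.eval_C, Polynomial.eval_pow, Polynomial.eval_X,
    ← h4, inv_mul_cancel_left₀ (Nat.cast_ne_zero.2 n.factorial_ne_zero)]

end AbelMean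

/-! ### The map `ρ` and Abel means -/

section Rho

/-- `∑_{n ≥ 2} (-1)^{n-1} ζ(n) u^{n-1}`. -/
noncomputable def zetaSeries : PowerSeries ℂ :=
  PowerSeries.mk fun n => if n = 0 then 0 else (-1) ^ n * riemannZeta ((n + 1 : ℕ) : ℂ)

/-- The series is used only through its logarithmic derivative and its constant term, the form in
which it can be compared with finite products. -/
theorem derivative_seriesS :
    PowerSeries.derivative ℂ seriesS = seriesS * zetaSeries := by
  have hs : PowerSeries.HasSubst (PowerSeries.mk fun n : ℕ => if 2 ≤ n then
      (-1) ^ (n - 1) * riemannZeta n / (n : ℂ) else 0) := by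
    refine PowerSeries.HasSubst.of_constantCoeff_zero' ?_
    rw [← PowerSeries.coeff_zero_eq_constantCoeff_apply, PowerSeries.coeff_mk]
    simp
  rw [seriesS, PowerSeries.derivative_subst hs, PowerSeries.derivative_exp]
  congr 1
  ext n
  rw [PowerSeries.coeff_derivative, PowerSeries.coeff_mk, zetaSeries, PowerSeries.coeff_mk]
  have hn : ((n : ℂ) + 1) ≠ 0 := by exact_mod_cast n.succ_ne_zero
  cases n with
  | zero => simp
  | succ n =>
    rw [if_pos (by omega), if_neg (by omega), Nat.add_sub_cancel]
    push_cast at hn ⊢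
    field_simp

theorem constantCoeff_seriesS : PowerSeries.constantCoeff seriesS = 1 := by
  have hs : PowerSeries.constantCoeff (PowerSeries.mk fun n : ℕ => if 2 ≤ n then
      (-1) ^ (n - 1) * riemannZeta n / (n : ℂ) else 0) = 0 := by
    rw [← PowerSeries.coeff_zero_eq_constantCoeff_apply, PowerSeries.coeff_mk]
    simp
  refine (PowerSeries.constantCoeff_subst (PowerSeries.HasSubst.of_constantCoeff_zero' hs)
    (PowerSeries.exp ℂ)).trans ?_
  rw [finsum_eq_single _ 0]
  · simp
  · intro d hd
    have : MvPowerSeries.constantCoeff (PowerSeries.mk fun n : ℕ => if 2 ≤ n then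
      (-1) ^ (n - 1) * riemannZeta n / (n : ℂ) else 0) = 0 := hs
    rw [map_pow, this, zero_pow hd, smul_zero]

theorem derivative_seriesA :
    PowerSeries.derivative ℂ seriesA = -(seriesA * zetaSeries) := by
  have h0 : seriesA * seriesS = 1 := by
    rw [seriesA]
    exact PowerSeries.inv_mul_cancel _ (by rw [constantCoeff_seriesS]; exact one_ne_zero)
  have h1 := congrArg (PowerSeries.derivative ℂ) h0
  rw [Derivation.leibniz, derivative_seriesS, smul_eq_mul, smul_eq_mul,
    Derivation.map_one_eq_zero] at h1
  linear_combination (seriesA) * h1 - (PowerSeries.derivative ℂ seriesA + seriesA * zetaSeries) * h0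

theorem constantCoeff_seriesA : PowerSeries.constantCoeff seriesA = 1 := by
  rw [seriesA, PowerSeries.constantCoeff_inv, constantCoeff_seriesS, inv_one]

/-! ### Finite products approximating `A(u)`. -/

variable (Γ : Subgroup ℂˣ)

/-- The generating series `∏_{k ≤ M} (1 + u / k)` of the truncated sums of `y_{1,1} ^ n`. -/
noncomputable def prodSeries (M : ℕ) : PowerSeries ℂ :=
  PowerSeries.mk fun n => truncatedSum Γ (List.replicate n (1, 1)) M

/-- The logarithmic derivative of `prodSeries`. -/
noncomputable def powerSumSeries (M : ℕ) : PowerSeries ℂ :=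
  PowerSeries.mk fun n => (-1) ^ n * truncatedSum Γ [(n.succPNat, 1)] M

/-- The logarithmic derivative of `prodSeries`, without its constant term. -/
noncomputable def higherPowerSumSeries (M : ℕ) : PowerSeries ℂ :=
  PowerSeries.mk fun n => if n = 0 then 0 else (-1) ^ n * truncatedSum Γ [(n.succPNat, 1)] M

theorem prodSeries_succ (M : ℕ) : prodSeries Γ (M + 1) =
    prodSeries Γ M * (1 + PowerSeries.C (((M : ℂ) + 1)⁻¹) * PowerSeries.X) := by
  rw [mul_add, mul_one, ← mul_assoc, mul_comm (prodSeries Γ M) (PowerSeries.C _)]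
  ext n
  rw [map_add]
  cases n with
  | zero =>
    rw [PowerSeries.coeff_zero_mul_X]
    simp [prodSeries, truncatedSum]
  | succ n =>
    rw [PowerSeries.coeff_succ_mul_X, PowerSeries.coeff_C_mul]
    simp only [prodSeries, PowerSeries.coeff_mk, List.replicate_succ, truncatedSum_cons_succ]
    simp [letterTerm]

theorem powerSumSeries_succ (M : ℕ) : powerSumSeries Γ (M + 1) = powerSumSeries Γ M +
    PowerSeries.mk fun n => (-1) ^ n * (((M : ℂ) + 1)⁻¹) ^ (n + 1) := by
  ext n
  simp only [powerSumSeries, map_add, PowerSeries.coeff_mk, truncatedSum_cons_succ]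
  simp [letterTerm, truncatedSum, mul_add]

theorem mk_mul_one_add (c : ℂ) :
    (PowerSeries.mk fun n => (-1) ^ n * c ^ (n + 1)) * (1 + PowerSeries.C c * PowerSeries.X) =
      PowerSeries.C c := by
  rw [mul_add, mul_one, ← mul_assoc, mul_comm _ (PowerSeries.C c)]
  ext n
  rw [map_add]
  cases n with
  | zero => simp
  | succ n =>
    rw [PowerSeries.coeff_succ_mul_X, PowerSeries.coeff_C_mul, PowerSeries.coeff_mk,
      PowerSeries.coeff_mk, PowerSeries.coeff_C, if_neg (by omega)]
    ring

/-- The logarithmic derivatives of the factors `1 + u/k` add up, each contributing a geometric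
series in `-u/k`. -/
theorem derivative_prodSeries (M : ℕ) :
    PowerSeries.derivative ℂ (prodSeries Γ M) = prodSeries Γ M * powerSumSeries Γ M := by
  induction M with
  | zero =>
    ext n
    have h1 : powerSumSeries Γ 0 = 0 := by
      ext n; simp [powerSumSeries, truncatedSum_cons_zero]
    rw [h1, mul_zero, PowerSeries.coeff_derivative, prodSeries, PowerSeries.coeff_mk,
      List.replicate_succ, truncatedSum_cons_zero]
    simp
  | succ M ih =>
    rw [prodSeries_succ, powerSumSeries_succ, Derivation.leibniz, ih]
    have h1 : PowerSeries.derivative ℂ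
        (1 + PowerSeries.C (((M : ℂ) + 1)⁻¹) * PowerSeries.X) = PowerSeries.C (((M : ℂ) + 1)⁻¹) := by
      rw [map_add, Derivation.map_one_eq_zero, Derivation.leibniz, PowerSeries.derivative_C,
        PowerSeries.derivative_X]
      simp
    rw [h1, smul_eq_mul, smul_eq_mul]
    linear_combination (-prodSeries Γ M) * mk_mul_one_add (((M : ℂ) + 1)⁻¹)

/-- `e ^ (H u)`, for the harmonic number `H`. -/
noncomputable def expHarmonic (M : ℕ) : PowerSeries ℂ :=
  PowerSeries.mk fun n => (PowerSeries.coeff n expTu).eval ((harmonic M : ℝ) : ℂ)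

theorem derivative_expHarmonic (M : ℕ) : PowerSeries.derivative ℂ (expHarmonic M) =
    PowerSeries.C (((harmonic M : ℝ) : ℂ)) * expHarmonic M := by
  ext n
  rw [PowerSeries.coeff_derivative, PowerSeries.coeff_C_mul, expHarmonic, PowerSeries.coeff_mk,
    PowerSeries.coeff_mk, coeff_expTu, coeff_expTu, Nat.factorial_succ]
  have hn : ((n : ℂ) + 1) ≠ 0 := by exact_mod_cast n.succ_ne_zero
  have hn' : (n.factorial : ℂ) ≠ 0 := by exact_mod_cast n.factorial_ne_zero
  simp only [Polynomial.eval_mul, Polynomial.eval_C, Polynomial.eval_pow, Polynomial.eval_X]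
  push_cast
  field_simp
  ring

theorem constantCoeff_prodSeries (M : ℕ) : PowerSeries.constantCoeff (prodSeries Γ M) = 1 := by
  rw [← PowerSeries.coeff_zero_eq_constantCoeff_apply, prodSeries, PowerSeries.coeff_mk]; rfl

/-- The truncated version `∏_{k ≤ M} e ^ (u / k) / (1 + u / k)` of `seriesA`. -/
noncomputable def truncatedSeriesA (M : ℕ) : PowerSeries ℂ :=
  expHarmonic M * (prodSeries Γ M)⁻¹

theorem truncatedSeriesA_mul (M : ℕ) : truncatedSeriesA Γ M * prodSeries Γ M = expHarmonic M := by
  rw [truncatedSeriesA, mul_assoc, PowerSeries.inv_mul_cancel, mul_one]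
  rw [constantCoeff_prodSeries]; exact one_ne_zero

theorem constantCoeff_truncatedSeriesA (M : ℕ) :
    PowerSeries.constantCoeff (truncatedSeriesA Γ M) = 1 := by
  rw [truncatedSeriesA, map_mul, PowerSeries.constantCoeff_inv, constantCoeff_prodSeries, inv_one,
    mul_one, ← PowerSeries.coeff_zero_eq_constantCoeff_apply, expHarmonic, PowerSeries.coeff_mk,
    coeff_expTu]
  simp

theorem powerSumSeries_eq (M : ℕ) : powerSumSeries Γ M =
    PowerSeries.C ((harmonic M : ℝ) : ℂ) + higherPowerSumSeries Γ M := by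
  ext n
  rw [map_add, powerSumSeries, higherPowerSumSeries, PowerSeries.coeff_mk, PowerSeries.coeff_mk,
    PowerSeries.coeff_C]
  cases n with
  | zero =>
    have : truncatedSum Γ [(Nat.succPNat 0, 1)] M = _ := truncatedSum_singleton_one Γ M
    simpa using this
  | succ n => simp

/-- The logarithmic derivative of `e^{H u}` is the constant `H`, which cancels the only divergent
coefficient of that of the product. -/
theorem derivative_truncatedSeriesA (M : ℕ) : PowerSeries.derivative ℂ (truncatedSeriesA Γ M) =
    -(truncatedSeriesA Γ M * higherPowerSumSeries Γ M) := by
  have h1 := congrArg (PowerSeries.derivative ℂ) (truncatedSeriesA_mul Γ M)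
  rw [Derivation.leibniz, derivative_prodSeries, derivative_expHarmonic, ← truncatedSeriesA_mul Γ M,
    smul_eq_mul, smul_eq_mul, powerSumSeries_eq] at h1
  have h2 : prodSeries Γ M ≠ 0 := by
    intro h
    have := constantCoeff_prodSeries Γ M
    rw [h, map_zero] at this
    exact zero_ne_one this
  refine mul_right_cancel₀ h2 ?_
  linear_combination h1

/-- For `n ≥ 1` the power sum belongs to the convergent letter `y_{n+1,1}`, which supplies the
negligible error; its limit is identified as `ζ(n+1)`. -/
theorem hasExpansion_higherPowerSumSeries [Finite Γ] (n : ℕ) :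
    HasExpansion (fun n => (harmonic n : ℝ))
      (fun M => PowerSeries.coeff n (higherPowerSumSeries Γ M))
      (Polynomial.C (PowerSeries.coeff n zetaSeries)) := by
  simp only [higherPowerSumSeries, zetaSeries, PowerSeries.coeff_mk]
  split_ifs with hn
  · exact hasExpansion_const 0
  · have hne : [((n.succPNat, 1) : YLetter Γ)].head? ≠ some (1, 1) := by
      intro h
      have h1 : (n.succPNat : ℕ) = 1 :=
        congrArg (fun x : YLetter Γ => (x.1 : ℕ)) (Option.some_inj.1 h)
      rw [Nat.succPNat_coe] at h1
      omega
    obtain ⟨l, hl⟩ := truncatedSum_hasExpansion_of_head?_ne Γ hne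
    have h1 : HasSum (fun k : ℕ => (1 : ℂ) / ((k : ℂ) + 1) ^ (n + 1))
        (riemannZeta ((n + 1 : ℕ) : ℂ)) := by
      have hs : Summable fun k : ℕ => (1 : ℂ) / (k : ℂ) ^ (n + 1) := by
        have h2 : Summable fun k : ℕ => 1 / (k : ℝ) ^ (n + 1) :=
          Real.summable_one_div_nat_pow.2 (by omega)
        refine Summable.of_norm (h2.congr fun k => ?_)
        rw [norm_div, norm_one, norm_pow, Complex.norm_natCast]
      rw [zeta_nat_eq_tsum_of_gt_one (by omega), hs.tsum_eq_zero_add]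
      have h2 := ((summable_nat_add_iff 1).2 hs).hasSum
      simpa using h2
    have h2 := h1.tendsto_sum_nat
    have h3 : l = riemannZeta ((n + 1 : ℕ) : ℂ) := by
      refine tendsto_nhds_unique hl.tendsto (h2.congr fun M => ?_)
      simp [truncatedSum, letterTerm]
    rw [← h3, map_mul]
    exact (hasExpansion_const _).mul hl

/-- The equation `F' = -F G` is a recursion expressing the coefficients of `F` polynomially through
those of `G`. It is the same for the truncated series and for `A`, so the expansions propagate from
the power sums. -/
theorem hasExpansion_truncatedSeriesA [Finite Γ] (n : ℕ) :
    HasExpansion (fun n => (harmonic n : ℝ)) (fun M => PowerSeries.coeff n (truncatedSeriesA Γ M))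
      (Polynomial.C (PowerSeries.coeff n seriesA)) := by
  induction n using Nat.strong_induction_on with
  | _ n ih =>
    cases n with
    | zero =>
      simp only [PowerSeries.coeff_zero_eq_constantCoeff_apply, constantCoeff_truncatedSeriesA,
        constantCoeff_seriesA]
      exact hasExpansion_const 1
    | succ n =>
      have hn : ((n : ℂ) + 1) ≠ 0 := by exact_mod_cast n.succ_ne_zero
      have hA : ∀ F G : PowerSeries ℂ, PowerSeries.derivative ℂ F = -(F * G) →
          PowerSeries.coeff (n + 1) F = ∑ p ∈ Finset.HasAntidiagonal.antidiagonal n,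
            -((n : ℂ) + 1)⁻¹ * (PowerSeries.coeff p.1 F * PowerSeries.coeff p.2 G) := by
        intro F G h
        have := congrArg (PowerSeries.coeff n) h
        rw [PowerSeries.coeff_derivative, map_neg, PowerSeries.coeff_mul] at this
        rw [← Finset.mul_sum, eq_div_of_mul_eq hn this]
        field_simp
      have h1 : PowerSeries.coeff (n + 1) seriesA = _ := hA _ _ derivative_seriesA
      have h2 : ∀ M, PowerSeries.coeff (n + 1) (truncatedSeriesA Γ M) = _ :=
        fun M => hA _ _ (derivative_truncatedSeriesA Γ M)
      simp only [h1, h2, map_sum, map_mul]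
      refine HasExpansion.sum fun p hp => ?_
      have hp' := Finset.HasAntidiagonal.mem_antidiagonal.1 hp
      exact ((ih p.1 (by omega)).mul (hasExpansion_higherPowerSumSeries Γ p.2)).const_mul _

/-! ### Abel means of polynomials in the harmonic numbers. -/

theorem PolyBounded.mk_mul {f g : ℕ → ℂ} (hf : PolyBounded (PowerSeries.mk f))
    (hg : PolyBounded (PowerSeries.mk g)) : PolyBounded (PowerSeries.mk fun n => f n * g n) := by
  obtain ⟨C, k, hC, h⟩ := hf
  obtain ⟨D, l, hD, h'⟩ := hg
  simp only [PowerSeries.coeff_mk] at h h'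
  refine ⟨C * D, k + l, by positivity, fun n => ?_⟩
  rw [PowerSeries.coeff_mk, norm_mul]
  calc _ ≤ (C * ((n : ℝ) + 1) ^ k) * (D * ((n : ℝ) + 1) ^ l) :=
        mul_le_mul (h n) (h' n) (norm_nonneg _) (by positivity)
    _ = _ := by ring

theorem PolyBounded.mk_sum {ι : Type*} {s : Finset ι} {F : ι → ℕ → ℂ}
    (hF : ∀ i ∈ s, PolyBounded (PowerSeries.mk (F i))) :
    PolyBounded (PowerSeries.mk fun n => ∑ i ∈ s, F i n) := by
  classical
  induction s using Finset.induction_on with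
  | empty => simpa using polyBounded_mk_of_bounded (f := fun _ => 0) (C := 0) (by simp)
  | insert a s ha ih =>
    simp only [Finset.sum_insert ha]
    exact (hF a (by simp)).add (ih fun i hi => hF i (by simp [hi]))

theorem abelMean_sum {ι : Type*} {s : Finset ι} {F : ι → ℕ → ℂ}
    (hF : ∀ i ∈ s, PolyBounded (PowerSeries.mk (F i))) (N : ℕ) :
    abelMean (fun n => ∑ i ∈ s, F i n) N = ∑ i ∈ s, abelMean (F i) N := by
  classical
  induction s using Finset.induction_on with
  | empty => simpa using abelMean_const_mul 0 (fun _ => 0) N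
  | insert a s ha ih =>
    simp only [Finset.sum_insert ha]
    rw [abelMean_add (hF a (by simp)) (PolyBounded.mk_sum fun i hi => hF i (by simp [hi])),
      ih fun i hi => hF i (by simp [hi])]

theorem polyBounded_mk_harmonic :
    PolyBounded (PowerSeries.mk fun n => ((harmonic n : ℝ) : ℂ)) := by
  have := polyBounded_mk_truncatedSum (⊥ : Subgroup ℂˣ) [(1, 1)]
  rwa [funext (truncatedSum_singleton_one (⊥ : Subgroup ℂˣ))] at this

theorem polyBounded_mk_eval_harmonic (P : Polynomial ℂ) :
    PolyBounded (PowerSeries.mk fun n => P.eval ((harmonic n : ℝ) : ℂ)) := by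
  induction P using Polynomial.induction_on' with
  | add P Q hP hQ => simp only [Polynomial.eval_add]; exact hP.add hQ
  | monomial n a =>
    simp only [Polynomial.eval_monomial]
    refine (polyBounded_mk_of_bounded (f := fun _ => a) fun _ => le_rfl).mk_mul ?_
    induction n with
    | zero =>
      simp only [pow_zero]
      exact polyBounded_mk_of_bounded (f := fun _ => 1) fun _ => le_rfl
    | succ n ih =>
      simp only [pow_succ]
      exact ih.mk_mul polyBounded_mk_harmonic

/-- Write `e^{H_M u} = A_M(u) ∏ (1 + u/k)`. Replacing `A_M` by `A` costs a negligible error even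
after multiplication by the product, whose coefficients have expansions in `H_M`. What remains has
the exact Abel mean `A(u) e^{u log K}`, which is how `ρ` enters. -/
theorem abelMean_coeff_expTu (n : ℕ) :
    HasExpansion logScale
      (abelMean fun M => (PowerSeries.coeff n expTu).eval ((harmonic M : ℝ) : ℂ))
      (rho (PowerSeries.coeff n expTu)) := by
  -- The statement involves only words in `y_{1,1}`, so the trivial group suffices.
  set Γ : Subgroup ℂˣ := ⊥
  have h1 : ∀ M, (PowerSeries.coeff n expTu).eval ((harmonic M : ℝ) : ℂ) =
      ∑ p ∈ Finset.HasAntidiagonal.antidiagonal n,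
        (PowerSeries.coeff p.1 seriesA * truncatedSum Γ (List.replicate p.2 (1, 1)) M +
        truncatedSum Γ (List.replicate p.2 (1, 1)) M *
          (PowerSeries.coeff p.1 (truncatedSeriesA Γ M) - PowerSeries.coeff p.1 seriesA)) := by
    intro M
    have := congrArg (PowerSeries.coeff n) (truncatedSeriesA_mul Γ M)
    rw [expHarmonic, PowerSeries.coeff_mk, PowerSeries.coeff_mul] at this
    rw [← this]
    refine Finset.sum_congr rfl fun p _ => ?_
    rw [prodSeries, PowerSeries.coeff_mk]; ring
  have hneg : ∀ p : ℕ × ℕ, Negligible (fun n => (harmonic n : ℝ)) fun M =>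
      truncatedSum Γ (List.replicate p.2 (1, 1)) M *
        (PowerSeries.coeff p.1 (truncatedSeriesA Γ M) - PowerSeries.coeff p.1 seriesA) := by
    intro p
    refine (hasExpansion_polylogPoly Γ _).negligible_mul ?_
    have : Negligible _ _ := hasExpansion_truncatedSeriesA Γ p.1
    simpa only [Polynomial.eval_C] using this
  have hb1 : ∀ p : ℕ × ℕ, PolyBounded (PowerSeries.mk fun M =>
      PowerSeries.coeff p.1 seriesA * truncatedSum Γ (List.replicate p.2 (1, 1)) M) := fun p =>
    (polyBounded_mk_of_bounded (f := fun _ => PowerSeries.coeff p.1 seriesA) fun _ => le_rfl).mk_mul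
      (polyBounded_mk_truncatedSum Γ _)
  have hb2 : ∀ p : ℕ × ℕ, PolyBounded (PowerSeries.mk fun M =>
      truncatedSum Γ (List.replicate p.2 (1, 1)) M *
        (PowerSeries.coeff p.1 (truncatedSeriesA Γ M) - PowerSeries.coeff p.1 seriesA)) := fun p =>
    (hneg p).exists_bound.elim fun C hC => polyBounded_mk_of_bounded hC
  simp only [h1]
  rw [rho_expTu, PowerSeries.coeff_mul]
  refine (HasExpansion.sum (F := fun p N => PowerSeries.coeff p.1 seriesA *
    (PowerSeries.coeff p.2 expTu).eval (logScale N : ℂ) + abelMean (fun M =>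
      truncatedSum Γ (List.replicate p.2 (1, 1)) M *
        (PowerSeries.coeff p.1 (truncatedSeriesA Γ M) - PowerSeries.coeff p.1 seriesA)) N)
    fun p _ => ?_).congr fun N => ?_
  · rw [PowerSeries.coeff_map, ← add_zero (_ * _)]
    exact ((hasExpansion_eval _).const_mul _).add (hasExpansion_zero_iff.2 (hneg p).abelMean)
  · have hb : ∀ p ∈ Finset.HasAntidiagonal.antidiagonal n, PolyBounded (PowerSeries.mk fun M =>
        PowerSeries.coeff p.1 seriesA * truncatedSum Γ (List.replicate p.2 (1, 1)) M +
        truncatedSum Γ (List.replicate p.2 (1, 1)) M *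
          (PowerSeries.coeff p.1 (truncatedSeriesA Γ M) - PowerSeries.coeff p.1 seriesA)) :=
      fun p _ => (hb1 p).add (hb2 p)
    rw [abelMean_sum hb]
    refine Finset.sum_congr rfl fun p _ => ?_
    rw [abelMean_add (hb1 p) (hb2 p), abelMean_const_mul, abelMean_truncatedSum_replicate]

theorem abelMean_eval_harmonic (P : Polynomial ℂ) :
    HasExpansion logScale (abelMean fun M => P.eval ((harmonic M : ℝ) : ℂ)) (rho P) := by
  induction P using Polynomial.induction_on' with
  | add P Q hP hQ =>
    rw [map_add]
    refine (hP.add hQ).congr fun N => ?_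
    simp only [Polynomial.eval_add]
    rw [abelMean_add (polyBounded_mk_eval_harmonic P) (polyBounded_mk_eval_harmonic Q)]
  | monomial n a =>
    have h : Polynomial.monomial n a =
        (a * n.factorial) • PowerSeries.coeff n expTu := by
      rw [coeff_expTu, Polynomial.smul_eq_C_mul, ← mul_assoc, ← Polynomial.C_mul, mul_assoc,
        mul_inv_cancel₀ (Nat.cast_ne_zero.2 n.factorial_ne_zero), mul_one,
        Polynomial.C_mul_X_pow_eq_monomial]
    rw [h, map_smul, Polynomial.smul_eq_C_mul, Polynomial.smul_eq_C_mul]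
    refine ((abelMean_coeff_expTu n).const_mul _).congr fun N => ?_
    simp only [Polynomial.eval_mul, Polynomial.eval_C]
    rw [abelMean_const_mul]

/-- Abel means transform expansions in the harmonic numbers by `ρ`. -/
theorem HasExpansion.abelMean {f : ℕ → ℂ} {P : Polynomial ℂ}
    (hf : HasExpansion (fun n => (harmonic n : ℝ)) f P) :
    HasExpansion logScale (abelMean f) (rho P) := by
  have h : Negligible _ _ := hf
  have h1 := (abelMean_eval_harmonic P).add (hasExpansion_zero_iff.2 h.abelMean)
  rw [add_zero] at h1
  refine h1.congr fun N => ?_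
  obtain ⟨C, hC⟩ := h.exists_bound
  rw [← abelMean_add (polyBounded_mk_eval_harmonic P) (polyBounded_mk_of_bounded hC)]
  congr 1
  funext n
  ring

end Rho

/-! ### Iterated integrals over simplices -/

section Simplex

/-- The simplex `s ≥ t_1 ≥ ⋯ ≥ t_r ≥ 0`. -/
def simplexUpTo (r : ℕ) (s : ℝ) : Set (Fin r → ℝ) :=
  {t | (∀ i, t i ∈ Set.Icc (0 : ℝ) s) ∧ Antitone t}

theorem measurableSet_simplexUpTo (r : ℕ) (s : ℝ) : MeasurableSet (simplexUpTo r s) := by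
  have h : simplexUpTo r s = (⋂ i, {t : Fin r → ℝ | t i ∈ Set.Icc (0 : ℝ) s}) ∩
      ⋂ i, ⋂ j, ⋂ _ : i ≤ j, {t : Fin r → ℝ | t j ≤ t i} := by
    ext t
    simp only [simplexUpTo, Antitone, Set.mem_inter_iff, Set.mem_iInter]
    rfl
  rw [h]
  refine (MeasurableSet.iInter fun i => ?_).inter
    (MeasurableSet.iInter fun i => MeasurableSet.iInter fun j => MeasurableSet.iInter fun _ => ?_)
  · exact (measurable_pi_apply i) measurableSet_Icc
  · exact measurableSet_le (measurable_pi_apply j) (measurable_pi_apply i)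

theorem cons_mem_simplexUpTo {r : ℕ} {s x : ℝ} {t : Fin r → ℝ} :
    (Fin.cons x t : Fin (r + 1) → ℝ) ∈ simplexUpTo (r + 1) s ↔
      x ∈ Set.Icc 0 s ∧ t ∈ simplexUpTo r x := by
  constructor
  · rintro ⟨h1, h2⟩
    refine ⟨by simpa using h1 0, fun i => ⟨by simpa using (h1 i.succ).1, ?_⟩, fun i j hij => ?_⟩
    · simpa using h2 (Fin.zero_le i.succ)
    · simpa using h2 (Fin.succ_le_succ_iff.2 hij)
  · rintro ⟨h1, h2, h3⟩
    refine ⟨fun i => ?_, fun i j hij => ?_⟩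
    · induction i using Fin.cases with
      | zero => simpa using h1
      | succ i => exact ⟨by simpa using (h2 i).1, by simpa using (h2 i).2.trans h1.2⟩
    · induction j using Fin.cases with
      | zero => rw [Fin.le_zero_iff.1 hij]
      | succ j =>
        induction i using Fin.cases with
        | zero => simpa using (h2 j).2
        | succ i => simpa using h3 (Fin.succ_le_succ_iff.1 hij)

/-- Fubini's theorem for the integral of a product over a simplex. -/
theorem integral_simplexUpTo_succ {r : ℕ} {s : ℝ} {f : Fin (r + 1) → ℝ → ℂ}
    (hf : IntegrableOn (fun t : Fin (r + 1) → ℝ => ∏ i, f i (t i)) (simplexUpTo (r + 1) s)) :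
    IntegrableOn (fun x => f 0 x * ∫ t in simplexUpTo r x, ∏ i : Fin r, f i.succ (t i))
        (Set.Icc 0 s) ∧
      ∫ t in simplexUpTo (r + 1) s, ∏ i, f i (t i) =
        ∫ x in Set.Icc 0 s, f 0 x * ∫ t in simplexUpTo r x, ∏ i : Fin r, f i.succ (t i) := by
  set F : (Fin (r + 1) → ℝ) → ℂ :=
    (simplexUpTo (r + 1) s).indicator fun t => ∏ i, f i (t i) with hF
  set φ : ℝ → ℂ := (Set.Icc 0 s).indicator fun x =>
    f 0 x * ∫ t in simplexUpTo r x, ∏ i : Fin r, f i.succ (t i) with hφ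
  set e := (MeasurableEquiv.piFinSuccAbove (fun _ : Fin (r + 1) => ℝ) 0).symm with he
  have hmp : MeasurePreserving e (volume.prod volume) volume :=
    (volume_preserving_piFinSuccAbove (fun _ : Fin (r + 1) => ℝ) 0).symm
  have hms := measurableSet_simplexUpTo (r + 1) s
  have hFint : Integrable F := hf.integrable_indicator hms
  have hF' : Integrable (F ∘ e) (volume.prod volume) :=
    (hmp.integrable_comp_emb e.measurableEmbedding).2 hFint
  have hcons : ∀ x (t : Fin r → ℝ), e (x, t) = (Fin.cons x t : Fin (r + 1) → ℝ) := fun x t => by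
    simp [he]
    rfl
  -- Once the first coordinate is `x`, the others range over the simplex up to `x`, so the indicator
  -- of the simplex factors.
  have hpt : ∀ x (t : Fin r → ℝ), F (e (x, t)) = (Set.Icc 0 s).indicator (f 0) x *
      (simplexUpTo r x).indicator (fun t => ∏ i : Fin r, f i.succ (t i)) t := by
    intro x t
    rw [hcons, hF]
    by_cases hx : x ∈ Set.Icc 0 s
    · by_cases ht : t ∈ simplexUpTo r x
      · rw [Set.indicator_of_mem (cons_mem_simplexUpTo.2 ⟨hx, ht⟩), Set.indicator_of_mem hx,
          Set.indicator_of_mem ht, Fin.prod_univ_succ]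
        simp
      · rw [Set.indicator_of_notMem (fun h => ht (cons_mem_simplexUpTo.1 h).2),
          Set.indicator_of_notMem ht, mul_zero]
    · rw [Set.indicator_of_notMem (fun h => hx (cons_mem_simplexUpTo.1 h).1),
        Set.indicator_of_notMem hx, zero_mul]
  have hinner : ∀ x, ∫ t : Fin r → ℝ, (F ∘ e) (x, t) = φ x := by
    intro x
    simp only [Function.comp_apply, hpt]
    rw [integral_const_mul, integral_indicator (measurableSet_simplexUpTo r x), hφ]
    by_cases hx : x ∈ Set.Icc 0 s
    · rw [Set.indicator_of_mem hx, Set.indicator_of_mem hx]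
    · rw [Set.indicator_of_notMem hx, Set.indicator_of_notMem hx, zero_mul]
  constructor
  · rw [← integrable_indicator_iff measurableSet_Icc]
    exact hF'.integral_prod_left.congr (Eventually.of_forall hinner)
  · rw [← integral_indicator hms, ← integral_indicator measurableSet_Icc, ← hF, ← hφ,
      ← hmp.integral_comp e.measurableEmbedding]
    exact (integral_prod _ hF').trans (integral_congr_ae (Eventually.of_forall hinner))

/-- Convergence of the Beta integral `B(δ, δ)`. -/
theorem integrableOn_rpow_mul_rpow {δ : ℝ} (hδ : 0 < δ) :
    IntegrableOn (fun x : ℝ => x ^ (δ - 1) * (1 - x) ^ (δ - 1)) (Set.Ioo 0 1) := by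
  have h := Complex.betaIntegral_convergent (u := δ) (v := δ) (by simpa) (by simpa)
  rw [intervalIntegrable_iff_integrableOn_Ioo_of_le zero_le_one] at h
  refine (IntegrableOn.congr_fun h.norm (fun x hx => ?_) measurableSet_Ioo)
  have h1 : (0 : ℝ) < 1 - x := by linarith [hx.2]
  have h2 : (1 - (x : ℂ)) = ((1 - x : ℝ) : ℂ) := by push_cast; rfl
  simp only [norm_mul]
  rw [h2, Complex.norm_cpow_eq_rpow_re_of_pos hx.1, Complex.norm_cpow_eq_rpow_re_of_pos h1]
  simp

/-- Integrability over a simplex of a product of functions with at most simple poles at `0` and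
`1`, the first one having no pole at `1` and the last one none at `0`. -/
theorem integrableOn_simplexUpTo {r : ℕ} {s : ℝ} (hs : s ≤ 1) {f : Fin (r + 1) → ℝ → ℂ}
    (hm : ∀ i, Measurable (f i))
    (hf : ∀ i, ∃ C, ∀ x ∈ Set.Ioo (0 : ℝ) 1, x ≤ s → ‖f i x‖ ≤ C * (x⁻¹ * (1 - x)⁻¹ *
      ((if i = 0 then 1 - x else 1) * (if i = Fin.last r then x else 1)))) :
    IntegrableOn (fun t : Fin (r + 1) → ℝ => ∏ i, f i (t i)) (simplexUpTo (r + 1) s) := by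
  choose C hC using hf
  -- The zero of the first factor at `1` is shared equally among all variables: on the simplex `1 -
  -- t_1 = ∏ (1 - t_1)^δ ≤ ∏ (1 - t_i)^δ`. The same works for the last variable at `0`. The
  -- integrand is then dominated by a product of Beta densities in separate variables.
  set δ : ℝ := 1 / ((r : ℝ) + 1) with hδ
  have hδ0 : 0 < δ := by positivity
  set U : Set (Fin (r + 1) → ℝ) := Set.univ.pi fun _ => Set.Ioo (0 : ℝ) 1 with hU
  have hUm : MeasurableSet U := MeasurableSet.univ_pi fun _ => measurableSet_Ioo
  have hms := measurableSet_simplexUpTo (r + 1) s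
  -- The faces `t_i = 0` and `t_i = 1`, where the bounds say nothing, have measure zero.
  have hae : simplexUpTo (r + 1) s =ᵐ[volume] (simplexUpTo (r + 1) s ∩ U : Set _) := by
    have h1 : simplexUpTo (r + 1) s ⊆
        (Set.Icc (fun _ => 0) (fun _ => 1) : Set (Fin (r + 1) → ℝ)) := fun t ht =>
      ⟨fun i => (ht.1 i).1, fun i => (ht.1 i).2.trans hs⟩
    have h2 : U =ᵐ[volume] (Set.Icc (fun _ => 0) (fun _ => 1) : Set (Fin (r + 1) → ℝ)) :=
      Measure.univ_pi_Ioo_ae_eq_Icc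
    have h3 := (ae_eq_refl (μ := volume) (simplexUpTo (r + 1) s)).inter h2.symm
    rwa [Set.inter_eq_left.2 h1] at h3
  rw [integrableOn_congr_set_ae hae]
  have hg : IntegrableOn (fun t : Fin (r + 1) → ℝ =>
      ∏ i, (|C i| * ((t i) ^ (δ - 1) * (1 - t i) ^ (δ - 1)))) U := by
    rw [hU, IntegrableOn, volume_pi, Measure.restrict_pi_pi]
    exact Integrable.fintype_prod (f := fun i x => |C i| * (x ^ (δ - 1) * (1 - x) ^ (δ - 1)))
      fun i => (integrableOn_rpow_mul_rpow hδ0).const_mul _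
  refine (hg.mono_set Set.inter_subset_right).mono' ?_ ?_
  · exact (Finset.measurable_prod _ fun i _ =>
      (hm i).comp (measurable_pi_apply i)).aestronglyMeasurable
  refine ae_restrict_of_forall_mem (hms.inter hUm) fun t ht => ?_
  obtain ⟨⟨hts, hta⟩, htU⟩ := ht
  have ht0 : ∀ i, 0 < t i := fun i => (htU i trivial).1
  have ht1 : ∀ i, 0 < 1 - t i := fun i => sub_pos.2 (htU i trivial).2
  have hroot : ∀ x : ℝ, 0 < x → x = ∏ _i : Fin (r + 1), x ^ δ := by
    intro x hx
    rw [Finset.prod_const, Finset.card_univ, Fintype.card_fin, ← Real.rpow_natCast,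
      ← Real.rpow_mul hx.le, hδ]
    push_cast
    rw [one_div_mul_cancel (by positivity), Real.rpow_one]
  have hP0 : ∏ i, (if i = 0 then 1 - t i else 1) ≤ ∏ i, (1 - t i) ^ δ := by
    rw [Finset.prod_ite_eq' Finset.univ (0 : Fin (r + 1)), if_pos (Finset.mem_univ _)]
    nth_rewrite 1 [hroot _ (ht1 0)]
    refine Finset.prod_le_prod (fun i _ => Real.rpow_nonneg (ht1 0).le _) fun i _ => ?_
    exact Real.rpow_le_rpow (ht1 0).le (by linarith [hta (Fin.zero_le i)]) hδ0.le
  have hP1 : ∏ i, (if i = Fin.last r then t i else 1) ≤ ∏ i, (t i) ^ δ := by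
    rw [Finset.prod_ite_eq' Finset.univ (Fin.last r), if_pos (Finset.mem_univ _)]
    nth_rewrite 1 [hroot _ (ht0 (Fin.last r))]
    refine Finset.prod_le_prod (fun i _ => Real.rpow_nonneg (ht0 _).le _) fun i _ => ?_
    exact Real.rpow_le_rpow (ht0 _).le (hta (Fin.le_last i)) hδ0.le
  have hP0' : 0 ≤ ∏ i, (if i = 0 then 1 - t i else 1) :=
    Finset.prod_nonneg fun i _ => by split_ifs <;> [exact (ht1 i).le; exact zero_le_one]
  have hP1' : 0 ≤ ∏ i, (if i = Fin.last r then t i else 1) :=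
    Finset.prod_nonneg fun i _ => by split_ifs <;> [exact (ht0 i).le; exact zero_le_one]
  have hinv : 0 ≤ ∏ i, (|C i| * ((t i)⁻¹ * (1 - t i)⁻¹)) := Finset.prod_nonneg fun i _ =>
    mul_nonneg (abs_nonneg _) (mul_nonneg (inv_nonneg.2 (ht0 i).le) (inv_nonneg.2 (ht1 i).le))
  rw [norm_prod]
  calc ∏ i, ‖f i (t i)‖
      ≤ ∏ i, (|C i| * ((t i)⁻¹ * (1 - t i)⁻¹) * ((if i = 0 then 1 - t i else 1) *
          (if i = Fin.last r then t i else 1))) := by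
        refine Finset.prod_le_prod (fun i _ => norm_nonneg _) fun i _ => ?_
        refine (hC i (t i) (htU i trivial) (hts i).2).trans ?_
        rw [← mul_assoc]
        have hi0 : 0 ≤ (if i = 0 then 1 - t i else 1) := by
          split_ifs <;> [exact (ht1 i).le; exact zero_le_one]
        have hi1 : 0 ≤ (if i = Fin.last r then t i else 1) := by
          split_ifs <;> [exact (ht0 i).le; exact zero_le_one]
        have := (ht0 i).le
        have := (ht1 i).le
        gcongr
        exact le_abs_self _
    _ = (∏ i, (|C i| * ((t i)⁻¹ * (1 - t i)⁻¹))) * ((∏ i, (if i = 0 then 1 - t i else 1)) *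
          ∏ i, (if i = Fin.last r then t i else 1)) := by
        rw [Finset.prod_mul_distrib, Finset.prod_mul_distrib (f := fun i => if i = 0 then _ else _)]
    _ ≤ (∏ i, (|C i| * ((t i)⁻¹ * (1 - t i)⁻¹))) * ((∏ i, (1 - t i) ^ δ) * ∏ i, (t i) ^ δ) := by
        gcongr
        exact Finset.prod_nonneg fun i _ => Real.rpow_nonneg (ht1 i).le _
    _ = ∏ i, (|C i| * ((t i) ^ (δ - 1) * (1 - t i) ^ (δ - 1))) := by
        rw [← Finset.prod_mul_distrib, ← Finset.prod_mul_distrib]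
        refine Finset.prod_congr rfl fun i _ => ?_
        rw [Real.rpow_sub_one (ht0 i).ne', Real.rpow_sub_one (ht1 i).ne']
        have := (ht0 i).ne'
        have := (ht1 i).ne'
        field_simp

end Simplex

/-! ### The densities `ω_σ` -/

section Density

variable {Γ : Subgroup ℂˣ}

theorem omegaDensity_zero (x : ℝ) : omegaDensity (0 : XLetter Γ) x = 1 / (x : ℂ) := rfl

theorem omegaDensity_coe (σ : Γ) (x : ℝ) :
    omegaDensity (σ : XLetter Γ) x = 1 / (((σ : ℂˣ) : ℂ)⁻¹ - (x : ℂ)) := rfl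

theorem measurable_omegaDensity (a : XLetter Γ) : Measurable (omegaDensity a) := by
  rcases eq_or_ne a 0 with rfl | ha
  · change Measurable fun x : ℝ => 1 / (x : ℂ)
    fun_prop
  · obtain ⟨σ, rfl⟩ := WithZero.ne_zero_iff_exists.1 ha
    change Measurable fun x : ℝ => 1 / (((σ : ℂˣ) : ℂ)⁻¹ - (x : ℂ))
    fun_prop

theorem getLast?_ne_of_cons {a b : XLetter Γ} {w : List (XLetter Γ)}
    (hw : (a :: w).getLast? ≠ some b) : w.getLast? ≠ some b := by
  rcases List.eq_nil_or_concat w with rfl | ⟨w', c, rfl⟩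
  · simp
  · simpa [List.getLast?_cons] using hw

/-- The iterated integral of a word over the simplex with `t_1 ≤ s`. -/
noncomputable def simplexIntegral (w : List (XLetter Γ)) (s : ℝ) : ℂ :=
  ∫ t in simplexUpTo w.length s, ∏ i, omegaDensity (w.get i) (t i)

theorem simplexIntegral_nil (s : ℝ) : simplexIntegral ([] : List (XLetter Γ)) s = 1 := by
  have h : simplexUpTo 0 s = Set.univ :=
    Set.eq_univ_of_forall fun t => ⟨fun i => i.elim0, fun i => i.elim0⟩
  change ∫ t in simplexUpTo 0 s, ∏ i : Fin 0, omegaDensity (([] : List (XLetter Γ)).get i) (t i) = 1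
  rw [h, Measure.restrict_univ, volume_pi, Measure.pi_of_empty]
  simp

variable [Finite Γ]

theorem norm_omegaDensity_coe_le (σ : Γ) {x : ℝ} (hx0 : 0 ≤ x) (hx1 : x < 1) :
    ‖omegaDensity (σ : XLetter Γ) x‖ ≤ (1 - x)⁻¹ := by
  rw [omegaDensity_coe, norm_div, norm_one, one_div]
  refine inv_anti₀ (sub_pos.2 hx1) ?_
  have h := norm_sub_norm_le (((σ : ℂˣ) : ℂ)⁻¹) (x : ℂ)
  rwa [norm_inv, norm_coe_subgroup, inv_one, Complex.norm_real, Real.norm_of_nonneg hx0] at h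

theorem exists_norm_omegaDensity_coe_le {σ : Γ} (hσ : σ ≠ 1) :
    ∃ C, ∀ x ∈ Set.Icc (0 : ℝ) 1, ‖omegaDensity (σ : XLetter Γ) x‖ ≤ C := by
  refine isCompact_Icc.exists_bound_of_continuousOn ?_
  change ContinuousOn (fun x : ℝ => 1 / (((σ : ℂˣ) : ℂ)⁻¹ - (x : ℂ))) _
  refine continuousOn_const.div (by fun_prop) fun x hx h => hσ ?_
  rw [sub_eq_zero] at h
  have h1 := congrArg norm h
  rw [norm_inv, norm_coe_subgroup, inv_one, Complex.norm_real, Real.norm_of_nonneg hx.1] at h1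
  rw [← h1, Complex.ofReal_one, inv_eq_one] at h
  exact Subtype.ext (Units.ext h)

/-- Here `p` and `q` stand for being the first and the last letter. A pole at `1` occurs only for
`x_1` and is out of reach when `s < 1`; a pole at `0` occurs only for `x_0`. -/
theorem exists_norm_omegaDensity_le {s : ℝ} (a : XLetter Γ) (p q : Prop) [Decidable p]
    [Decidable q] (hp : p → a ≠ 1 ∨ s < 1) (hq : q → a ≠ 0) :
    ∃ C, ∀ x ∈ Set.Ioo (0 : ℝ) 1, x ≤ s → ‖omegaDensity a x‖ ≤ C * (x⁻¹ * (1 - x)⁻¹ *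
      ((if p then 1 - x else 1) * (if q then x else 1))) := by
  rcases eq_or_ne a 0 with rfl | ha
  · refine ⟨1, fun x hx _ => ?_⟩
    rw [if_neg (fun h => hq h rfl), omegaDensity_zero, norm_div, norm_one, Complex.norm_real,
      Real.norm_of_nonneg hx.1.le, mul_one, one_mul, one_div]
    have h0 := hx.1
    have h1 : 0 < 1 - x := sub_pos.2 hx.2
    split_ifs
    · rw [mul_assoc, inv_mul_cancel₀ h1.ne', mul_one]
    · rw [mul_one]
      refine le_mul_of_one_le_right (inv_nonneg.2 h0.le) (one_le_inv_iff₀.2 ⟨h1, by linarith⟩)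
  · obtain ⟨σ, rfl⟩ := WithZero.ne_zero_iff_exists.1 ha
    have key : ∀ D : ℝ, (∀ x ∈ Set.Ioo (0 : ℝ) 1, x ≤ s → ‖omegaDensity (σ : XLetter Γ) x‖ ≤
        D * ((1 - x)⁻¹ * (if p then 1 - x else 1))) →
        ∃ C, ∀ x ∈ Set.Ioo (0 : ℝ) 1, x ≤ s → ‖omegaDensity (σ : XLetter Γ) x‖ ≤
          C * (x⁻¹ * (1 - x)⁻¹ * ((if p then 1 - x else 1) * (if q then x else 1))) := by
      intro D hD
      refine ⟨D, fun x hx hxs => (hD x hx hxs).trans ?_⟩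
      have h0 := hx.1
      have hnn : 0 ≤ D * ((1 - x)⁻¹ * (if p then 1 - x else 1)) :=
        (norm_nonneg _).trans (hD x hx hxs)
      have h1 : 1 ≤ x⁻¹ * (if q then x else 1) := by
        split_ifs
        · rw [inv_mul_cancel₀ h0.ne']
        · rw [mul_one]; exact one_le_inv_iff₀.2 ⟨h0, hx.2.le⟩
      refine (le_mul_of_one_le_right hnn h1).trans (le_of_eq ?_)
      ring
    by_cases h : p
    · simp only [if_pos h] at key ⊢
      rcases hp h with h1 | h1
      · obtain ⟨C, hC⟩ := exists_norm_omegaDensity_coe_le (σ := σ) (by rintro rfl; exact h1 rfl)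
        refine key C fun x hx _ => ?_
        rw [inv_mul_cancel₀ (sub_pos.2 hx.2).ne', mul_one]
        exact hC x (Set.Ioo_subset_Icc_self hx)
      · refine key (1 - s)⁻¹ fun x hx hxs => ?_
        rw [inv_mul_cancel₀ (sub_pos.2 hx.2).ne', mul_one]
        exact (norm_omegaDensity_coe_le σ hx.1.le hx.2).trans
          (inv_anti₀ (sub_pos.2 h1) (by linarith))
    · simp only [if_neg h] at key ⊢
      refine key 1 fun x hx _ => ?_
      rw [one_mul, mul_one]
      exact norm_omegaDensity_coe_le σ hx.1.le hx.2

theorem integrableOn_simplexUpTo_cons {a : XLetter Γ} {w : List (XLetter Γ)}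
    (hw : (a :: w).getLast? ≠ some 0) {s : ℝ} (hs : s ≤ 1) (ha : a ≠ 1 ∨ s < 1) :
    IntegrableOn (fun t : Fin (a :: w).length → ℝ => ∏ i, omegaDensity ((a :: w).get i) (t i))
      (simplexUpTo (a :: w).length s) := by
  refine integrableOn_simplexUpTo (r := w.length) hs (fun i => measurable_omegaDensity _) fun i =>
    exists_norm_omegaDensity_le _ _ _ (fun h => ?_) fun h => ?_
  · subst h; exact ha
  · subst h
    intro h0
    apply hw
    rw [List.getLast?_eq_getElem?, ← h0]
    simp

theorem simplexIntegral_cons {a : XLetter Γ} {w : List (XLetter Γ)}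
    (hw : (a :: w).getLast? ≠ some 0) {s : ℝ} (hs0 : 0 ≤ s) (hs : s ≤ 1) (ha : a ≠ 1 ∨ s < 1) :
    IntervalIntegrable (fun x => omegaDensity a x * simplexIntegral w x) volume 0 s ∧
      simplexIntegral (a :: w) s = ∫ x in (0 : ℝ)..s, omegaDensity a x * simplexIntegral w x := by
  have h := integral_simplexUpTo_succ (r := w.length)
    (f := fun i => omegaDensity ((a :: w).get i)) (integrableOn_simplexUpTo_cons hw hs ha)
  refine ⟨(intervalIntegrable_iff_integrableOn_Icc_of_le hs0).2 h.1, ?_⟩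
  rw [intervalIntegral.integral_of_le hs0, ← integral_Icc_eq_integral_Ioc]
  exact h.2

theorem seriesEval_letterSeries (a : XLetter Γ) {x : ℝ} (hx : x ∈ Set.Ioo (0 : ℝ) 1) :
    seriesEval x (letterSeries Γ a) = x * omegaDensity a x := by
  have hx0 : (x : ℂ) ≠ 0 := Complex.ofReal_ne_zero.2 hx.1.ne'
  rcases eq_or_ne a 0 with rfl | ha
  · rw [letterSeries_zero, seriesEval_one, omegaDensity_zero, mul_one_div_cancel hx0]
  · obtain ⟨σ, rfl⟩ := WithZero.ne_zero_iff_exists.1 ha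
    have habs : |x| < 1 := by rw [abs_of_pos hx.1]; exact hx.2
    have hσ : ((σ : ℂˣ) : ℂ) ≠ 0 := Units.ne_zero _
    have hn : ‖((σ : ℂˣ) : ℂ) * x‖ < 1 := by
      rw [norm_mul, norm_coe_subgroup, one_mul, Complex.norm_real]; exact habs
    have h1 : (1 : ℂ) - ((σ : ℂˣ) : ℂ) * x ≠ 0 := by
      intro h
      rw [sub_eq_zero] at h
      rw [← h, norm_one] at hn
      exact lt_irrefl _ hn
    rw [omegaDensity_coe, seriesEval,
      ((polyBounded_letterSeries Γ _).summable habs).tsum_eq_zero_add]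
    have h2 : ∀ n : ℕ, PowerSeries.coeff (n + 1) (letterSeries Γ (σ : XLetter Γ)) *
        (x : ℂ) ^ (n + 1) = ((σ : ℂˣ) : ℂ) * x * (((σ : ℂˣ) : ℂ) * x) ^ n := by
      intro n
      rw [letterSeries_coe, PowerSeries.coeff_mk, if_neg n.succ_ne_zero]; ring
    simp only [h2]
    rw [tsum_mul_left, tsum_geometric_of_norm_lt_one hn, letterSeries_coe, PowerSeries.coeff_mk,
      if_pos rfl, zero_mul, zero_add]
    have h3 : (((σ : ℂˣ) : ℂ))⁻¹ - x = (1 - ((σ : ℂˣ) : ℂ) * x) / ((σ : ℂˣ) : ℂ) := by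
      field_simp
    rw [h3]
    field_simp

/-- Both sides vanish at `0` for nonempty words and have the derivative `ω_a` times the value of the
remaining word. No regularizing term appears, because the word does not end with `x_0`. -/
theorem simplexIntegral_eq_seriesEval {w : List (XLetter Γ)} (hw : w.getLast? ≠ some 0) {s : ℝ}
    (hs0 : 0 ≤ s) (hs1 : s < 1) : simplexIntegral w s = seriesEval s (iteratedSeries Γ w) := by
  induction w generalizing s with
  | nil => rw [simplexIntegral_nil, iteratedSeries_nil, seriesEval_one]
  | cons a w ih =>
    have hw' := getLast?_ne_of_cons hw
    obtain ⟨hint, heq⟩ := simplexIntegral_cons hw hs0 hs1.le (Or.inr hs1)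
    have habs : ∀ x ∈ Set.Icc 0 s, |x| < 1 := fun x hx => by
      rw [abs_of_nonneg hx.1]; exact hx.2.trans_lt hs1
    have hpb := polyBounded_iteratedSeries Γ (a :: w)
    have hderiv : ∀ x ∈ Set.Ioo 0 s, HasDerivAt (fun x => seriesEval x (iteratedSeries Γ (a :: w)))
        (omegaDensity a x * simplexIntegral w x) x := by
      intro x hx
      have hx' : x ∈ Set.Ioo (0 : ℝ) 1 := ⟨hx.1, hx.2.trans hs1⟩
      have hx0 : (x : ℂ) ≠ 0 := Complex.ofReal_ne_zero.2 hx.1.ne'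
      have hxa := habs x (Set.Ioo_subset_Icc_self hx)
      refine (hasDerivAt_seriesEval hpb hxa).congr_deriv ?_
      have h1 := congrArg (seriesEval x) (X_mul_derivative_iteratedSeries Γ (a :: w))
      rw [backSeries, if_neg hw, sub_zero, frontSeries,
        seriesEval_mul polyBounded_X hpb.derivative hxa, seriesEval_X,
        seriesEval_mul (polyBounded_letterSeries Γ a) (polyBounded_iteratedSeries Γ w) hxa,
        seriesEval_letterSeries a hx', mul_assoc] at h1
      rw [ih hw' hx.1.le hx'.2]
      exact mul_left_cancel₀ hx0 h1
    rw [heq, intervalIntegral.integral_eq_sub_of_hasDerivAt_of_le hs0 (fun x hx =>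
      (hasDerivAt_seriesEval hpb (habs x hx)).continuousAt.continuousWithinAt) hderiv hint,
      seriesEval_zero, PowerSeries.coeff_zero_eq_constantCoeff_apply,
      constantCoeff_iteratedSeries Γ (by simp), sub_zero]

/-- The convergent iterated integrals are the limits of the values of the generating series. -/
theorem hasIteratedIntegral_of_tendsto {w : List (XLetter Γ)} (h1 : w.head? ≠ some 1)
    (hw : w.getLast? ≠ some 0) {l : ℂ} (hl : Tendsto (iteratedValue Γ w) atTop (𝓝 l)) :
    HasIteratedIntegral (fun i => w.get i) l := by
  have hval : iteratedValue Γ w = fun N => simplexIntegral w (abelPoint N) := funext fun N =>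
    (simplexIntegral_eq_seriesEval hw (abelPoint_nonneg N) (abelPoint_lt_one N)).symm
  have hset : ∀ r, orderedSimplex r = simplexUpTo r 1 := fun r => rfl
  rw [HasIteratedIntegral, hset]
  change _ ∧ simplexIntegral w 1 = l
  cases w with
  | nil =>
    refine ⟨?_, ?_⟩
    · have : IsFiniteMeasure (volume : Measure (Fin ([] : List (XLetter Γ)).length → ℝ)) := by
        change IsFiniteMeasure (volume : Measure (Fin 0 → ℝ))
        rw [volume_pi, Measure.pi_of_empty]
        infer_instance
      have hc : (fun t : Fin ([] : List (XLetter Γ)).length → ℝ =>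
          ∏ i, omegaDensity (([] : List (XLetter Γ)).get i) (t i)) = fun _ => 1 := by
        funext t; simp
      rw [hc]
      exact (integrable_const _).integrableOn
    · rw [hval] at hl
      simp only [simplexIntegral_nil] at hl ⊢
      exact tendsto_nhds_unique tendsto_const_nhds hl
  | cons a w =>
    have ha : a ≠ 1 := by simpa using h1
    refine ⟨integrableOn_simplexUpTo_cons hw le_rfl (Or.inl ha), ?_⟩
    obtain ⟨hint, heq⟩ := simplexIntegral_cons hw zero_le_one le_rfl (Or.inl ha)
    -- Integrability up to `1` makes the integral over `t_1 ≤ s` continuous at `s = 1`, so its value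
    -- there is the limit along `abelPoint`.
    have hcont := intervalIntegral.continuousOn_primitive_interval
      ((intervalIntegrable_iff_integrableOn_Icc_of_le zero_le_one).1 hint |>.mono_set
        (Set.uIcc_of_le (zero_le_one' ℝ)).le)
    rw [Set.uIcc_of_le (zero_le_one' ℝ)] at hcont
    have hlim : Tendsto abelPoint atTop (𝓝[Set.Icc 0 1] 1) := by
      refine tendsto_nhdsWithin_iff.2 ⟨?_, Eventually.of_forall fun N =>
        ⟨abelPoint_nonneg N, (abelPoint_lt_one N).le⟩⟩
      have := (tendsto_natCast_add_two.inv_tendsto_atTop).const_sub 1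
      rw [sub_zero] at this
      refine this.congr fun N => ?_
      simp [abelPoint]
    have h2 := (hcont 1 (Set.right_mem_Icc.2 zero_le_one)).tendsto.comp hlim
    rw [← heq] at h2
    refine tendsto_nhds_unique (h2.congr fun N => ?_) hl
    rw [hval]
    exact (simplexIntegral_cons hw (abelPoint_nonneg N) (abelPoint_lt_one N).le
      (Or.inl ha)).2.symm

end Density

/-! ### The regularized generating series of the iterated integrals -/

section IntegralSeries

variable (Γ : Subgroup ℂˣ)

/-- Because `A(0) = 1`, convergent values need no correction. -/
theorem rho_C (c : ℂ) : rho (Polynomial.C c) = Polynomial.C c := by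
  have h := rho_expTu 0
  have hA : PowerSeries.coeff 0 seriesA = 1 := by
    rw [PowerSeries.coeff_zero_eq_constantCoeff_apply, constantCoeff_seriesA]
  rw [PowerSeries.coeff_mul, Finset.Nat.antidiagonal_zero, Finset.sum_singleton,
    PowerSeries.coeff_map, hA, coeff_expTu] at h
  simp only [pow_zero, Nat.factorial_zero, Nat.cast_one, inv_one, map_one, mul_one] at h
  rw [← mul_one (Polynomial.C c), ← Polynomial.smul_eq_C_mul, map_smul, h]

/-! ### From integral words to polylogarithm words. -/

section Combinatorics

theorem head?_relativeRatios_ne {l : List (YLetter Γ)} (hl : (xWord Γ l).head? ≠ some 1) :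
    (relativeRatios Γ 1 l).head? ≠ some (1, 1) := by
  cases l with
  | nil => simp [relativeRatios]
  | cons y l =>
    obtain ⟨n, σ⟩ := y
    intro h
    simp only [relativeRatios, List.head?_cons, inv_one, mul_one, Option.some.injEq,
      Prod.mk.injEq] at h
    obtain ⟨rfl, rfl⟩ := h
    exact hl rfl

theorem xWord_ofFn {r : ℕ} (s : Fin r → ℕ+) (σ : Fin r → Γ) :
    xWord Γ (List.ofFn fun i => (s i, σ i)) = integralIndex s σ := by
  induction r with
  | zero => simp [xWord, integralIndex]
  | succ r ih =>
    have h := ih (fun i => s i.succ) (fun i => σ i.succ)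
    rw [integralIndex] at h ⊢
    rw [List.ofFn_succ, List.ofFn_succ, xWord, h, List.flatten_cons, List.append_assoc]
    rfl

/-- Prepending `p` and reading at `castSucc` gives the predecessor of `σ i`, uniformly including the
first index. -/
theorem relativeRatios_ofFn (p : Γ) {r : ℕ} (s : Fin r → ℕ+) (σ : Fin r → Γ) :
    relativeRatios Γ p (List.ofFn fun i => (s i, σ i)) = List.ofFn fun i : Fin r =>
      (s i, σ i * ((Fin.cons p σ : Fin (r + 1) → Γ) i.castSucc)⁻¹) := by
  induction r generalizing p with
  | zero => simp [relativeRatios]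
  | succ r ih =>
    rw [List.ofFn_succ, List.ofFn_succ, relativeRatios,
      ih (σ 0) (fun i => s i.succ) (fun i => σ i.succ)]
    congr 2
    funext i
    cases r with
    | zero => exact i.elim0
    | succ r =>
      induction i using Fin.cases with
      | zero => simp
      | succ i => simp

theorem relativeRatios_one_ofFn {r : ℕ} (s : Fin r → ℕ+) (σ : Fin r → Γ) :
    relativeRatios Γ 1 (List.ofFn fun i => (s i, σ i)) =
      List.ofFn fun i => (s i, successiveRatios σ i) := by
  rw [relativeRatios_ofFn]
  congr 1
  funext i
  cases r with
  | zero => exact i.elim0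
  | succ r =>
    induction i using Fin.cases with
    | zero => simp [successiveRatios]
    | succ i =>
      rw [← Fin.succ_castSucc, Fin.cons_succ, successiveRatios, if_neg (by simp)]
      rfl

end Combinatorics

/-! ### Regularized integrals as expansion polynomials in the logarithm. -/

section Expansion

variable [Finite Γ]

/-- This is where the two regularizations meet: the integral is an Abel mean of truncated sums, and
Abel means act on expansions by `ρ`. -/
theorem hasExpansion_iteratedValue_xWord (l : List (YLetter Γ)) :
    HasExpansion logScale (iteratedValue Γ (xWord Γ l))
      (rho (polylogPoly Γ (relativeRatios Γ 1 l))) :=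
  (hasExpansion_polylogPoly Γ _).abelMean.congr fun N =>
    (seriesEval_iteratedSeries_xWord Γ l N).symm

/-- Shuffling with `x_0`, whose regularized value is `0`, reduces to words not ending with `x_0`,
which are all of the form `xWord Γ l`. -/
theorem iteratedValue_hasExpansion (w : List (XLetter Γ)) :
    ∃ P, HasExpansion logScale (iteratedValue Γ w) P := by
  refine (isShuffleChar_iteratedValue Γ).mem_of_getLast?_ne (b := 0) (expansionSubalgebra logScale)
    ⟨0, hasExpansion_zero_iff.2 (negligible_zero.congr fun N => (iteratedValue_zero Γ N).symm)⟩
    (fun w hw => ?_) w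
  obtain ⟨l, rfl⟩ := exists_xWord_eq Γ hw
  exact ⟨_, hasExpansion_iteratedValue_xWord Γ l⟩

/-- The polynomial in the expansion of the value of a word in terms of the logarithm. -/
noncomputable def integralPoly (w : List (XLetter Γ)) : Polynomial ℂ :=
  (iteratedValue_hasExpansion Γ w).choose

theorem hasExpansion_integralPoly (w : List (XLetter Γ)) :
    HasExpansion logScale (iteratedValue Γ w) (integralPoly Γ w) :=
  (iteratedValue_hasExpansion Γ w).choose_spec

theorem isShuffleChar_integralPoly : IsShuffleChar (fun _ _ => none) (integralPoly Γ) :=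
  (isShuffleChar_iteratedValue Γ).of_hasExpansion tendsto_logScale (hasExpansion_integralPoly Γ)

theorem integralPoly_singleton_one : integralPoly Γ [1] = Polynomial.X :=
  (hasExpansion_integralPoly Γ _).unique tendsto_logScale
    (hasExpansion_self.congr fun N => (iteratedValue_one Γ N).symm)

theorem integralPoly_singleton_zero : integralPoly Γ [0] = 0 :=
  (hasExpansion_integralPoly Γ _).unique tendsto_logScale
    (hasExpansion_zero_iff.2 (negligible_zero.congr fun N => (iteratedValue_zero Γ N).symm))

theorem integralPoly_xWord (l : List (YLetter Γ)) :
    integralPoly Γ (xWord Γ l) = rho (polylogPoly Γ (relativeRatios Γ 1 l)) :=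
  (hasExpansion_integralPoly Γ _).unique tendsto_logScale (hasExpansion_iteratedValue_xWord Γ l)

/-- A word not beginning with `x_1` corresponds to a sum not beginning with `y_{1,1}`, whose
polynomial is a constant and hence fixed by `ρ`. The limit at `t → 1` is then the absolutely
convergent integral. -/
theorem integralPoly_of_head?_ne_of_getLast?_ne {w : List (XLetter Γ)} (h1 : w.head? ≠ some 1)
    (hw : w.getLast? ≠ some 0) :
    ∃ l, integralPoly Γ w = Polynomial.C l ∧ HasIteratedIntegral (fun i => w.get i) l := by
  obtain ⟨v, rfl⟩ := exists_xWord_eq Γ hw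
  obtain ⟨l, hl, -⟩ := polylogPoly_of_head?_ne Γ (head?_relativeRatios_ne Γ h1)
  have hP : integralPoly Γ (xWord Γ v) = Polynomial.C l := by rw [integralPoly_xWord, hl, rho_C]
  refine ⟨l, hP, hasIteratedIntegral_of_tendsto h1 hw ?_⟩
  have h := hasExpansion_integralPoly Γ (xWord Γ v)
  rw [hP] at h
  exact h.tendsto

theorem IsIntegralSeries.isShuffleChar {Γ : Subgroup ℂˣ} {I : NCSeries (XLetter Γ) ℂ}
    (hI : IsIntegralSeries Γ I) :
    IsShuffleChar (fun _ _ => none) fun w => I (FreeMonoid.ofList w) :=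
  (isDiagonal_iff_isShuffleChar _ _ (shuffleCoproduct_peel Γ) _).1 hI.diagonal

/-- Existence and uniqueness of the series `ℐ`. -/
theorem existsUnique_isIntegralSeries : ∃! I : NCSeries (XLetter Γ) ℂ, IsIntegralSeries Γ I := by
  refine ⟨fun w => (integralPoly Γ (FreeMonoid.toList w)).eval 0, ⟨?_, fun w h1 hw => ?_, ?_, ?_⟩,
    fun I hI => funext fun w => ?_⟩
  · exact (isDiagonal_iff_isShuffleChar _ _ (shuffleCoproduct_peel Γ) _).2
      ((isShuffleChar_integralPoly Γ).comp (Polynomial.evalRingHom 0))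
  · obtain ⟨l, h2, h3⟩ := integralPoly_of_head?_ne_of_getLast?_ne Γ h1 hw
    rw [h2, Polynomial.eval_C]
    exact h3
  · change (integralPoly Γ [0]).eval 0 = 0
    rw [integralPoly_singleton_zero, Polynomial.eval_zero]
  · change (integralPoly Γ [1]).eval 0 = 0
    rw [integralPoly_singleton_one, Polynomial.eval_X]
  · refine hI.isShuffleChar.ext_of_head?_ne_of_getLast?_ne
      ((isShuffleChar_integralPoly Γ).comp (Polynomial.evalRingHom 0)) (a := 1) (b := 0)
      one_ne_zero ?_ ?_ (fun w h1 hw => ?_) w.toList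
    · rw [integralPoly_singleton_one, Polynomial.coe_evalRingHom, Polynomial.eval_X]
      exact hI.coeff_x_one
    · rw [integralPoly_singleton_zero, map_zero]
      exact hI.coeff_x_zero
    · obtain ⟨l, h2, h3⟩ := integralPoly_of_head?_ne_of_getLast?_ne Γ h1 hw
      rw [h2, Polynomial.coe_evalRingHom, Polynomial.eval_C]
      exact (hI.convergent (FreeMonoid.ofList w) h1 hw).2.symm.trans h3.2

/-- The expansion polynomials are the coefficients of `exp(T x_1) ℐ`. -/
theorem integralPoly_eq {I : NCSeries (XLetter Γ) ℂ} (hI : IsIntegralSeries Γ I)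
    (w : List (XLetter Γ)) : integralPoly Γ w = integralSeriesT I (FreeMonoid.ofList w) := by
  refine (isShuffleChar_integralPoly Γ).ext_of_head?_ne_of_getLast?_ne
    (isShuffleChar_ofLetter_mul (by simp) hI.isShuffleChar) (a := 1) (b := 0) one_ne_zero
    ?_ ?_ (fun w h1 hw => ?_) w
  · rw [integralPoly_singleton_one, ofLetter_mul_singleton _ _ hI.diagonal.1 hI.coeff_x_one]
  · rw [integralPoly_singleton_zero,
      ofLetter_mul_singleton_of_ne _ _ zero_ne_one _ hI.coeff_x_zero]
  · obtain ⟨l, h2, h3⟩ := integralPoly_of_head?_ne_of_getLast?_ne Γ h1 hw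
    rw [h2, ofLetter_mul_eq_C _ _ h1]
    exact congrArg _ (h3.2.symm.trans (hI.convergent (FreeMonoid.ofList w) h1 hw).2)

end Expansion

/-- The comparison of the two regularizations. -/
theorem rho_stuffleRegLi [Fintype Γ] {L : NCSeries (YLetter Γ) ℂ} {I : NCSeries (XLetter Γ) ℂ}
    (hL : IsPolylogSeries Γ L) (hI : IsIntegralSeries Γ I) {r : ℕ} (s : Fin r → ℕ+)
    (σ : Fin r → Γ) :
    rho (stuffleRegLi L s (successiveRatios σ)) = shuffleRegI I (integralIndex s σ) := by
  rw [stuffleRegLi, shuffleRegI, ← polylogPoly_eq Γ hL, ← integralPoly_eq Γ hI, ← xWord_ofFn,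
    integralPoly_xWord, relativeRatios_one_ofFn]

end IntegralSeries

theorem mainTheorem10 (Γ : Subgroup ℂˣ) [Fintype Γ] :
    (∃! L : NCSeries (YLetter Γ) ℂ, IsPolylogSeries Γ L) ∧
    (∃! I : NCSeries (XLetter Γ) ℂ, IsIntegralSeries Γ I) ∧
    ∀ (L : NCSeries (YLetter Γ) ℂ) (I : NCSeries (XLetter Γ) ℂ),
      IsPolylogSeries Γ L → IsIntegralSeries Γ I →
      ∀ (r : ℕ) (s : Fin r → ℕ+) (σ : Fin r → Γ),
        rho (stuffleRegLi L s (successiveRatios σ)) = shuffleRegI I (integralIndex s σ) :=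
  ⟨existsUnique_isPolylogSeries Γ, existsUnique_isIntegralSeries Γ,
    fun _ _ hL hI _ s σ => rho_stuffleRegLi Γ hL hI s σ⟩
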